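/- **Theorem.** Let $\beta, Q, t_1,t_2,\dots,\bar t_1,\bar t_2,\dots$ be variables and let $$Z_{\beta,Q}[\boldsymbol t,\bar{\boldsymbol t}]=\sum_{\lambda}e^{\beta\kappa_\lambda/2}\,Q^{|\lambda|}\,s_\lambda[\boldsymbol t]\,s_\lambda[-\bar{\boldsymbol t}]\in\mathbb C[[\beta,Q,\boldsymbol t,\bar{\boldsymbol t}]]$$ be the generating function of double Hurwitz numbers. Here the sum is over all partitions $\lambda$, $\kappa_\lambda=\sum_{i\ge1}\lambda_i(\lambda_i-2i+1)$, and $s_\lambda[\boldsymbol t]=\det\big(h_{\lambda_i-i+j}[\boldsymbol t]\big)_{i,j}$ with $\sum_{m\ge0}h_m[\boldsymbol t]z^m=\exp\big(\sum_{k\ge1}t_kz^k\big)$ and $h_m=0$ for $m<0$. Rescale $\beta\to\hbar\beta$, $\boldsymbol t\to\hbar^{-1}\boldsymbol t$, $\bar{\boldsymbol t}\to\hbar^{-1}\bar{\boldsymbol t}$, and regard $Z_{\hbar\beta,Q}[\hbar^{-1}\boldsymbol t,\hbar^{-1}\bar{\boldsymbol t}]$ as a formal power series in $\beta,Q,\boldsymbol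 t,\bar{\boldsymbol t}$ (with constant term $1$) over the field $\mathbb C((\hbar))$ of formal Laurent series. Then there are formal power series $F_0,F_1,F_2,\dots\in\mathbb C[[\beta,Q,\boldsymbol t,\bar{\boldsymbol t}]]$ with the following properties. 1. The formal logarithm has the $\hbar$-expansion $$\log Z_{\hbar\beta,Q}[\hbar^{-1}\boldsymbol t,\hbar^{-1}\bar{\boldsymbol t}]=\hbar^{-2}F_0+F_1+\hbar^2F_2+\cdots+\hbar^{2n-2}F_n+\cdots,$$ that is, for each monomial in $\beta,Q,\boldsymbol t,\bar{\boldsymbol t}$ the coefficients of the two sides agree as Laurent series in $\hbar$. 2. For every $n\ge0$ (with $F_{-1}=0$), $$\frac{\partial F_n}{\partial\beta}=\frac12\sum_{k,l\ge1}kl\,t_kt_l\frac{\partial F_n}{\partial t_{k+l}}+\frac12\sum_{k,l\ge1}(k+l)t_{k+l}\frac{\partial^2F_{n-1}}{\partial t_k\partial t_l}+\frac12\sum_{k,l\ge1}(k+l)t_{k+l}\sum_{m=0}^n\frac{\partial F_m}{\partial t_k}\frac{\partial F_{n-m}}{\partial t_l},$$ $$F_n|_{\beta=0}=-\delta_{n0}\sum_{k\ge1}Q^k\,k\,t_k\bar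 t_k .$$ 3. These equations determine the $F_n$ recursively: for every $N\ge 0$, if formal power series $G_0,\dots,G_N\in\mathbb C[[\beta,Q,\boldsymbol t,\bar{\boldsymbol t}]]$ satisfy the equations and the initial conditions of part 2 for $n=0,\dots,N$, then $G_n=F_n$ for $n=0,\dots,N$. 4. The $F_n$ are analytic in a common domain: there is $R>0$, independent of $n$, such that for every $n$ the power series $F_n$ converges absolutely at every point of the polydisc $$\sup\Big\{\tfrac{|\beta|}{R},\ \tfrac{|Q|}{R},\ \tfrac{|t_k|}{R^{k}},\ \tfrac{|\bar t_k|}{R^{k}}\ :\ k\ge1\Big\}<1,$$ and its sum is a complex analytic function on this polydisc, regarded as the open unit ball of the Banach space of bounded families $(\beta/R,\ Q/R,\ t_k/R^k,\ \bar t_k/R^k)_{k\ge1}$ with the supremum norm. -/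

import Mathlib

noncomputable section

namespace DoubleHurwitz

/-- The variables `β`, `Q`, `t_k`, `t̄_k` (`k = 1, 2, …`). -/
inductive Var : Type
  | beta : Var
  | Q : Var
  | t : ℕ+ → Var
  | tbar : ℕ+ → Var

/-- Formal power series in `β, Q, t₁, t₂, …, t̄₁, t̄₂, …` with coefficients in `R`. -/
abbrev Series (R : Type) : Type := MvPowerSeries Var R

open MvPowerSeries in
/-- The sum of a family of formal power series, taken coefficient by coefficient. It is used only
for families in which every monomial occurs in finitely many members. -/
def formalSum {ι σ R : Type} [CommRing R] (f : ι → MvPowerSeries σ R) : MvPowerSeries σ R :=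
  fun m => ∑ᶠ i, coeff m (f i)

/-- The complete symmetric function `h_m[t]`, a polynomial in `t₁, t₂, …`:
`∑_{m ≥ 0} h_m[t] z^m = exp (∑_{k ≥ 1} t_k z^k)`, and `h_m = 0` for `m < 0`. -/
def completeH (m : ℤ) : MvPolynomial ℕ+ ℂ :=
  if m < 0 then 0
  else PowerSeries.coeff m.toNat
    ((PowerSeries.exp ℂ).subst
      (PowerSeries.mk fun k : ℕ => if h : 0 < k then MvPolynomial.X (⟨k, h⟩ : ℕ+) else 0 :
        PowerSeries (MvPolynomial ℕ+ ℂ)))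

/-- The `i`-th largest part of a partition, counted from `i = 0`, and `0` beyond the last part. -/
def part {d : ℕ} (lam : Nat.Partition d) (i : ℕ) : ℤ :=
  ((lam.parts.sort (· ≥ ·)).getD i 0 : ℕ)

/-- The Schur function `s_λ[t] = det (h_{λ_i - i + j}[t])` (Jacobi-Trudi). -/
def schur {d : ℕ} (lam : Nat.Partition d) : MvPolynomial ℕ+ ℂ :=
  Matrix.det (Matrix.of fun i j : Fin (Multiset.card lam.parts) =>
    completeH (part lam i - (i : ℤ) + (j : ℤ)))

/-- `κ_λ = ∑_{i ≥ 1} λ_i (λ_i - 2 i + 1)`; the index below starts at `0`. -/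
def kappa {d : ℕ} (lam : Nat.Partition d) : ℤ :=
  ∑ i : Fin (Multiset.card lam.parts), part lam i * (part lam i - 2 * ((i : ℤ) + 1) + 1)

open MvPowerSeries in
/-- The generating function of double Hurwitz numbers,
`Z_{β,Q}[t, t̄] = ∑_λ exp (β κ_λ / 2) Q^{|λ|} s_λ[t] s_λ[-t̄]`, the sum being over all partitions. -/
def Z : Series ℂ :=
  formalSum fun p : (Σ d : ℕ, Nat.Partition d) =>
    (PowerSeries.exp ℂ).subst (C ((kappa p.2 : ℂ) / 2) * X Var.beta : Series ℂ) *
      X Var.Q ^ p.1 *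
      MvPolynomial.aeval (fun k : ℕ+ => (X (Var.t k) : Series ℂ)) (schur p.2) *
      MvPolynomial.aeval (fun k : ℕ+ => (-X (Var.tbar k) : Series ℂ)) (schur p.2)

/-- `ħ`, as a formal Laurent series. -/
def hbar : LaurentSeries ℂ := HahnSeries.single (1 : ℤ) (1 : ℂ)

/-- The factors of the rescaling `β → ħ β`, `t → ħ⁻¹ t`, `t̄ → ħ⁻¹ t̄`, with `Q` unchanged. -/
def hbarFactor : Var → LaurentSeries ℂ
  | Var.beta => hbar
  | Var.Q => 1
  | Var.t _ => hbar⁻¹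
  | Var.tbar _ => hbar⁻¹

/-- `Z_{ħβ,Q}[ħ⁻¹ t, ħ⁻¹ t̄]`, a power series in `β, Q, t, t̄` over the Laurent series in `ħ`. -/
def Zhbar : Series (LaurentSeries ℂ) :=
  MvPowerSeries.rescale hbarFactor (MvPowerSeries.map HahnSeries.C Z)

/-- The formal logarithm of a power series with constant term `1`. -/
def formalLog {R : Type} [CommRing R] [Algebra ℚ R] (A : Series R) : Series R :=
  (PowerSeries.log R).subst (A - 1)

open MvPowerSeries in
/-- `L = ħ⁻² F₀ + F₁ + ħ² F₂ + ⋯ + ħ^(2n-2) F_n + ⋯`, as an equality of Laurent series in `ħ` for the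
coefficient of each monomial in `β, Q, t, t̄`. -/
def HasGenusExpansion (L : Series (LaurentSeries ℂ)) (F : ℕ → Series ℂ) : Prop :=
  ∀ m : Var →₀ ℕ,
    (∀ n : ℕ, (coeff m L).coeff (2 * (n : ℤ) - 2) = coeff m (F n)) ∧
    (∀ j : ℤ, (∀ n : ℕ, j ≠ 2 * (n : ℤ) - 2) → (coeff m L).coeff j = 0)

/-- The partial derivative `∂ / ∂ v`. -/
def pd (v : Var) (A : Series ℂ) : Series ℂ := MvPowerSeries.pderiv ℂ v A

open MvPowerSeries in
/-- `½ ∑_{k,l ≥ 1} k l t_k t_l ∂A/∂t_{k+l}`. -/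
def joinTerm (A : Series ℂ) : Series ℂ :=
  (1 / 2 : ℂ) • formalSum fun p : ℕ+ × ℕ+ =>
    ((p.1 : ℂ) * (p.2 : ℂ)) • (X (Var.t p.1) * X (Var.t p.2) * pd (Var.t (p.1 + p.2)) A)

open MvPowerSeries in
/-- `½ ∑_{k,l ≥ 1} (k + l) t_{k+l} ∂²A/∂t_k∂t_l`. -/
def cutTerm (A : Series ℂ) : Series ℂ :=
  (1 / 2 : ℂ) • formalSum fun p : ℕ+ × ℕ+ =>
    ((p.1 : ℂ) + (p.2 : ℂ)) • (X (Var.t (p.1 + p.2)) * pd (Var.t p.1) (pd (Var.t p.2) A))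

open MvPowerSeries in
/-- `½ ∑_{k,l ≥ 1} (k + l) t_{k+l} ∑_{a=0}^n (∂F_a/∂t_k) (∂F_{n-a}/∂t_l)`. -/
def quadTerm (F : ℕ → Series ℂ) (n : ℕ) : Series ℂ :=
  (1 / 2 : ℂ) • formalSum fun p : ℕ+ × ℕ+ =>
    ((p.1 : ℂ) + (p.2 : ℂ)) • (X (Var.t (p.1 + p.2)) *
      ∑ a ∈ Finset.range (n + 1), pd (Var.t p.1) (F a) * pd (Var.t p.2) (F (n - a)))

/-- The `n`-th cut-and-join evolution equation in `β`, with the convention `F_{-1} = 0`. -/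
def CutJoinEq (F : ℕ → Series ℂ) (n : ℕ) : Prop :=
  pd Var.beta (F n) =
    joinTerm (F n) + (if n = 0 then 0 else cutTerm (F (n - 1))) + quadTerm F n

open MvPowerSeries Classical in
/-- The restriction `A|_{β = 0}`. -/
def atBetaZero (A : Series ℂ) : Series ℂ :=
  fun m => if m Var.beta = 0 then coeff m A else 0

open MvPowerSeries in
/-- The initial condition `F_n|_{β=0} = - δ_{n0} ∑_{k ≥ 1} Q^k k t_k t̄_k`. -/
def InitialCond (F : ℕ → Series ℂ) (n : ℕ) : Prop :=
  atBetaZero (F n) =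
    if n = 0 then
      -formalSum fun k : ℕ+ =>
        (k : ℂ) • (X Var.Q ^ (k : ℕ) * X (Var.t k) * X (Var.tbar k) : Series ℂ)
    else 0

/-- Complex Banach space of bounded families `u = (u_v)` indexed by the variables, with the
supremum norm. -/
abbrev BoundedPoints : Type := lp (fun _ : Var => ℂ) (⊤ : ENNReal)

/-- `β` and `Q` have weight `1`, while `t_k` and `t̄_k` have weight `k`. -/
def weight : Var → ℕ
  | Var.beta => 1
  | Var.Q => 1
  | Var.t k => k
  | Var.tbar k => k

/-- The point `β = R u_β`, `Q = R u_Q`, `t_k = R^k u_{t_k}`, `t̄_k = R^k u_{t̄_k}`. -/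
def point (R : ℝ) (u : BoundedPoints) (v : Var) : ℂ := (R : ℂ) ^ weight v * u v

/-- The value of the monomial with exponents `m` at the point `x`. -/
def monomialValue (m : Var →₀ ℕ) (x : Var → ℂ) : ℂ := m.prod fun v e => x v ^ e

/-- The power series `A` converges absolutely in the open polydisc of radii
`|β| , |Q| < R`, `|t_k| , |t̄_k| < R^k` (the open unit ball in the coordinates `u`), and its sum is
an analytic function there. -/
def AnalyticOnPolydisc (A : Series ℂ) (R : ℝ) : Prop :=
  (∀ u ∈ Metric.ball (0 : BoundedPoints) 1,
    Summable fun m : Var →₀ ℕ => ‖MvPowerSeries.coeff m A * monomialValue m (point R u)‖) ∧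
  AnalyticOnNhd ℂ
    (fun u : BoundedPoints =>
      ∑' m : Var →₀ ℕ, MvPowerSeries.coeff m A * monomialValue m (point R u))
    (Metric.ball (0 : BoundedPoints) 1)

end DoubleHurwitz

end

/-! The proof has an algebraic half, which finds the evolution equation of log Z, and an analytic
half, which bounds its solution.

Algebra. Let H(z) = exp(∑ t_k z^k). The functional `lam α` extracts the coefficient of z^α in f(z) ∏
H(z_i). It turns ∂/∂t_k into multiplication by ∑ z_i^k, and ∑ k t_k z_i^k into α_i - E_i, where E_i
= z_i ∂/∂z_i. Applied to the Vandermonde product it gives a Schur function. The cut-and-join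
operator thus becomes an operator in the z_i in which the mixed terms α_i E_i cancel, and what
remains is a symmetric polynomial in the E_i, for which the Vandermonde product is an eigenvector.
So Schur functions are eigenvectors with eigenvalue κ_λ (`cutJoin_altSchur`, `cutJoin_schur`), and Z
satisfies the linear cut-and-join equation `pd_beta_Z`. Division by Z gives the equation of log Z
with its quadratic term (`pd_beta_logZ`). At β = 0 the sum is a Cauchy sum. Its recursion
`cauchySum_rec` follows from the Euler relation and the Murnaghan-Nakayama rule
`powerSum_mul_altSchur`, and yields the initial value of log Z.

Genus expansion. Under the rescaling every monomial acquires a power of ħ, and F_n is the part of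
log Z of ħ-degree 2n - 2. The evolution equation preserves the set of degrees 2n - 2, n ≥ 0, and the
initial value has degree -2, so no other degree occurs (`homPart_logZ`). The homogeneous parts of
the equation are the stated equations. They determine the F_n by induction on n and on the degree in
β.

Analyticity. Coefficients are replaced by their absolute values in [0, ∞], where every sum and
substitution makes sense, and inequalities propagate along the β-evolution (`le_of_pderiv_le`). The
majorants are restricted to the curve β, Q = 1, t_k = x^k / k³, t̄_k = 1 / k³. The convolution of
1/k² with itself is at most 8/n², so the join term is bounded by 8 x∂/∂x, and the quadratic term by
the flux ∑ x^k ∂F/∂t_k times x∂/∂x. In genus 0 this flux must be controlled without loss of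
derivatives. For that the equation is differentiated in t_j, and ∂F_0/∂t_j is bounded by c(x + 8β)^j
/ j², where c is the Catalan series (`momentum_le`). For n > 0 the equation is linear in F_n, with
transport coefficient the flux of F_0 and with a source from lower genus. Derivatives lost in the
source only raise the exponent in a bound M (1 - 8(x + 8β))^{-N}; the singularity stays where it is
(`tame_genusCurve`). This gives absolute convergence at one point with positive coordinates,
independent of n, hence analyticity on the ball. -/

noncomputable section

namespace DoubleHurwitz

/-! ### Complete symmetric functions -/

/-- The ring of polynomials in the times `t₁, t₂, …`. -/
abbrev TimePoly : Type := MvPolynomial ℕ+ ℂ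

/-- The power sum `(k + 1) t_{k+1}`. -/
def powerSum (k : ℕ) : TimePoly := ((k : ℂ) + 1) • MvPolynomial.X k.succPNat

theorem completeH_of_neg {m : ℤ} (hm : m < 0) : completeH m = 0 := by
  simp [completeH, hm]

/-- The series `∑ t_k z^k`. -/
def timeSeries : PowerSeries TimePoly :=
  PowerSeries.mk fun k : ℕ => if h : 0 < k then MvPolynomial.X (⟨k, h⟩ : ℕ+) else 0

theorem hasSubst_timeSeries : PowerSeries.HasSubst timeSeries :=
  PowerSeries.HasSubst.of_constantCoeff_zero' (by
    rw [← PowerSeries.coeff_zero_eq_constantCoeff_apply]; simp [timeSeries])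

theorem completeH_natCast (n : ℕ) :
    completeH n = PowerSeries.coeff n ((PowerSeries.exp TimePoly).subst timeSeries) := by
  have : ¬ ((n : ℤ) < 0) := by omega
  simp only [completeH, if_neg this, Int.toNat_natCast]
  change PowerSeries.coeff n ((PowerSeries.exp ℂ).subst timeSeries) = _
  rw [PowerSeries.coeff_subst' hasSubst_timeSeries, PowerSeries.coeff_subst' hasSubst_timeSeries]
  refine finsum_congr fun d => ?_
  simp [PowerSeries.coeff_exp, Algebra.smul_def]

theorem completeH_zero : completeH 0 = 1 := by
  have := completeH_natCast 0
  rw [Nat.cast_zero] at this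
  rw [this, PowerSeries.coeff_zero_eq_constantCoeff_apply, PowerSeries.constantCoeff_eq,
    PowerSeries.constantCoeff_subst hasSubst_timeSeries, finsum_eq_single _ 0]
  · simp
  · intro n hn
    have : PowerSeries.constantCoeff timeSeries = 0 := by
      rw [← PowerSeries.coeff_zero_eq_constantCoeff_apply]; simp [timeSeries]
    rw [PowerSeries.constantCoeff_eq] at this
    simp [this, hn]

/-- This is the coefficient of z^n in H'(z) = H(z) ∑ k t_k z^(k-1). The index of `powerSum` is one
less than that of the time. -/
theorem completeH_succ (n : ℕ) :
    ((n : TimePoly) + 1) * completeH (n + 1) =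
      ∑ k ∈ Finset.range (n + 1), powerSum k * completeH (n - k) := by
  have h := PowerSeries.derivative_subst (f := PowerSeries.exp TimePoly) hasSubst_timeSeries
  rw [PowerSeries.derivative_exp] at h
  have h' := congrArg (PowerSeries.coeff n) h
  rw [PowerSeries.coeff_derivative, PowerSeries.coeff_mul] at h'
  have e : ((n : ℤ) + 1) = ((n + 1 : ℕ) : ℤ) := by push_cast; rfl
  rw [e, completeH_natCast, mul_comm, h', ← Finset.Nat.sum_antidiagonal_swap,
    Finset.Nat.sum_antidiagonal_eq_sum_range_succ_mk]
  refine Finset.sum_congr rfl fun k hk => ?_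
  have hk' : k ≤ n := Nat.lt_succ_iff.mp (Finset.mem_range.mp hk)
  rw [show ((n : ℤ) - k) = ((n - k : ℕ) : ℤ) by omega, completeH_natCast]
  simp only [Prod.swap, PowerSeries.coeff_derivative]
  rw [mul_comm]
  congr 1
  simp [timeSeries, powerSum, MvPolynomial.smul_eq_C_mul, Nat.succPNat, mul_comm]

/-- Euler's recursion for the complete symmetric functions. -/
theorem completeH_rec {m : ℤ} {M : ℕ} (h : m ≤ M) :
    (m : ℂ) • completeH m = ∑ k ∈ Finset.range M, powerSum k * completeH (m - (k + 1)) := by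
  rcases lt_trichotomy m 0 with hm | hm | hm
  · rw [completeH_of_neg hm, smul_zero]
    refine (Finset.sum_eq_zero fun k _ => ?_).symm
    rw [completeH_of_neg (by omega), mul_zero]
  · subst hm
    rw [Int.cast_zero, zero_smul]
    refine (Finset.sum_eq_zero fun k _ => ?_).symm
    rw [completeH_of_neg (by omega), mul_zero]
  · obtain ⟨n, rfl⟩ : ∃ n : ℕ, m = n + 1 := ⟨(m - 1).toNat, by omega⟩
    have h1 := completeH_succ n
    have e : (((n : ℤ) + 1 : ℤ) : ℂ) • completeH (n + 1) =
        ((n : TimePoly) + 1) * completeH (n + 1) := by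
      rw [MvPolynomial.smul_eq_C_mul]; simp
    rw [e, h1]
    have hsub : Finset.range (n + 1) ⊆ Finset.range M := by
      intro k hk; simp only [Finset.mem_range] at *; omega
    rw [← Finset.sum_subset hsub]
    · refine Finset.sum_congr rfl fun k _ => ?_
      congr 2; ring
    · intro k _ hk
      rw [completeH_of_neg (by simp only [Finset.mem_range] at hk; omega), mul_zero]

theorem pderiv_powerSum (k l : ℕ) :
    MvPolynomial.pderiv k.succPNat (powerSum l) = if k = l then ((k : TimePoly) + 1) else 0 := by
  classical
  rw [powerSum, Derivation.map_smul, MvPolynomial.pderiv_X]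
  by_cases h : k = l
  · subst h; simp [MvPolynomial.smul_eq_C_mul]
  · have : k.succPNat ≠ l.succPNat := fun e => h (Nat.succPNat_injective e)
    simp [h, this.symm]

/-- In generating functions this is ∂H/∂t_{k+1} = z^{k+1} H. Differentiating Euler's recursion for
h_m gives the recursion for h_{m-k-1}, plus k + 1 copies of h_{m-k-1} from the factor `powerSum k`;
the total multiple is m, which is then cancelled. -/
theorem pderiv_completeH (k : ℕ) (m : ℤ) :
    MvPolynomial.pderiv k.succPNat (completeH m) = completeH (m - (k + 1)) := by
  induction' hn : m.toNat using Nat.strong_induction_on with n ih generalizing m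
  rcases lt_trichotomy m 0 with hm | hm | hm
  · rw [completeH_of_neg hm, completeH_of_neg (by omega), map_zero]
  · subst hm
    rw [completeH_zero, completeH_of_neg (by omega), Derivation.map_one_eq_zero]
  -- The range has to contain the index k, where the derivative of `powerSum` is nonzero; the
  -- recursion allows surplus terms.
  · set M : ℕ := m.toNat + k + 1 with hM
    have h1 := congrArg (MvPolynomial.pderiv k.succPNat) (completeH_rec (m := m) (M := M) (by omega))
    rw [Derivation.map_smul, map_sum] at h1
    have h2 : ∀ l ∈ Finset.range M, MvPolynomial.pderiv k.succPNat
        (powerSum l * completeH (m - (l + 1))) =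
        powerSum l * completeH (m - (k + 1) - (l + 1)) +
          if k = l then ((k : TimePoly) + 1) * completeH (m - (k + 1)) else 0 := by
      intro l _
      rw [Derivation.leibniz, pderiv_powerSum, smul_eq_mul, smul_eq_mul]
      congr 1
      · by_cases hl : m - (l + 1) < 0
        · rw [completeH_of_neg hl, completeH_of_neg (by omega), map_zero]
        · rw [ih _ (by omega) (m - (l + 1)) rfl]
          congr 2; ring
      · split_ifs with hkl
        · subst hkl; ring
        · ring
    rw [Finset.sum_congr rfl h2, Finset.sum_add_distrib, ← completeH_rec (by omega),
      Finset.sum_ite_eq, if_pos (Finset.mem_range.mpr (by omega))] at h1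
    have h3 : (m : ℂ) • completeH (m - (k + 1)) =
        ((m - (k + 1) : ℤ) : ℂ) • completeH (m - (k + 1)) +
          ((k : TimePoly) + 1) * completeH (m - (k + 1)) := by
      simp only [MvPolynomial.smul_eq_C_mul]; push_cast; simp; ring
    rw [← h3] at h1
    have hm0 : (m : ℂ) ≠ 0 := by exact_mod_cast hm.ne'
    exact smul_right_injective _ hm0 h1

/-- The Leibniz rule for a finite product. -/
theorem derivation_prod {R A ι : Type*} [CommSemiring R] [CommSemiring A] [Algebra R A]
    [DecidableEq ι] (D : Derivation R A A) (s : Finset ι) (f : ι → A) :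
    D (∏ i ∈ s, f i) = ∑ i ∈ s, (∏ j ∈ s.erase i, f j) * D (f i) := by
  induction s using Finset.induction_on with
  | empty => simp
  | insert a s ha ih =>
    rw [Finset.prod_insert ha, Derivation.leibniz, ih, Finset.sum_insert ha,
      Finset.erase_insert ha, smul_eq_mul, smul_eq_mul, add_comm, Finset.mul_sum]
    congr 1
    refine Finset.sum_congr rfl fun i hi => ?_
    have hia : a ≠ i := fun e => ha (e ▸ hi)
    rw [Finset.erase_insert_of_ne hia, Finset.prod_insert (by simp [ha]), mul_assoc]

/-! ### The functionals `Λ_α` -/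

variable {N : ℕ}

/-- The linear functional `z^c ↦ ∏ h_{α_i - c_i}`, the coefficient of `z^α` in `f(z) ∏ H(z_i)`. -/
def lam (α : Fin N → ℤ) : MvPolynomial (Fin N) ℂ →ₗ[ℂ] TimePoly :=
  (MvPolynomial.basisMonomials (Fin N) ℂ).constr ℂ
    (fun c : Fin N →₀ ℕ => ∏ i, completeH (α i - c i))

theorem lam_monomial (α : Fin N → ℤ) (c : Fin N →₀ ℕ) (r : ℂ) :
    lam α (MvPolynomial.monomial c r) = r • ∏ i, completeH (α i - c i) := by
  have : MvPolynomial.monomial c r = r • MvPolynomial.basisMonomials (Fin N) ℂ c := by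
    simp [MvPolynomial.smul_monomial]
  rw [this, map_smul, lam, Module.Basis.constr_basis]

attribute [irreducible] lam

/-- Linear maps on polynomials that agree on monomials agree. -/
theorem eq_of_monomial {M : Type*} [AddCommMonoid M] [Module ℂ M]
    {f g : MvPolynomial (Fin N) ℂ →ₗ[ℂ] M}
    (h : ∀ c : Fin N →₀ ℕ, f (MvPolynomial.monomial c 1) = g (MvPolynomial.monomial c 1))
    (p : MvPolynomial (Fin N) ℂ) : f p = g p := by
  have : f = g := (MvPolynomial.basisMonomials (Fin N) ℂ).ext fun c => by simpa using h c
  rw [this]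

/-- A property of polynomials stable under linear combinations may be checked on monomials. -/
theorem poly_induction {P : MvPolynomial (Fin N) ℂ → Prop}
    (hm : ∀ c : Fin N →₀ ℕ, P (MvPolynomial.monomial c 1))
    (hadd : ∀ p q, P p → P q → P (p + q)) (hsmul : ∀ (r : ℂ) p, P p → P (r • p))
    (p : MvPolynomial (Fin N) ℂ) : P p := by
  induction p using MvPolynomial.induction_on' with
  | monomial c r => simpa [MvPolynomial.smul_monomial] using hsmul r _ (hm c)
  | add p q hp hq => exact hadd _ _ hp hq

theorem X_pow_mul_monomial (i : Fin N) (k : ℕ) (c : Fin N →₀ ℕ) :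
    (MvPolynomial.X i ^ k * MvPolynomial.monomial c 1 : MvPolynomial (Fin N) ℂ) =
      MvPolynomial.monomial (c + Finsupp.single i k) 1 := by
  rw [MvPolynomial.X_pow_eq_monomial, MvPolynomial.monomial_mul, one_mul, add_comm]

theorem prod_completeH_single (α : Fin N → ℤ) (c : Fin N →₀ ℕ) (i : Fin N) (k : ℕ) :
    ∏ j, completeH (α j - (c + Finsupp.single i k) j) =
      completeH (α i - c i - k) * ∏ j ∈ Finset.univ.erase i, completeH (α j - c j) := by
  rw [← Finset.mul_prod_erase _ _ (Finset.mem_univ i)]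
  congr 1
  · simp; congr 1; ring
  · refine Finset.prod_congr rfl fun j hj => ?_
    have : i ≠ j := (Finset.ne_of_mem_erase hj).symm
    simp [this]

/-- Each factor H(z_i) contributes z_i^{k+1} under ∂/∂t_{k+1}, by the Leibniz rule. -/
theorem pderiv_lam (α : Fin N → ℤ) (k : ℕ) (f : MvPolynomial (Fin N) ℂ) :
    MvPolynomial.pderiv k.succPNat (lam α f) =
      lam α ((∑ i, MvPolynomial.X i ^ (k + 1)) * f) := by
  have key := eq_of_monomial
    (f := ((MvPolynomial.pderiv k.succPNat).toLinearMap : TimePoly →ₗ[ℂ] TimePoly) ∘ₗ lam α)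
    (g := lam α ∘ₗ LinearMap.mulLeft ℂ (∑ i, MvPolynomial.X i ^ (k + 1))) ?_ f
  · exact key
  intro c
  rw [LinearMap.comp_apply, LinearMap.comp_apply, LinearMap.mulLeft_apply, Finset.sum_mul,
    map_sum, lam_monomial, one_smul]
  change MvPolynomial.pderiv k.succPNat _ = _
  rw [derivation_prod]
  refine Finset.sum_congr rfl fun i _ => ?_
  rw [X_pow_mul_monomial, lam_monomial, one_smul, prod_completeH_single, pderiv_completeH,
    mul_comm]
  push_cast
  rfl

/-- The Euler operator `z_i ∂ / ∂ z_i`. -/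
def euler (i : Fin N) : Derivation ℂ (MvPolynomial (Fin N) ℂ) (MvPolynomial (Fin N) ℂ) :=
  (MvPolynomial.X i : MvPolynomial (Fin N) ℂ) • MvPolynomial.pderiv i

theorem euler_apply (i : Fin N) (f : MvPolynomial (Fin N) ℂ) :
    euler i f = MvPolynomial.X i * MvPolynomial.pderiv i f := rfl

theorem euler_monomial (i : Fin N) (c : Fin N →₀ ℕ) :
    euler i (MvPolynomial.monomial c 1 : MvPolynomial (Fin N) ℂ) =
      (c i : ℂ) • MvPolynomial.monomial c 1 := by
  rw [euler_apply, MvPolynomial.pderiv_monomial, one_mul, MvPolynomial.smul_monomial]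
  rcases Nat.eq_zero_or_pos (c i) with h | h
  · simp [h]
  · rw [MvPolynomial.X, MvPolynomial.monomial_mul]
    congr 1
    · rw [add_comm, tsub_add_cancel_of_le]
      simpa using (show 1 ≤ c i from h)
    · simp

/-- `Λ_α` intertwines `∑ k t_k z_i^k` with `α_i - z_i ∂ / ∂ z_i`. -/
theorem sum_powerSum_lam (α : Fin N → ℤ) (i : Fin N) {M : ℕ} (hM : α i ≤ M)
    (f : MvPolynomial (Fin N) ℂ) :
    ∑ k ∈ Finset.range M, powerSum k * lam α (MvPolynomial.X i ^ (k + 1) * f) =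
      lam α ((α i : ℂ) • f - euler i f) := by
  induction f using poly_induction with
  | hadd p q hp hq =>
    simp only [mul_add, map_add, smul_add, Finset.sum_add_distrib, hp, hq]
    rw [← map_add]
    congr 1
    ring
  | hsmul r p hp =>
    simp only [mul_smul_comm, LinearMap.map_smul, ← Finset.smul_sum, hp]
    rw [← map_smul, smul_sub, smul_comm, (euler i).map_smul]
  | hm c => ?_
  rw [euler_monomial, ← sub_smul, map_smul, lam_monomial, one_smul,
    ← Finset.mul_prod_erase _ _ (Finset.mem_univ i), ← smul_mul_assoc]
  have := completeH_rec (m := α i - c i) (M := M) (by omega)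
  push_cast at this
  rw [this, Finset.sum_mul]
  refine Finset.sum_congr rfl fun k _ => ?_
  rw [X_pow_mul_monomial, lam_monomial, one_smul, prod_completeH_single, mul_assoc]
  push_cast
  rfl

/-- A factor h of negative index appears. This is what makes the cut-offs of the sums over k and l
harmless. -/
theorem lam_X_pow_mul_eq_zero (α : Fin N → ℤ) (i : Fin N) {k : ℕ} (hk : α i < k)
    (f : MvPolynomial (Fin N) ℂ) : lam α (MvPolynomial.X i ^ k * f) = 0 := by
  have key := eq_of_monomial (f := lam α ∘ₗ LinearMap.mulLeft ℂ (MvPolynomial.X i ^ k))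
    (g := 0) ?_ f
  · exact key
  intro c
  rw [LinearMap.comp_apply, LinearMap.mulLeft_apply, X_pow_mul_monomial, lam_monomial,
    prod_completeH_single, completeH_of_neg (by omega)]
  simp

/-- Multiplying by `z_i^k` amounts to lowering `α_i` by `k`. -/
theorem lam_X_pow_mul (α : Fin N → ℤ) (i : Fin N) (k : ℕ) (f : MvPolynomial (Fin N) ℂ) :
    lam α (MvPolynomial.X i ^ k * f) = lam (α - Pi.single i (k : ℤ)) f := by
  have key := eq_of_monomial (f := lam α ∘ₗ LinearMap.mulLeft ℂ (MvPolynomial.X i ^ k))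
    (g := lam (α - Pi.single i (k : ℤ))) ?_ f
  · exact key
  intro c
  rw [LinearMap.comp_apply, LinearMap.mulLeft_apply, X_pow_mul_monomial, lam_monomial,
    lam_monomial, one_smul, one_smul]
  refine Finset.prod_congr rfl fun j _ => ?_
  by_cases h : j = i
  · subst h; simp; congr 1; ring
  · simp [h]

end DoubleHurwitz

end

/-! ### The Vandermonde product and the eigenvalues of the cut-and-join operator -/

noncomputable section

namespace DoubleHurwitz

variable {N : ℕ}

/-! ### The Vandermonde product -/

/-- The index pairs `i < j`. -/
def ltPairs (N : ℕ) : Finset (Fin N × Fin N) := Finset.univ.filter fun p => p.1 < p.2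

/-- The Vandermonde product `∏_{i < j} (z_i - z_j)`. -/
def vdm (N : ℕ) : MvPolynomial (Fin N) ℂ :=
  ∏ p ∈ ltPairs N, (MvPolynomial.X p.1 - MvPolynomial.X p.2)

/-- The Vandermonde product without the factor of the pair `p`. -/
def vdmCof (p : Fin N × Fin N) : MvPolynomial (Fin N) ℂ :=
  ∏ q ∈ (ltPairs N).erase p, (MvPolynomial.X q.1 - MvPolynomial.X q.2)

/-- The quotient of the Vandermonde product by `z_i - z_j`, and `0` for `i = j`. -/
def vdmDiv (i j : Fin N) : MvPolynomial (Fin N) ℂ :=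
  if i < j then vdmCof (i, j) else if j < i then -vdmCof (j, i) else 0

theorem vdmDiv_self (i : Fin N) : vdmDiv i i = 0 := by simp [vdmDiv]

theorem vdmDiv_swap (i j : Fin N) : vdmDiv j i = -vdmDiv i j := by
  rcases lt_trichotomy i j with h | h | h
  · simp [vdmDiv, h, h.not_gt]
  · subst h; simp [vdmDiv]
  · simp [vdmDiv, h, h.not_gt]

theorem sub_mul_vdmCof {p : Fin N × Fin N} (hp : p.1 < p.2) :
    (MvPolynomial.X p.1 - MvPolynomial.X p.2) * vdmCof p = vdm N :=
  Finset.mul_prod_erase _ (fun q : Fin N × Fin N =>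
    (MvPolynomial.X q.1 - MvPolynomial.X q.2 : MvPolynomial (Fin N) ℂ)) (by simpa [ltPairs] using hp)

theorem sub_mul_vdmDiv {i j : Fin N} (h : i ≠ j) :
    (MvPolynomial.X i - MvPolynomial.X j) * vdmDiv i j = vdm N := by
  rcases lt_or_gt_of_ne h with h | h
  · simpa [vdmDiv, h] using sub_mul_vdmCof (p := (i, j)) h
  · rw [← sub_mul_vdmCof (p := (j, i)) h]
    simp only [vdmDiv, h, h.not_gt, if_true, if_false]
    ring

theorem pderiv_vdm (i : Fin N) : MvPolynomial.pderiv i (vdm N) = ∑ j, vdmDiv i j := by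
  rw [vdm, derivation_prod]
  have h1 : ∀ p ∈ ltPairs N, (∏ q ∈ (ltPairs N).erase p,
      (MvPolynomial.X q.1 - MvPolynomial.X q.2 : MvPolynomial (Fin N) ℂ)) *
        MvPolynomial.pderiv i (MvPolynomial.X p.1 - MvPolynomial.X p.2) =
      (if p.1 = i then vdmCof p else 0) - (if p.2 = i then vdmCof p else 0) := by
    intro p _
    rw [map_sub, MvPolynomial.pderiv_X, MvPolynomial.pderiv_X, ← vdmCof]
    simp only [Pi.single_apply, mul_sub, mul_ite, mul_one, mul_zero]
  rw [Finset.sum_congr rfl h1, Finset.sum_sub_distrib, ltPairs, Finset.sum_filter,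
    Finset.sum_filter, ← Finset.univ_product_univ, Finset.sum_product, Finset.sum_product_right]
  rw [Finset.sum_eq_single i, Finset.sum_eq_single
    (f := fun y => ∑ x, if (x, y).1 < (x, y).2 then if (x, y).2 = i then vdmCof (x, y) else 0 else 0)
    i, ← Finset.sum_sub_distrib]
  · refine Finset.sum_congr rfl fun j _ => ?_
    rcases lt_trichotomy i j with h | h | h
    · simp [vdmDiv, h, h.not_gt]
    · subst h; simp [vdmDiv]
    · simp [vdmDiv, h, h.not_gt]
  · intro j _ hj; simp [hj]
  · simp
  · intro j _ hj; simp [hj]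
  · simp

/-- The Vandermonde product is invariant under simultaneous translation of the variables; here the
antisymmetry of `vdmDiv` makes the double sum equal to its negative. -/
theorem sum_pderiv_vdm : ∑ i : Fin N, MvPolynomial.pderiv i (vdm N) = 0 := by
  have h : ∑ i : Fin N, MvPolynomial.pderiv i (vdm N) =
      -∑ i : Fin N, MvPolynomial.pderiv i (vdm N) := by
    simp only [pderiv_vdm]
    conv_lhs => rw [Finset.sum_comm]
    simp only [← Finset.sum_neg_distrib]
    refine Finset.sum_congr rfl fun i _ => Finset.sum_congr rfl fun j _ => vdmDiv_swap i j
  exact self_eq_neg.mp h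

/-- For each of the N - 1 indices j ≠ i, z_i / (z_i - z_j) = 1 + z_j / (z_i - z_j). The sum over j
on the right is the one produced by `cut_offdiag_lam`. -/
theorem euler_vdm (i : Fin N) :
    euler i (vdm N) = ∑ j, MvPolynomial.X j * vdmDiv i j + ((N : ℂ) - 1) • vdm N := by
  rw [euler_apply, pderiv_vdm, Finset.mul_sum]
  have h : ∀ j, MvPolynomial.X i * vdmDiv i j =
      MvPolynomial.X j * vdmDiv i j + if j ∈ Finset.univ.erase i then vdm N else 0 := by
    intro j
    by_cases hij : i = j
    · subst hij; simp [vdmDiv_self]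
    · rw [if_pos (by simp [Ne.symm hij]), ← sub_mul_vdmDiv hij]; ring
  rw [Finset.sum_congr rfl fun j _ => h j, Finset.sum_add_distrib, Finset.sum_ite_mem,
    Finset.univ_inter, Finset.sum_const, Finset.card_erase_of_mem (Finset.mem_univ i)]
  congr 1
  have : 1 ≤ N := i.pos
  rw [Finset.card_univ, Fintype.card_fin, ← Nat.cast_smul_eq_nsmul ℂ]
  push_cast [this]
  rfl

/-- The Vandermonde product as a determinant, `det (z_i^{N-1-j})`. -/
theorem vdm_eq_det : vdm N =
    Matrix.det (Matrix.of fun i j : Fin N =>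
      (MvPolynomial.X i ^ (j.rev : ℕ) : MvPolynomial (Fin N) ℂ)) := by
  have h := Matrix.det_projVandermonde (fun _ : Fin N => (1 : MvPolynomial (Fin N) ℂ))
    (fun i => MvPolynomial.X i)
  have e : Matrix.projVandermonde (fun _ : Fin N => (1 : MvPolynomial (Fin N) ℂ))
      (fun i => MvPolynomial.X i) = Matrix.of fun i j : Fin N =>
      (MvPolynomial.X i ^ (j.rev : ℕ) : MvPolynomial (Fin N) ℂ) := by
    ext i j : 2
    simp [Matrix.projVandermonde_apply]
  rw [← e, h, vdm, ltPairs, Finset.prod_filter, ← Finset.univ_product_univ, Finset.prod_product]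
  refine Finset.prod_congr rfl fun i _ => ?_
  rw [← Finset.prod_filter]
  refine Finset.prod_congr (by ext; simp) fun j _ => by simp

/-- The exponents `N - 1 - σ(i)` of the monomials of the Vandermonde product. -/
def vdmExp (σ : Equiv.Perm (Fin N)) : Fin N →₀ ℕ := Finsupp.equivFunOnFinite.symm fun i =>
  ((σ i).rev : ℕ)

theorem vdm_eq_sum : vdm N =
    ∑ σ : Equiv.Perm (Fin N), ((σ.sign : ℤ) : ℂ) • MvPolynomial.monomial (vdmExp σ) (1 : ℂ) := by
  rw [vdm_eq_det, ← Matrix.det_transpose, Matrix.det_apply]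
  refine Finset.sum_congr rfl fun σ _ => ?_
  have : ∏ i, ((Matrix.of fun i j : Fin N =>
      (MvPolynomial.X i ^ (j.rev : ℕ) : MvPolynomial (Fin N) ℂ)).transpose (σ i) i) =
      MvPolynomial.monomial (vdmExp σ) 1 := by
    rw [MvPolynomial.monomial_eq, Finsupp.prod_fintype _ _ (by simp)]
    simp [vdmExp]
  rw [this, Units.smul_def, ← Int.cast_smul_eq_zsmul ℂ]

/-- The generalized Schur function `det (h_{α_i - (N - 1 - j)})`. -/
def altSchur (α : Fin N → ℤ) : TimePoly := lam α (vdm N)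

theorem altSchur_eq_det (α : Fin N → ℤ) : altSchur α =
    Matrix.det (Matrix.of fun i j : Fin N => completeH (α i - (j.rev : ℕ))) := by
  rw [altSchur, vdm_eq_sum, map_sum, ← Matrix.det_transpose, Matrix.det_apply]
  refine Finset.sum_congr rfl fun σ _ => ?_
  rw [map_smul, lam_monomial, one_smul, Units.smul_def, ← Int.cast_smul_eq_zsmul ℂ]
  rfl

/-- The Vandermonde product is an eigenvector of symmetric polynomials in the Euler operators. -/
theorem sum_euler_vdm (a b : ℂ) :
    ∑ i : Fin N, (a • euler i (euler i (vdm N)) + b • euler i (vdm N)) =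
      (∑ j ∈ Finset.range N, (a * (j : ℂ) ^ 2 + b * j)) • vdm N := by
  -- The exponents of each monomial of the Vandermonde product are a permutation of 0, …, N - 1, so
  -- every monomial has the same eigenvalue.
  have h1 : ∀ σ : Equiv.Perm (Fin N), ∑ i : Fin N,
      (a • euler i (euler i (MvPolynomial.monomial (vdmExp σ) (1 : ℂ))) +
        b • euler i (MvPolynomial.monomial (vdmExp σ) (1 : ℂ))) =
      (∑ j ∈ Finset.range N, (a * (j : ℂ) ^ 2 + b * j)) • MvPolynomial.monomial (vdmExp σ) 1 := by
    intro σ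
    simp only [euler_monomial, Derivation.map_smul, smul_smul, ← add_smul, ← Finset.sum_smul]
    congr 1
    rw [Finset.sum_range, ← Equiv.sum_comp (σ.trans Fin.revPerm)
      (fun j : Fin N => a * (j : ℂ) ^ 2 + b * (j : ℂ))]
    refine Finset.sum_congr rfl fun i _ => ?_
    simp only [vdmExp, Finsupp.equivFunOnFinite_symm_apply_apply, Equiv.trans_apply,
      Fin.revPerm_apply]
    ring
  rw [vdm_eq_sum, Finset.smul_sum]
  simp only [map_sum, Derivation.map_smul, Finset.smul_sum, ← Finset.sum_add_distrib]
  rw [Finset.sum_comm]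
  refine Finset.sum_congr rfl fun σ _ => ?_
  rw [smul_comm, ← h1 σ, Finset.smul_sum]
  refine Finset.sum_congr rfl fun i _ => ?_
  rw [smul_add, smul_comm a, smul_comm b]

/-! ### The cut-and-join operator -/

theorem sum_range_sum_range_eq_antidiagonal {A : Type*} [AddCommMonoid A] (M : ℕ)
    (G : ℕ → ℕ → A) (hG : ∀ k l, M ≤ k + l → G k l = 0) :
    ∑ k ∈ Finset.range M, ∑ l ∈ Finset.range M, G k l =
      ∑ n ∈ Finset.range M, ∑ p ∈ Finset.HasAntidiagonal.antidiagonal n, G p.1 p.2 := by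
  rw [← Finset.sum_product', Finset.sum_sigma']
  symm
  refine Finset.sum_of_injOn (fun x : (Σ _ : ℕ, ℕ × ℕ) => x.2) ?_ ?_ ?_ ?_
  · rintro ⟨n, p⟩ h ⟨n', p'⟩ h' e
    simp only [Finset.coe_sigma, Set.mem_sigma_iff, Finset.mem_coe, Finset.HasAntidiagonal.mem_antidiagonal] at h h'
    simp only at e
    subst e
    obtain rfl : n = n' := h.2.symm.trans h'.2
    rfl
  · rintro ⟨n, p⟩ h
    simp only [Finset.coe_sigma, Set.mem_sigma_iff, Finset.mem_coe, Finset.HasAntidiagonal.mem_antidiagonal,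
      Finset.mem_range, Finset.coe_product, Set.mem_prod] at h ⊢
    omega
  · rintro ⟨k, l⟩ _ h
    refine hG k l ?_
    by_contra hlt
    refine h ⟨⟨k + l, (k, l)⟩, ?_, rfl⟩
    simp; omega
  · rintro ⟨n, p⟩ _; rfl

/-- Twice the cut-and-join operator, with the sums over `k, l` cut off at `M`. -/
def cutJoin (M : ℕ) (f : TimePoly) : TimePoly :=
  ∑ k ∈ Finset.range M, ∑ l ∈ Finset.range M,
    (powerSum k * powerSum l * MvPolynomial.pderiv (k + l + 1).succPNat f +
      powerSum (k + l + 1) *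
        MvPolynomial.pderiv k.succPNat (MvPolynomial.pderiv l.succPNat f))

/-- Two applications of `sum_powerSum_lam` give (α_i - E_i)². Moving E_i past z_i^{k+1} costs the
term with k + 1, which `cut_diag_lam` cancels up to one copy. -/
theorem join_lam (α : Fin N → ℤ) (i : Fin N) {M : ℕ} (hM : α i ≤ M)
    (f : MvPolynomial (Fin N) ℂ) :
    ∑ k ∈ Finset.range M, ∑ l ∈ Finset.range M,
      powerSum k * powerSum l * lam α (MvPolynomial.X i ^ (k + l + 2) * f) =
    lam α ((α i : ℂ) • ((α i : ℂ) • f - euler i f) - euler i ((α i : ℂ) • f - euler i f)) -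
      ∑ k ∈ Finset.range M,
        ((k : ℂ) + 1) • (powerSum k * lam α (MvPolynomial.X i ^ (k + 1) * f)) := by
  rw [← sum_powerSum_lam α i hM, ← Finset.sum_sub_distrib]
  refine Finset.sum_congr rfl fun k _ => ?_
  have h1 := sum_powerSum_lam α i hM (MvPolynomial.X i ^ (k + 1) * f)
  have h2 : euler i (MvPolynomial.X i ^ (k + 1) * f) =
      MvPolynomial.X i ^ (k + 1) * euler i f + ((k : ℂ) + 1) • (MvPolynomial.X i ^ (k + 1) * f) := by
    rw [Derivation.leibniz, Derivation.leibniz_pow, euler_apply i (MvPolynomial.X i),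
      MvPolynomial.pderiv_X_self, MvPolynomial.smul_eq_C_mul]
    simp only [smul_eq_mul, nsmul_eq_mul, map_add, map_natCast, map_one]
    push_cast
    ring
  calc ∑ l ∈ Finset.range M, powerSum k * powerSum l *
        lam α (MvPolynomial.X i ^ (k + l + 2) * f)
      = powerSum k * ∑ l ∈ Finset.range M, powerSum l *
        lam α (MvPolynomial.X i ^ (l + 1) * (MvPolynomial.X i ^ (k + 1) * f)) := by
        rw [Finset.mul_sum]
        refine Finset.sum_congr rfl fun l _ => ?_
        rw [mul_assoc, ← mul_assoc (MvPolynomial.X i ^ (l + 1)), ← pow_add,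
          show l + 1 + (k + 1) = k + l + 2 by ring]
    _ = _ := by
        rw [h1, h2, ← mul_smul_comm, sub_add_eq_sub_sub, ← mul_smul_comm, ← mul_sub, LinearMap.map_sub,
          mul_sub, mul_smul_comm, LinearMap.map_smul, mul_smul_comm]

/-- The summand depends only on k + l = n, and n + 1 pairs share this value. -/
theorem cut_diag_lam (α : Fin N → ℤ) (i : Fin N) {M : ℕ} (hM : α i ≤ M)
    (f : MvPolynomial (Fin N) ℂ) :
    ∑ k ∈ Finset.range M, ∑ l ∈ Finset.range M,
      powerSum (k + l + 1) * lam α (MvPolynomial.X i ^ (k + l + 2) * f) =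
    ∑ k ∈ Finset.range M, (k : ℂ) • (powerSum k * lam α (MvPolynomial.X i ^ (k + 1) * f)) := by
  rw [sum_range_sum_range_eq_antidiagonal M (fun k l =>
    powerSum (k + l + 1) * lam α (MvPolynomial.X i ^ (k + l + 2) * f))]
  · have h : ∀ n ∈ Finset.range M, ∑ p ∈ Finset.HasAntidiagonal.antidiagonal n,
        powerSum (p.1 + p.2 + 1) * lam α (MvPolynomial.X i ^ (p.1 + p.2 + 2) * f) =
        ((n + 1 : ℕ) : ℂ) • (powerSum (n + 1) * lam α (MvPolynomial.X i ^ (n + 1 + 1) * f)) := by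
      intro n _
      rw [Nat.cast_smul_eq_nsmul ℂ, ← Finset.Nat.card_antidiagonal, ← Finset.sum_const]
      refine Finset.sum_congr rfl fun p hp => ?_
      rw [Finset.HasAntidiagonal.mem_antidiagonal.mp hp, Finset.Nat.card_antidiagonal]
    rw [Finset.sum_congr rfl h]
    have h2 := Finset.sum_range_succ' (fun n : ℕ =>
      (n : ℂ) • (powerSum n * lam α (MvPolynomial.X i ^ (n + 1) * f))) M
    rw [Finset.sum_range_succ, lam_X_pow_mul_eq_zero α i (k := M + 1) (by push_cast; omega)] at h2
    simpa using h2.symm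
  · intro k l h
    rw [lam_X_pow_mul_eq_zero α i (by push_cast; omega), mul_zero]

/-- On k + l = n the geometric sum ∑ z_i^k z_j^l equals (z_i^{n+1} - z_j^{n+1}) / (z_i - z_j), and
the denominator divides the Vandermonde product. This leaves sums in one variable at a time, to
which `sum_powerSum_lam` applies. Since α_i + α_j ≤ M, the terms with k + l ≥ M vanish. -/
theorem cut_offdiag_lam (α : Fin N → ℤ) {i j : Fin N} (hij : i ≠ j) {M : ℕ}
    (hi : 2 * α i ≤ M) (hj : 2 * α j ≤ M) :
    ∑ k ∈ Finset.range M, ∑ l ∈ Finset.range M,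
      powerSum (k + l + 1) *
        lam α (MvPolynomial.X i ^ (k + 1) * (MvPolynomial.X j ^ (l + 1) * vdm N)) =
    lam α ((α i : ℂ) • (MvPolynomial.X j * vdmDiv i j) - euler i (MvPolynomial.X j * vdmDiv i j)) +
    lam α ((α j : ℂ) • (MvPolynomial.X i * vdmDiv j i) -
      euler j (MvPolynomial.X i * vdmDiv j i)) := by
  rw [sum_range_sum_range_eq_antidiagonal M (fun k l => powerSum (k + l + 1) *
        lam α (MvPolynomial.X i ^ (k + 1) * (MvPolynomial.X j ^ (l + 1) * vdm N)))]
  · have h : ∀ n ∈ Finset.range M, ∑ p ∈ Finset.HasAntidiagonal.antidiagonal n, powerSum (p.1 + p.2 + 1) *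
        lam α (MvPolynomial.X i ^ (p.1 + 1) * (MvPolynomial.X j ^ (p.2 + 1) * vdm N)) =
        powerSum (n + 1) * lam α (MvPolynomial.X i ^ (n + 2) * (MvPolynomial.X j * vdmDiv i j)) +
        powerSum (n + 1) *
          lam α (MvPolynomial.X j ^ (n + 2) * (MvPolynomial.X i * vdmDiv j i)) := by
      intro n _
      have e : ∀ p ∈ Finset.HasAntidiagonal.antidiagonal n, powerSum (p.1 + p.2 + 1) *
          lam α (MvPolynomial.X i ^ (p.1 + 1) * (MvPolynomial.X j ^ (p.2 + 1) * vdm N)) =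
          powerSum (n + 1) * lam α (MvPolynomial.X i ^ p.1 * MvPolynomial.X j ^ p.2 *
            (MvPolynomial.X i * MvPolynomial.X j * vdm N)) := by
        intro p hp
        rw [Finset.HasAntidiagonal.mem_antidiagonal.mp hp,
          show (MvPolynomial.X i ^ (p.1 + 1) * (MvPolynomial.X j ^ (p.2 + 1) * vdm N) :
            MvPolynomial (Fin N) ℂ) = MvPolynomial.X i ^ p.1 * MvPolynomial.X j ^ p.2 *
            (MvPolynomial.X i * MvPolynomial.X j * vdm N) by ring]
      rw [Finset.sum_congr rfl e, ← Finset.mul_sum, ← map_sum, ← Finset.sum_mul, ← mul_add,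
        ← map_add, vdmDiv_swap i j, ← sub_mul_vdmDiv hij]
      refine congrArg (fun x => powerSum (n + 1) * lam α x) ?_
      have g := (Commute.all (MvPolynomial.X i : MvPolynomial (Fin N) ℂ)
        (MvPolynomial.X j)).geom_sum₂_mul (n + 1)
      rw [Nat.add_sub_cancel, ← Finset.Nat.sum_antidiagonal_eq_sum_range_succ
        (fun a b => (MvPolynomial.X i : MvPolynomial (Fin N) ℂ) ^ a * MvPolynomial.X j ^ b)] at g
      linear_combination (MvPolynomial.X i * MvPolynomial.X j * vdmDiv i j) * g
    rw [Finset.sum_congr rfl h, Finset.sum_add_distrib, ← sum_powerSum_lam α i (M := M + 1)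
      (by push_cast; omega), ← sum_powerSum_lam α j (M := M + 1) (by push_cast; omega),
      Finset.sum_range_succ', Finset.sum_range_succ']
    -- The antidiagonal sums start at z_i² and z_j²; the missing linear terms cancel each other by
    -- antisymmetry.
    have z : powerSum 0 * lam α (MvPolynomial.X i ^ (0 + 1) * (MvPolynomial.X j * vdmDiv i j)) +
        powerSum 0 * lam α (MvPolynomial.X j ^ (0 + 1) * (MvPolynomial.X i * vdmDiv j i)) = 0 := by
      rw [← mul_add, ← map_add, vdmDiv_swap i j]
      have : MvPolynomial.X i ^ (0 + 1) * (MvPolynomial.X j * vdmDiv i j) +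
        MvPolynomial.X j ^ (0 + 1) * (MvPolynomial.X i * -vdmDiv i j) = 0 := by ring
      rw [this, map_zero, mul_zero]
    linear_combination -z
  · intro k l h
    rcases le_or_gt (k + 1 : ℤ) (α i) with hk | hk
    · rw [mul_left_comm, lam_X_pow_mul_eq_zero α j (by push_cast; omega), mul_zero]
    · rw [lam_X_pow_mul_eq_zero α i (by push_cast; omega), mul_zero]

theorem sum_eq_add_sum {A : Type*} [AddCommMonoid A] (i : Fin N) (f g : Fin N → A) (d : A)
    (hd : f i = d) (hg : g i = 0) (h : ∀ j, j ≠ i → f j = g j) : ∑ j, f j = d + ∑ j, g j := by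
  rw [← Finset.add_sum_erase _ f (Finset.mem_univ i), ← Finset.add_sum_erase _ g (Finset.mem_univ i),
    hd, hg, zero_add]
  congr 1
  exact Finset.sum_congr rfl fun j hj => h j (Finset.ne_of_mem_erase hj)

/-- The generalized Schur functions are eigenvectors of the cut-and-join operator. -/
theorem cutJoin_altSchur (α : Fin N → ℤ) {M : ℕ} (hM : ∀ i, 2 * α i ≤ M) :
    cutJoin M (altSchur α) =
      ((∑ i, ((α i : ℂ) ^ 2 - (2 * N - 1) * α i)) -
        ∑ j ∈ Finset.range N, ((j : ℂ) ^ 2 - (2 * N - 1) * j)) • altSchur α := by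
  have hM' : ∀ i, α i ≤ M := fun i => by have := hM i; omega
  have e1 : cutJoin M (altSchur α) =
      ∑ i, (∑ k ∈ Finset.range M, ∑ l ∈ Finset.range M,
        powerSum k * powerSum l * lam α (MvPolynomial.X i ^ (k + l + 2) * vdm N) +
      ∑ j, ∑ k ∈ Finset.range M, ∑ l ∈ Finset.range M, powerSum (k + l + 1) *
        lam α (MvPolynomial.X i ^ (k + 1) * (MvPolynomial.X j ^ (l + 1) * vdm N))) := by
    simp only [cutJoin, altSchur, pderiv_lam, Finset.sum_mul, Finset.mul_sum, map_sum,
      Finset.sum_add_distrib]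
    congr 1
    · rw [Finset.sum_congr rfl fun k _ => Finset.sum_comm, Finset.sum_comm]
    · rw [Finset.sum_congr rfl fun k _ => Finset.sum_congr rfl fun l _ => Finset.sum_comm,
        Finset.sum_congr rfl fun k _ => Finset.sum_comm, Finset.sum_comm]
      refine Finset.sum_congr rfl fun i _ => ?_
      rw [Finset.sum_congr rfl fun k _ => Finset.sum_comm, Finset.sum_comm]
  have off : ∀ i j : Fin N, i ≠ j → _ := fun i j hij =>
    cut_offdiag_lam α hij (hM i) (hM j)
  set P : Fin N → Fin N → TimePoly := fun i j =>
    lam α ((α i : ℂ) • (MvPolynomial.X j * vdmDiv i j) - euler i (MvPolynomial.X j * vdmDiv i j))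
    with hP
  have hPi : ∀ i, P i i = 0 := fun i => by simp [hP, vdmDiv_self]
  have e2 : ∀ i, ∑ j, ∑ k ∈ Finset.range M, ∑ l ∈ Finset.range M, powerSum (k + l + 1) *
        lam α (MvPolynomial.X i ^ (k + 1) * (MvPolynomial.X j ^ (l + 1) * vdm N)) =
      (∑ k ∈ Finset.range M,
        (k : ℂ) • (powerSum k * lam α (MvPolynomial.X i ^ (k + 1) * vdm N))) +
      ∑ j, (P i j + P j i) := by
    intro i
    refine sum_eq_add_sum i _ _ _ ?_ (by rw [hPi, add_zero]) fun j hj => off i j hj.symm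
    · rw [← cut_diag_lam α i (hM' i)]
      refine Finset.sum_congr rfl fun k _ => Finset.sum_congr rfl fun l _ => ?_
      rw [← mul_assoc, ← pow_add, show k + 1 + (l + 1) = k + l + 2 by ring]
  have e3 : ∑ i, ∑ j, (P i j + P j i) = ∑ i, (2 : ℂ) • lam α
      ((α i : ℂ) • (euler i (vdm N) - ((N : ℂ) - 1) • vdm N) -
        euler i (euler i (vdm N) - ((N : ℂ) - 1) • vdm N)) := by
    simp only [Finset.sum_add_distrib]
    rw [Finset.sum_comm (f := fun i j => P j i), ← Finset.sum_add_distrib]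
    refine Finset.sum_congr rfl fun i _ => ?_
    rw [two_smul]
    have : ∑ j, P i j = lam α
      ((α i : ℂ) • (euler i (vdm N) - ((N : ℂ) - 1) • vdm N) -
        euler i (euler i (vdm N) - ((N : ℂ) - 1) • vdm N)) := by
      rw [euler_vdm, add_sub_cancel_right, Finset.smul_sum, map_sum, ← Finset.sum_sub_distrib,
        map_sum]
    rw [this]
  rw [e1, Finset.sum_add_distrib, Finset.sum_congr rfl fun i _ => e2 i,
    Finset.sum_add_distrib, e3, Finset.sum_congr rfl fun i _ => join_lam α i (hM' i) (vdm N),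
    ← Finset.sum_add_distrib, ← Finset.sum_add_distrib]
  -- With a = α_i and E = E_i this is (a - E)² - (a - E) + 2 (a - E)(E - (N - 1)) = (a² - (2N - 1)
  -- a) - (E² - (2N - 1) E). The terms a E cancel, so `sum_euler_vdm` applies after summing over i.
  have e4 : ∀ i, lam α ((α i : ℂ) • ((α i : ℂ) • vdm N - euler i (vdm N)) -
        euler i ((α i : ℂ) • vdm N - euler i (vdm N))) -
      ∑ k ∈ Finset.range M,
        ((k : ℂ) + 1) • (powerSum k * lam α (MvPolynomial.X i ^ (k + 1) * vdm N)) +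
      (∑ k ∈ Finset.range M,
        (k : ℂ) • (powerSum k * lam α (MvPolynomial.X i ^ (k + 1) * vdm N)) +
      (2 : ℂ) • lam α ((α i : ℂ) • (euler i (vdm N) - ((N : ℂ) - 1) • vdm N) -
        euler i (euler i (vdm N) - ((N : ℂ) - 1) • vdm N))) =
      lam α (((α i : ℂ) ^ 2 - (2 * N - 1) * α i) • vdm N -
        ((1 : ℂ) • euler i (euler i (vdm N)) + (-(2 * N - 1) : ℂ) • euler i (vdm N))) := by
    intro i
    simp only [add_smul, one_smul, Finset.sum_add_distrib, sum_powerSum_lam α i (hM' i)]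
    have : ∀ x y z w : TimePoly, x - (y + z) + (y + w) = x - z + w := fun x y z w => by ring
    rw [this, ← map_smul, ← map_sub, ← map_add]
    congr 1
    simp only [map_sub, Derivation.map_smul]
    module
  rw [Finset.sum_congr rfl fun i _ => e4 i, ← map_sum, Finset.sum_sub_distrib, sum_euler_vdm,
    ← Finset.sum_smul, ← sub_smul, map_smul]
  congr 3
  funext j
  ring

end DoubleHurwitz

end

/-! ### Alternation, the Euler relation and the Murnaghan-Nakayama rule -/

noncomputable section

namespace DoubleHurwitz

variable {N : ℕ}

/-! ### Alternation -/

theorem altSchur_perm (α : Fin N → ℤ) (σ : Equiv.Perm (Fin N)) :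
    altSchur (α ∘ σ) = ((σ.sign : ℤ) : TimePoly) * altSchur α := by
  rw [altSchur_eq_det, altSchur_eq_det, ← Matrix.det_permute]
  rfl

theorem altSchur_eq_zero_of_eq (α : Fin N → ℤ) {i j : Fin N} (hij : i ≠ j) (h : α i = α j) :
    altSchur α = 0 := by
  rw [altSchur_eq_det]
  refine Matrix.det_zero_of_row_eq hij ?_
  ext1 l
  simp [h]

theorem altSchur_eq_zero_of_neg (α : Fin N → ℤ) {i : Fin N} (h : α i < 0) : altSchur α = 0 := by
  rw [altSchur_eq_det]
  refine Matrix.det_eq_zero_of_row_eq_zero i fun j => ?_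
  rw [Matrix.of_apply, completeH_of_neg (by omega)]

theorem pderiv_altSchur (α : Fin N → ℤ) (k : ℕ) :
    MvPolynomial.pderiv k.succPNat (altSchur α) =
      ∑ i, altSchur (α - Pi.single i ((k : ℤ) + 1)) := by
  rw [altSchur, pderiv_lam, Finset.sum_mul, map_sum]
  refine Finset.sum_congr rfl fun i _ => ?_
  rw [lam_X_pow_mul, altSchur]
  push_cast
  rfl

/-- The Euler relation for the generalized Schur functions. -/
theorem sum_powerSum_pderiv_altSchur (α : Fin N → ℤ) {M : ℕ} (hM : ∀ i, α i ≤ M) :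
    ∑ k ∈ Finset.range M, powerSum k * MvPolynomial.pderiv k.succPNat (altSchur α) =
      ((∑ i, (α i : ℂ)) - ∑ j ∈ Finset.range N, (j : ℂ)) • altSchur α := by
  have h := sum_euler_vdm (N := N) 0 1
  simp only [zero_smul, zero_add, one_smul, zero_mul, one_mul] at h
  simp only [altSchur, pderiv_lam, Finset.sum_mul, map_sum, Finset.mul_sum]
  rw [Finset.sum_comm, Finset.sum_congr rfl fun i _ => sum_powerSum_lam α i (hM i) (vdm N),
    ← map_sum, Finset.sum_sub_distrib, h, ← Finset.sum_smul, ← sub_smul, map_smul]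

/-! ### Multiplication by power sums -/

/-- Both sides are the derivative of the determinant at A in the direction B, that is, the sum of
adj(A)_{ji} B_{ij}. -/
theorem sum_det_updateRow_eq {R : Type*} [CommRing R] (A B : Matrix (Fin N) (Fin N) R) :
    ∑ i, (A.updateRow i (B i)).det = ∑ j, (A.updateCol j fun i => B i j).det := by
  have h1 : ∀ i, (A.updateRow i (B i)).det = ∑ j, A.adjugate j i * B i j := fun i => by
    rw [← Matrix.cramer_transpose_apply, Matrix.cramer_eq_adjugate_mulVec,
      ← Matrix.adjugate_transpose]
    rfl
  have h2 : ∀ j, (A.updateCol j fun i => B i j).det = ∑ i, A.adjugate j i * B i j := fun j => by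
    rw [← Matrix.cramer_apply, Matrix.cramer_eq_adjugate_mulVec]
    rfl
  simp only [h1, h2]
  exact Finset.sum_comm

theorem altSchur_add_single (α : Fin N → ℤ) (i : Fin N) (c : ℤ) :
    altSchur (α + Pi.single i c) =
      ((Matrix.of fun i j : Fin N => completeH (α i - (j.rev : ℕ))).updateRow i
        fun j => completeH (α i + c - (j.rev : ℕ))).det := by
  rw [altSchur_eq_det]
  congr 1
  ext1 a b
  by_cases h : a = i
  · subst h; simp
  · simp [h]

theorem completeH_one : completeH 1 = powerSum 0 := by
  have := completeH_rec (m := 1) (M := 1) (by simp)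
  simpa [completeH_zero] using this

/-- Pieri's rule for the first power sum. -/
theorem powerSum_zero_mul_altSchur (α : Fin N → ℤ) (h : ∃ i, α i = 0) :
    powerSum 0 * altSchur α = ∑ i, altSchur (α + Pi.single i 1) := by
  obtain ⟨i₀, hi₀⟩ := h
  obtain ⟨n, rfl⟩ : ∃ n, N = n + 1 := ⟨N - 1, by have := i₀.pos; omega⟩
  simp only [altSchur_add_single]
  rw [altSchur_eq_det]
  set A : Matrix (Fin (n + 1)) (Fin (n + 1)) TimePoly :=
    Matrix.of fun i j => completeH (α i - (j.rev : ℕ)) with hA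
  have h1 := sum_det_updateRow_eq A (Matrix.of fun i j => completeH (α i + 1 - (j.rev : ℕ)))
  refine Eq.trans ?_ h1.symm
  -- Shifting column j reproduces column j + 1, so only the last column contributes.
  rw [Finset.sum_eq_single (Fin.last n)]
  -- The shifted last column is p_1 times the old one plus a remainder. Row i₀, where α = 0, is (0,
  -- …, 0, 1), and there the remainder vanishes because h_1 = p_1; so the remainder gives
  -- determinant 0.
  · have e : (fun i => (Matrix.of fun i (j : Fin (n + 1)) => completeH (α i + 1 - (j.rev : ℕ))) i
        (Fin.last n)) = powerSum 0 • (fun i => A i (Fin.last n)) +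
          (fun i => completeH (α i + 1) - powerSum 0 * completeH (α i)) := by
      funext i; simp [hA]
    rw [e, Matrix.det_updateCol_add, Matrix.det_updateCol_smul]
    have e2 : A.updateCol (Fin.last n) (fun i => A i (Fin.last n)) = A := by
      ext1 a b
      by_cases hb : b = Fin.last n
      · subst hb; simp
      · simp [hb]
    rw [e2, Matrix.det_eq_zero_of_row_eq_zero (A := A.updateCol (Fin.last n) fun i =>
      completeH (α i + 1) - powerSum 0 * completeH (α i)) i₀, add_zero]
    intro j
    by_cases hj : j = Fin.last n
    · subst hj; simp [hi₀, completeH_one, completeH_zero]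
    · rw [Matrix.updateCol_ne hj, hA, Matrix.of_apply, hi₀, completeH_of_neg]
      have := Fin.val_lt_last hj
      simp only [Fin.val_rev]
      omega
  · intro j _ hj
    have hj' := Fin.val_lt_last hj
    refine Matrix.det_zero_of_column_eq (i := j) (j := ⟨j + 1, by omega⟩) (by
      intro e; have := congrArg Fin.val e; simp at this) fun i => ?_
    rw [Matrix.updateCol_self, Matrix.updateCol_ne (by
      intro e; have := congrArg Fin.val e; simp at this), hA, Matrix.of_apply, Matrix.of_apply]
    congr 1
    simp only [Fin.val_rev]
    omega
  · simp

/-- The operator `∑ (l + 1) t_{l+1} ∂ / ∂ t_l`. -/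
def raise (M : ℕ) : Derivation ℂ TimePoly TimePoly :=
  ∑ l ∈ Finset.range M, powerSum (l + 1) • MvPolynomial.pderiv l.succPNat

theorem raise_apply (M : ℕ) (f : TimePoly) :
    raise M f = ∑ l ∈ Finset.range M, powerSum (l + 1) * MvPolynomial.pderiv l.succPNat f := by
  rw [raise, ← Derivation.coeFnAddMonoidHom_apply, map_sum, Finset.sum_apply]
  rfl

theorem raise_powerSum {M k : ℕ} (h : k < M) :
    raise M (powerSum k) = ((k : ℂ) + 1) • powerSum (k + 1) := by
  rw [raise_apply, Finset.sum_eq_single k]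
  · rw [pderiv_powerSum, if_pos rfl, MvPolynomial.smul_eq_C_mul]
    simp [mul_comm]
  · intro l _ hl
    rw [pderiv_powerSum, if_neg hl, mul_zero]
  · intro hk; exact absurd (Finset.mem_range.mpr h) hk

/-- The sum over p_{l+2} z_i^{l+1} is the Euler relation for α with α_i raised by 1, except for its
p_1 term; these N exceptions give the last term. The derivatives ∂/∂z_i of the Vandermonde product
add up to 0. -/
theorem raise_altSchur (α : Fin N → ℤ) {M : ℕ} (hM : ∀ i, α i ≤ M) :
    raise M (altSchur α) = ∑ i, ((α i : ℂ) + 1) • altSchur (α + Pi.single i 1) -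
      (N : ℂ) • (powerSum 0 * altSchur α) := by
  have h1 : ∀ i f, lam α f = lam (α + Pi.single i 1) (MvPolynomial.X i * f) := by
    intro i f
    have := lam_X_pow_mul (α + Pi.single i 1) i 1 f
    rw [pow_one, Nat.cast_one, add_sub_cancel_right] at this
    exact this.symm
  have h2 : ∀ i, powerSum 0 * altSchur α +
      ∑ l ∈ Finset.range M, powerSum (l + 1) * lam α (MvPolynomial.X i ^ (l + 1) * vdm N) =
      ((α i : ℂ) + 1) • altSchur (α + Pi.single i 1) - lam α (MvPolynomial.pderiv i (vdm N)) := by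
    intro i
    have h3 := sum_powerSum_lam (α + Pi.single i 1) i (M := M + 1)
      (by have := hM i; simp; omega) (vdm N)
    rw [Finset.sum_range_succ', map_sub, map_smul, euler_apply, ← h1] at h3
    have e : (((α + Pi.single i 1 : Fin N → ℤ) i : ℤ) : ℂ) = (α i : ℂ) + 1 := by simp
    rw [e] at h3
    rw [altSchur, altSchur, ← h3, add_comm]
    congr 1
    · refine Finset.sum_congr rfl fun l _ => ?_
      rw [h1 i, ← mul_assoc, ← pow_succ']
    · rw [zero_add, pow_one, ← h1]
  have h4 : raise M (altSchur α) + (N : ℂ) • (powerSum 0 * altSchur α) =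
      ∑ i, (powerSum 0 * altSchur α +
        ∑ l ∈ Finset.range M, powerSum (l + 1) * lam α (MvPolynomial.X i ^ (l + 1) * vdm N)) := by
    rw [Finset.sum_add_distrib, Finset.sum_const, Finset.card_univ, Fintype.card_fin,
      ← Nat.cast_smul_eq_nsmul ℂ, add_comm, raise_apply, Finset.sum_comm]
    congr 1
    refine Finset.sum_congr rfl fun l _ => ?_
    rw [altSchur, pderiv_lam, Finset.sum_mul, map_sum, Finset.mul_sum]
  rw [eq_sub_iff_add_eq, h4, Finset.sum_congr rfl fun i _ => h2 i, Finset.sum_sub_distrib,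
    ← map_sum, sum_pderiv_vdm, map_zero, sub_zero]

/-- The transposition of a and b fixes γ, permutes the summands and reverses their signs. -/
theorem sum_altSchur_add_single_eq_zero (γ : Fin N → ℤ) {a b : Fin N} (hab : a ≠ b)
    (h : γ a = γ b) (c : ℤ) : ∑ i, altSchur (γ + Pi.single i c) = 0 := by
  have e : ∀ i, altSchur (γ + Pi.single (Equiv.swap a b i) c) = -altSchur (γ + Pi.single i c) := by
    intro i
    have h1 := altSchur_perm (γ + Pi.single i c) (Equiv.swap a b)
    rw [Equiv.Perm.sign_swap hab] at h1
    have h2 : (γ + Pi.single i c) ∘ Equiv.swap a b =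
        γ + Pi.single (Equiv.swap a b i) c := by
      funext j
      have hγ : γ (Equiv.swap a b j) = γ j := by
        rcases eq_or_ne j a with rfl | hja
        · rw [Equiv.swap_apply_left, h]
        · rcases eq_or_ne j b with rfl | hjb
          · rw [Equiv.swap_apply_right, h]
          · rw [Equiv.swap_apply_of_ne_of_ne hja hjb]
      simp only [Function.comp_apply, Pi.add_apply, hγ, Pi.single_apply]
      congr 2
      rw [eq_iff_iff]
      exact ⟨fun e => by rw [← e, Equiv.swap_apply_self], fun e => by
        rw [e, Equiv.swap_apply_self]⟩
    rw [h2] at h1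
    rw [h1]; simp
  have h1 : ∑ i, altSchur (γ + Pi.single i c) = -∑ i, altSchur (γ + Pi.single i c) := by
    conv_lhs => rw [← Equiv.sum_comp (Equiv.swap a b)]
    rw [← Finset.sum_neg_distrib]
    exact Finset.sum_congr rfl fun i _ => e i
  exact self_eq_neg.mp h1

/-- The Murnaghan-Nakayama rule: multiplication by a power sum shifts the exponents, provided that
the smallest exponents are all present. -/
theorem powerSum_mul_altSchur (k : ℕ) (α : Fin N → ℤ) (h0 : ∀ i, 0 ≤ α i)
    (h : ∀ v : ℕ, v ≤ k → ∃ i, α i = v) :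
    powerSum k * altSchur α = ∑ i, altSchur (α + Pi.single i ((k : ℤ) + 1)) := by
  induction k generalizing α with
  | zero => simpa using powerSum_zero_mul_altSchur α (by simpa using h 0 le_rfl)
  | succ k ih =>
    obtain ⟨M, hM⟩ : ∃ M : ℕ, ∀ i, α i + k + 2 ≤ M := by
      refine ⟨∑ i, (α i).toNat + k + 2, fun i => ?_⟩
      have := Finset.single_le_sum (f := fun i => (α i).toNat) (fun _ _ => Nat.zero_le _)
        (Finset.mem_univ i)
      have h2 := h0 i
      omega
    have hkM : k < M := by
      obtain ⟨i, hi⟩ := h 0 (Nat.zero_le _)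
      have := hM i; omega
    have ih0 := ih α h0 fun v hv => h v (by omega)
    -- The commutator of `raise` with multiplication by p_{k+1} is multiplication by (k + 1)
    -- p_{k+2}, so applying `raise` to one case of the rule produces the next.
    have h1 := congrArg (raise M) ih0
    rw [Derivation.leibniz, raise_powerSum hkM, map_sum,
      Finset.sum_congr rfl fun i _ => raise_altSchur _ (M := M) fun j => by
        have := hM j
        by_cases hj : j = i
        · subst hj; simp; omega
        · simp [hj]; omega, Finset.sum_sub_distrib,
      raise_altSchur α (M := M) fun i => by have := hM i; omega] at h1
    have h2 : ∀ j, powerSum k * altSchur (α + Pi.single j 1) =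
        ∑ i, altSchur (α + Pi.single j 1 + Pi.single i ((k : ℤ) + 1)) := by
      intro j
      -- If α_j ≤ k, the value α_j + 1 already occurs elsewhere and both sides vanish by
      -- alternation. If α_j > k, raising α_j keeps all of 0, …, k present and the induction
      -- hypothesis applies.
      rcases le_or_gt (α j) k with hj | hj
      · obtain ⟨i, hi⟩ := h ((α j).toNat + 1) (by have := h0 j; omega)
        have hij : j ≠ i := by
          rintro rfl
          have := h0 j
          push_cast at hi; omega
        have e : (α + Pi.single j 1 : Fin N → ℤ) j = (α + Pi.single j 1 : Fin N → ℤ) i := by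
          have := h0 j
          simp [hij.symm, hi]; omega
        rw [altSchur_eq_zero_of_eq _ hij e, sum_altSchur_add_single_eq_zero _ hij e, mul_zero]
      · refine ih _ (fun i => ?_) fun v hv => ?_
        · have := h0 i
          by_cases hi : i = j
          · subst hi; simp; omega
          · simp [hi, this]
        · obtain ⟨i, hi⟩ := h v (by omega)
          have hij : i ≠ j := by rintro rfl; omega
          exact ⟨i, by simp [hij, hi]⟩
    -- The two double sums differ only on the diagonal i = j, where the coefficient exceeds α_j + 1
    -- by k + 1; this surplus is the sum wanted for the next case.
    have h3 : ∑ i, ∑ j, ((((α + Pi.single i ((k : ℤ) + 1) : Fin N → ℤ) j : ℤ) : ℂ) + 1) •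
          altSchur (α + Pi.single i ((k : ℤ) + 1) + Pi.single j 1) =
        ∑ j, ((α j : ℂ) + 1) • (powerSum k * altSchur (α + Pi.single j 1)) +
        ((k : ℂ) + 1) • ∑ i, altSchur (α + Pi.single i ((k : ℤ) + 2)) := by
      rw [Finset.sum_congr rfl fun j _ => congrArg _ (h2 j)]
      simp only [Finset.smul_sum]
      symm
      rw [Finset.sum_comm, ← Finset.sum_add_distrib]
      symm
      refine Finset.sum_congr rfl fun i _ => ?_
      have : ((k : ℂ) + 1) • altSchur (α + Pi.single i ((k : ℤ) + 2)) =
          ∑ j, if j = i then ((k : ℂ) + 1) • altSchur (α + Pi.single i ((k : ℤ) + 2)) else 0 := by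
        simp
      rw [this, ← Finset.sum_add_distrib]
      refine Finset.sum_congr rfl fun j _ => ?_
      by_cases hj : j = i
      · subst hj
        have e : α + Pi.single j ((k : ℤ) + 1) + Pi.single j 1 = α + Pi.single j ((k : ℤ) + 2) := by
          rw [add_assoc, ← Pi.single_add]; congr 2
        have e' : α + Pi.single j 1 + Pi.single j ((k : ℤ) + 1) = α + Pi.single j ((k : ℤ) + 2) := by
          rw [add_assoc, ← Pi.single_add]; congr 2; ring
        rw [e, e', if_pos rfl, ← add_smul]
        congr 1
        simp; ring
      · rw [if_neg hj, add_zero, add_right_comm]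
        simp [hj]
    rw [h3, ← Finset.smul_sum, ← Finset.mul_sum, ← ih0] at h1
    have hk0 : ((k : ℂ) + 1) ≠ 0 := by exact_mod_cast Nat.succ_ne_zero k
    refine smul_right_injective TimePoly hk0 ?_
    simp only [smul_eq_mul, mul_sub, Finset.mul_sum, mul_smul_comm] at h1 ⊢
    push_cast
    rw [show ((k : ℤ) + 1 + 1) = k + 2 by ring, mul_comm (powerSum (k + 1))]
    have e : (N : ℂ) • (powerSum 0 * (powerSum k * altSchur α)) =
        (N : ℂ) • (powerSum k * (powerSum 0 * altSchur α)) := by rw [mul_left_comm]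
    rw [e] at h1
    linear_combination h1

end DoubleHurwitz

end

/-! ### Cauchy sums over exponent sequences and over partitions -/

noncomputable section

namespace DoubleHurwitz

variable {N : ℕ}

/-! ### Exponent sequences -/

theorem sum_range_le_of_injective (γ : Fin N → ℤ) (h0 : ∀ i, 0 ≤ γ i)
    (hinj : Function.Injective γ) : ∑ j ∈ Finset.range N, (j : ℤ) ≤ ∑ i, γ i := by
  have h := Finset.sum_range_le_sum (s := Finset.univ.image γ) (c := 0) (by simpa using h0)
  rw [Finset.card_image_of_injective _ hinj, Finset.card_univ, Fintype.card_fin,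
    Finset.sum_image fun _ _ _ _ h => hinj h] at h
  simpa using h

/-- Together with the missing value v there are N + 1 distinct nonnegative integers. -/
theorem sum_range_succ_le_of_injective (γ : Fin N → ℤ) (h0 : ∀ i, 0 ≤ γ i)
    (hinj : Function.Injective γ) {v : ℕ} (hv : ∀ i, γ i ≠ v) :
    ∑ j ∈ Finset.range (N + 1), (j : ℤ) ≤ v + ∑ i, γ i := by
  have hv' : (v : ℤ) ∉ Finset.univ.image γ := by simpa using hv
  have h := Finset.sum_range_le_sum (s := insert (v : ℤ) (Finset.univ.image γ)) (c := 0)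
    (by simpa using h0)
  rw [Finset.card_insert_of_notMem hv', Finset.sum_insert hv',
    Finset.card_image_of_injective _ hinj, Finset.card_univ, Fintype.card_fin,
    Finset.sum_image fun _ _ _ _ h => hinj h] at h
  simpa using h

theorem nonneg_of_altSchur_ne_zero {γ : Fin N → ℤ} (h : altSchur γ ≠ 0) (i : Fin N) : 0 ≤ γ i := by
  by_contra hi
  exact h (altSchur_eq_zero_of_neg γ (not_le.mp hi))

theorem injective_of_altSchur_ne_zero {γ : Fin N → ℤ} (h : altSchur γ ≠ 0) :
    Function.Injective γ := by
  intro i j hij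
  by_contra hne
  exact h (altSchur_eq_zero_of_eq γ hne hij)

/-- The sum `0 + 1 + ⋯ + (N - 1)` of the exponents of the empty partition. -/
def deltaSum (N : ℕ) : ℕ := ∑ j ∈ Finset.range N, j

theorem altSchur_eq_zero_of_sum_lt (γ : Fin N → ℤ) (h : ∑ i, γ i < deltaSum N) :
    altSchur γ = 0 := by
  by_contra hne
  have := sum_range_le_of_injective γ (nonneg_of_altSchur_ne_zero hne)
    (injective_of_altSchur_ne_zero hne)
  rw [deltaSum] at h
  push_cast at h
  omega

/-! ### The Cauchy sum over exponent sequences -/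

section Cauchy

variable {B : Type*} [CommRing B] [Algebra ℂ B] (φ ψ : TimePoly →ₐ[ℂ] B)

/-- The exponent sequences with sum `e`. -/
def exponents (N e : ℕ) : Finset (Fin N → ℕ) := Finset.piAntidiag Finset.univ e

theorem mem_exponents {e : ℕ} {α : Fin N → ℕ} : α ∈ exponents N e ↔ ∑ i, α i = e := by
  simp [exponents]

/-- The generalized Schur function of a sequence of natural numbers. -/
def natSchur (α : Fin N → ℕ) : TimePoly := altSchur fun i => (α i : ℤ)

/-- The sum of `s_α[t] s_α[t']` over all sequences `α` with sum `e`. -/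
def altCauchy (N e : ℕ) : B := ∑ α ∈ exponents N e, φ (natSchur α) * ψ (natSchur α)

/-- Reindexing by α = β + k e_i moves the shift from one factor to the other. The sequences with α_i
< k are not reached, but there the left factor has a negative exponent and vanishes. -/
theorem sum_shift (e k : ℕ) (i : Fin N) :
    ∑ α ∈ exponents N (e + k), φ (altSchur ((fun j => (α j : ℤ)) - Pi.single i (k : ℤ))) *
      ψ (natSchur α) =
    ∑ β ∈ exponents N e, φ (natSchur β) *
      ψ (altSchur ((fun j => (β j : ℤ)) + Pi.single i (k : ℤ))) := by
  have cast_add : ∀ β : Fin N → ℕ, (fun j => (((β + Pi.single i k : Fin N → ℕ) j : ℕ) : ℤ)) =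
      (fun j => (β j : ℤ)) + Pi.single i (k : ℤ) := by
    intro β; funext j
    by_cases hj : j = i
    · subst hj; simp
    · simp [hj]
  symm
  refine Finset.sum_of_injOn (fun β => β + Pi.single i k) ?_ ?_ ?_ ?_
  · exact fun _ _ _ _ h => add_right_cancel h
  · intro β hβ
    rw [Finset.mem_coe, mem_exponents] at *
    simp [Finset.sum_add_distrib, hβ]
  · intro α hα hα'
    rw [mem_exponents] at hα
    have hlt : α i < k := by
      by_contra hle
      rw [not_lt] at hle
      refine hα' ⟨α - Pi.single i k, ?_, ?_⟩
      · rw [Finset.mem_coe, mem_exponents]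
        have h1 : α - Pi.single i k + Pi.single i k = α := by
          funext j
          by_cases hj : j = i
          · subst hj; simp [hle]
          · simp [hj]
        have h2 := congrArg (fun γ : Fin N → ℕ => ∑ j, γ j) h1
        simp only [Pi.add_apply, Finset.sum_add_distrib, hα] at h2
        simpa using h2
      · funext j
        by_cases hj : j = i
        · subst hj; simp [hle]
        · simp [hj]
    rw [altSchur_eq_zero_of_neg (i := i) _ (by simpa using hlt), map_zero, zero_mul]
  · intro β _
    rw [natSchur, natSchur, cast_add, add_sub_cancel_right]

/-- If the Schur function is nonzero, the exponents are distinct. If moreover some v ≤ k were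
missing, their sum would be at least 0 + ⋯ + N - v, which exceeds the prescribed sum because d ≤ N.
So the Murnaghan-Nakayama rule applies. -/
theorem powerSum_mul_natSchur {d k : ℕ} (hk : k < d) (hd : d ≤ N) {β : Fin N → ℕ}
    (hβ : β ∈ exponents N (d - (k + 1) + deltaSum N)) :
    powerSum k * natSchur β =
      ∑ i, altSchur ((fun j => (β j : ℤ)) + Pi.single i ((k : ℤ) + 1)) ∨ natSchur β = 0 := by
  by_cases hz : natSchur β = 0
  · exact Or.inr hz
  refine Or.inl (powerSum_mul_altSchur k _ (fun i => Int.natCast_nonneg _) fun v hv => ?_)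
  by_contra hne
  push Not at hne
  have h1 := sum_range_succ_le_of_injective (fun j => (β j : ℤ)) (fun i => Int.natCast_nonneg _)
    (injective_of_altSchur_ne_zero hz) hne
  rw [mem_exponents] at hβ
  have h2 : ∑ j, (β j : ℤ) = (d - (k + 1) + deltaSum N : ℕ) := by exact_mod_cast hβ
  rw [h2, Finset.sum_range_succ] at h1
  have h3 : ∑ j ∈ Finset.range N, (j : ℤ) = deltaSum N := by simp [deltaSum]
  rw [h3] at h1
  omega

/-- The Euler relation on the φ-side produces p_k times the sequences lowered by k. `sum_shift`
turns the lowering into a raising on the ψ-side, and the Murnaghan-Nakayama rule turns that into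
multiplication by p_k. Summing over all sequences rather than partitions keeps the reindexing free
of ordering conditions. -/
theorem altCauchy_rec {d : ℕ} (hd : d ≤ N) :
    (d : ℂ) • altCauchy φ ψ N (d + deltaSum N) =
      ∑ k ∈ Finset.range d, φ (powerSum k) * ψ (powerSum k) *
        altCauchy φ ψ N (d - (k + 1) + deltaSum N) := by
  set M := d + deltaSum N with hM
  have e1 : ∀ α ∈ exponents N M, (d : ℂ) • (φ (natSchur α) * ψ (natSchur α)) =
      ∑ k ∈ Finset.range M, φ (powerSum k) * ∑ i,
        φ (altSchur ((fun j => (α j : ℤ)) - Pi.single i ((k : ℤ) + 1))) * ψ (natSchur α) := by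
    intro α hα
    rw [mem_exponents] at hα
    have h1 := sum_powerSum_pderiv_altSchur (fun j => (α j : ℤ)) (M := M) fun i => by
      have := Finset.single_le_sum (f := α) (fun _ _ => Nat.zero_le _) (Finset.mem_univ i)
      exact_mod_cast this.trans hα.le
    have h2 : (∑ i, (((α i : ℕ) : ℤ) : ℂ)) - ∑ j ∈ Finset.range N, (j : ℂ) = d := by
      have : ∑ i, (((α i : ℕ) : ℤ) : ℂ) = ((∑ i, α i : ℕ) : ℂ) := by push_cast; rfl
      rw [this, hα, hM, deltaSum]; push_cast; ring
    rw [h2] at h1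
    rw [← smul_mul_assoc, ← map_smul, natSchur, ← h1, map_sum, Finset.sum_mul]
    refine Finset.sum_congr rfl fun k _ => ?_
    rw [map_mul, pderiv_altSchur, map_sum, mul_assoc, Finset.sum_mul]
  rw [altCauchy, Finset.smul_sum, Finset.sum_congr rfl e1, Finset.sum_comm]
  simp only [← Finset.mul_sum]
  have hsub : Finset.range d ⊆ Finset.range M := by
    intro k hk; simp only [Finset.mem_range] at *; omega
  rw [← Finset.sum_subset hsub]
  · refine Finset.sum_congr rfl fun k hk => ?_
    have hkd := Finset.mem_range.mp hk
    rw [mul_assoc, Finset.sum_comm]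
    congr 1
    have e2 : ∀ i, ∑ α ∈ exponents N M,
        φ (altSchur ((fun j => (α j : ℤ)) - Pi.single i ((k : ℤ) + 1))) * ψ (natSchur α) =
        ∑ β ∈ exponents N (d - (k + 1) + deltaSum N), φ (natSchur β) *
          ψ (altSchur ((fun j => (β j : ℤ)) + Pi.single i ((k : ℤ) + 1))) := by
      intro i
      have := sum_shift φ ψ (d - (k + 1) + deltaSum N) (k + 1) i
      rw [show d - (k + 1) + deltaSum N + (k + 1) = M by omega] at this
      exact_mod_cast this
    rw [Finset.sum_congr rfl fun i _ => e2 i, Finset.sum_comm, altCauchy, Finset.mul_sum]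
    refine Finset.sum_congr rfl fun β hβ => ?_
    rw [← Finset.mul_sum, ← map_sum]
    rcases powerSum_mul_natSchur hkd hd hβ with h | h
    · rw [← h, map_mul]; ring
    · rw [h]; simp
  · intro k _ hk
    rw [Finset.sum_eq_zero, mul_zero]
    intro α hα
    refine Finset.sum_eq_zero fun i _ => ?_
    rw [altSchur_eq_zero_of_sum_lt, map_zero, zero_mul]
    rw [mem_exponents] at hα
    have h2 : ∑ j, (α j : ℤ) = (M : ℕ) := by exact_mod_cast hα
    simp only [Pi.sub_apply, Finset.sum_sub_distrib, h2]
    simp only [Finset.mem_range] at hk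
    simp
    omega

end Cauchy

/-! ### Partitions -/

/-- The natural number version of `part`. -/
def natPart {d : ℕ} (p : Nat.Partition d) (i : ℕ) : ℕ := (p.parts.sort (· ≥ ·)).getD i 0

theorem part_eq {d : ℕ} (p : Nat.Partition d) (i : ℕ) : part p i = natPart p i := rfl

theorem length_sort_parts {d : ℕ} (p : Nat.Partition d) :
    (p.parts.sort (· ≥ ·)).length = Multiset.card p.parts := by simp

theorem natPart_eq_zero {d : ℕ} (p : Nat.Partition d) {i : ℕ} (h : Multiset.card p.parts ≤ i) :
    natPart p i = 0 := by
  rw [natPart, List.getD_eq_default]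
  rw [length_sort_parts]
  exact h

theorem natPart_antitone {d : ℕ} (p : Nat.Partition d) : Antitone (natPart p) := by
  intro i j hij
  rcases lt_or_ge j (Multiset.card p.parts) with hj | hj
  · have hs := Multiset.pairwise_sort p.parts (· ≥ ·)
    rw [natPart, natPart, List.getD_eq_getElem _ _ (by rw [length_sort_parts]; exact hj),
      List.getD_eq_getElem _ _ (by rw [length_sort_parts]; omega)]
    rcases hij.eq_or_lt with h | h
    · subst h; rfl
    · exact List.pairwise_iff_getElem.mp hs i j _ _ h
  · rw [natPart_eq_zero p hj]; exact Nat.zero_le _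

theorem sum_natPart {d : ℕ} (p : Nat.Partition d) {N : ℕ} (h : Multiset.card p.parts ≤ N) :
    ∑ i : Fin N, natPart p i = d := by
  rw [← Finset.sum_range (fun i => natPart p i)]
  have h1 : ∑ i ∈ Finset.range (Multiset.card p.parts), natPart p i = d := by
    conv_rhs => rw [← p.parts_sum, ← Multiset.sort_eq p.parts (· ≥ ·), Multiset.sum_coe]
    rw [← length_sort_parts, Finset.sum_range, ← List.sum_ofFn]
    congr 1
    refine List.ext_getElem (by simp) fun i h1 h2 => ?_
    simp only [List.getElem_ofFn, natPart]
    rw [List.getD_eq_getElem _ _ h2]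
  conv_rhs => rw [← h1]
  symm
  refine Finset.sum_subset (Finset.range_subset_range.mpr h) fun i _ hi => natPart_eq_zero p ?_
  simpa using hi

theorem card_parts_le {d : ℕ} (p : Nat.Partition d) : Multiset.card p.parts ≤ d := by
  have h := Multiset.card_nsmul_le_sum (s := p.parts) (a := 1) fun x hx => p.parts_pos hx
  rwa [p.parts_sum, smul_eq_mul, mul_one] at h

/-- The strictly decreasing sequence `λ_i + N - i` of a partition. -/
def shiftedParts {d : ℕ} (p : Nat.Partition d) (N : ℕ) (i : Fin N) : ℕ := natPart p i + i.rev

theorem shiftedParts_strictAnti {d : ℕ} (p : Nat.Partition d) (N : ℕ) :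
    StrictAnti (shiftedParts p N) := by
  intro i j hij
  have h1 := natPart_antitone p (show (i : ℕ) ≤ j from hij.le)
  have h2 : (i : ℕ) < j := hij
  simp only [shiftedParts, Fin.val_rev]
  omega

theorem sum_rev (N : ℕ) : ∑ i : Fin N, (i.rev : ℕ) = deltaSum N := by
  rw [deltaSum, Finset.sum_range]
  exact Equiv.sum_comp Fin.revPerm (fun i : Fin N => (i : ℕ))

theorem sum_shiftedParts {d : ℕ} (p : Nat.Partition d) {N : ℕ} (h : Multiset.card p.parts ≤ N) :
    ∑ i, shiftedParts p N i = d + deltaSum N := by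
  simp only [shiftedParts, Finset.sum_add_distrib, sum_natPart p h, sum_rev]

theorem natSchur_shiftedParts_card {d : ℕ} (p : Nat.Partition d) :
    natSchur (shiftedParts p (Multiset.card p.parts)) = schur p := by
  rw [natSchur, altSchur_eq_det, schur]
  congr 1
  ext1 i j
  simp only [Matrix.of_apply, shiftedParts, part_eq, Fin.val_rev]
  congr 1
  omega

/-- A further zero part adds a last row (0, …, 0, 1) to the determinant. -/
theorem natSchur_shiftedParts_succ {d : ℕ} (p : Nat.Partition d) {N : ℕ}
    (h : Multiset.card p.parts ≤ N) :
    natSchur (shiftedParts p (N + 1)) = natSchur (shiftedParts p N) := by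
  rw [natSchur, altSchur_eq_det, natSchur, altSchur_eq_det, Matrix.det_succ_row _ (Fin.last N),
    Finset.sum_eq_single (Fin.last N)]
  · have e1 : natPart p N = 0 := natPart_eq_zero p h
    simp only [Matrix.of_apply, shiftedParts, Fin.val_last, e1, Fin.rev_last, Fin.val_zero]
    have e2 : ((-1 : TimePoly)) ^ (N + N) = 1 := by rw [← two_mul, pow_mul, neg_one_sq, one_pow]
    rw [e2, one_mul, add_zero, sub_self, completeH_zero, one_mul]
    congr 1
    ext1 i j
    simp only [Matrix.submatrix_apply, Matrix.of_apply, Fin.succAbove_last, Fin.val_castSucc,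
      Fin.val_rev]
    congr 1
    have := i.isLt
    have := j.isLt
    omega
  · intro j _ hj
    have := Fin.val_lt_last hj
    rw [Matrix.of_apply, completeH_of_neg]
    · simp
    · simp only [shiftedParts, Fin.val_last, natPart_eq_zero p h, Fin.rev_last, Fin.val_zero,
        Fin.val_rev]
      omega
  · simp

theorem natSchur_shiftedParts {d : ℕ} (p : Nat.Partition d) {N : ℕ}
    (h : Multiset.card p.parts ≤ N) : natSchur (shiftedParts p N) = schur p := by
  induction N, h using Nat.le_induction with
  | base => exact natSchur_shiftedParts_card p
  | succ N h ih => rw [natSchur_shiftedParts_succ p h, ih]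

theorem getD_filter_ne_zero {l : List ℕ} (hl : l.Pairwise (· ≥ ·)) (i : ℕ) :
    (l.filter (· ≠ 0)).getD i 0 = l.getD i 0 := by
  induction l generalizing i with
  | nil => simp
  | cons a l ih =>
    rw [List.pairwise_cons] at hl
    by_cases ha : a = 0
    · subst ha
      have h0 : ∀ x ∈ l, x = 0 := fun x hx => Nat.le_zero.mp (hl.1 x hx)
      have e : ((0 :: l).filter (· ≠ 0)) = [] := by
        rw [List.filter_eq_nil_iff]
        intro x hx
        rcases List.mem_cons.mp hx with rfl | hx
        · simp
        · simp [h0 x hx]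
      rw [e]
      rcases lt_or_ge i (0 :: l).length with hi | hi
      · rw [List.getD_eq_getElem _ _ hi]
        have := List.getElem_mem hi
        rcases List.mem_cons.mp this with h | h
        · simp [h]
        · simp [h0 _ h]
      · rw [List.getD_eq_default _ _ hi]; simp
    · rw [List.filter_cons_of_pos (by simpa using ha)]
      cases i with
      | zero => simp
      | succ i => simpa using ih hl.2 i

theorem exists_partition {N d : ℕ} (f : Fin N → ℕ) (hf : Antitone f) (hsum : ∑ i, f i = d) :
    ∃ p : Nat.Partition d, ∀ i : Fin N, natPart p i = f i := by
  have hs : ((List.ofFn f : List ℕ) : Multiset ℕ).sum = d := by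
    rw [Multiset.sum_coe, List.sum_ofFn, hsum]
  refine ⟨Nat.Partition.ofSums d (List.ofFn f : List ℕ) hs, fun i => ?_⟩
  have hp : (List.ofFn f).Pairwise (· ≥ ·) := by
    rw [List.pairwise_ofFn]
    exact fun i j hij => hf hij.le
  have e : (Nat.Partition.ofSums d (List.ofFn f : List ℕ) hs).parts.sort (· ≥ ·) =
      (List.ofFn f).filter (· ≠ 0) := by
    refine List.Perm.eq_of_pairwise' (r := (· ≥ ·)) (Multiset.pairwise_sort _ _) (hp.filter _) ?_
    rw [← Multiset.coe_eq_coe, Multiset.sort_eq]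
    simp
  rw [natPart, e, getD_filter_ne_zero hp, List.getD_eq_getElem _ _ (by simp)]
  simp

theorem partition_ext {d : ℕ} {p q : Nat.Partition d} (h : ∀ i, natPart p i = natPart q i) :
    p = q := by
  have key : ∀ r : Nat.Partition d, ∀ i, i < Multiset.card r.parts ↔ natPart r i ≠ 0 := by
    intro r i
    constructor
    · intro hi
      rw [natPart, List.getD_eq_getElem _ _ (by rw [length_sort_parts]; exact hi)]
      refine (r.parts_pos ?_).ne'
      rw [← Multiset.mem_sort (r := (· ≥ ·))]
      exact List.getElem_mem _
    · intro hne
      by_contra hle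
      exact hne (natPart_eq_zero r (not_lt.mp hle))
  have hc : Multiset.card p.parts = Multiset.card q.parts := by
    have h1 : ∀ i, i < Multiset.card p.parts ↔ i < Multiset.card q.parts := fun i => by
      rw [key, key, h]
    exact le_antisymm (not_lt.mp fun hlt => lt_irrefl _ ((h1 _).mp hlt))
      (not_lt.mp fun hlt => lt_irrefl _ ((h1 _).mpr hlt))
  have hl : p.parts.sort (· ≥ ·) = q.parts.sort (· ≥ ·) := by
    refine List.ext_getElem (by simp [hc]) fun i h1 h2 => ?_
    have := h i
    rwa [natPart, natPart, List.getD_eq_getElem _ _ h1, List.getD_eq_getElem _ _ h2] at this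
  ext1
  rw [← Multiset.sort_eq p.parts (· ≥ ·), hl, Multiset.sort_eq]

/-- Sort the sequence decreasingly and subtract the staircase N - 1, …, 0; strict decrease makes the
difference nonnegative and weakly decreasing. -/
theorem exists_shiftedParts {N d : ℕ} (α : Fin N → ℕ) (hinj : Function.Injective α)
    (hsum : ∑ i, α i = d + deltaSum N) :
    ∃ (p : Nat.Partition d) (σ : Equiv.Perm (Fin N)), shiftedParts p N ∘ σ = α := by
  set τ : Equiv.Perm (Fin N) := Fin.revPerm.trans (Tuple.sort α) with hτ
  have hanti : StrictAnti (α ∘ τ) := by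
    have h1 : Antitone (α ∘ τ) := by
      intro i j hij
      exact Tuple.monotone_sort α (Fin.rev_le_rev.mpr hij)
    exact h1.strictAnti_of_injective (hinj.comp τ.injective)
  have hge : ∀ i : Fin N, (i.rev : ℕ) ≤ (α ∘ τ) i := by
    have h1 : ∀ n : ℕ, ∀ i : Fin N, (i.rev : ℕ) = n → n ≤ (α ∘ τ) i := by
      intro n
      induction n with
      | zero => intro i _; exact Nat.zero_le _
      | succ n ih =>
        intro i hi
        simp only [Fin.val_rev] at hi
        have h2 := ih ⟨i + 1, by omega⟩ (by simp only [Fin.val_rev]; omega)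
        have h3 : (α ∘ τ) ⟨i + 1, by omega⟩ < (α ∘ τ) i := hanti (by
          rw [Fin.lt_def]; simp)
        omega
    exact fun i => h1 _ i rfl
  obtain ⟨p, hp⟩ := exists_partition (d := d) (fun i => (α ∘ τ) i - (i.rev : ℕ)) (by
    intro i j hij
    have hle : ∀ n : ℕ, ∀ i j : Fin N, (j : ℕ) = i + n →
        (α ∘ τ) j + n ≤ (α ∘ τ) i := by
      intro n
      induction n with
      | zero => intro i j h; obtain rfl : j = i := Fin.ext (by simpa using h); simp
      | succ n ih =>
        intro i j h
        have hj := j.isLt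
        have h2 := ih i ⟨i + n, by omega⟩ rfl
        have h3 : (α ∘ τ) j < (α ∘ τ) ⟨i + n, by omega⟩ := hanti (by
          rw [Fin.lt_def]; simp [h])
        omega
    have h1 := hle (j - i) i j (by have : (i : ℕ) ≤ j := hij; omega)
    have : (i : ℕ) ≤ j := hij
    have := hge j
    simp only [Fin.val_rev] at *
    omega) (by
    have h1 : ∑ i, ((α ∘ τ) i - (i.rev : ℕ)) + ∑ i : Fin N, (i.rev : ℕ) = ∑ i, (α ∘ τ) i := by
      rw [← Finset.sum_add_distrib]
      exact Finset.sum_congr rfl fun i _ => Nat.sub_add_cancel (hge i)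
    have h2 : ∑ i, (α ∘ τ) i = ∑ i, α i := Equiv.sum_comp τ α
    rw [sum_rev, h2, hsum] at h1
    omega)
  refine ⟨p, τ.symm, ?_⟩
  funext i
  rw [Function.comp_apply, shiftedParts, hp, Nat.sub_add_cancel (hge _)]
  simp

section Cauchy

variable {B : Type*} [CommRing B] [Algebra ℂ B] (φ ψ : TimePoly →ₐ[ℂ] B)

/-- The Cauchy sum `∑_{λ ⊢ d} s_λ[t] s_λ[t']`. -/
def cauchySum (d : ℕ) : B := ∑ p : Nat.Partition d, φ (schur p) * ψ (schur p)

/-- Sequences with a repeated entry contribute 0. Every other one is a permutation of the shifted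
parts of a unique partition, and the sign of the permutation enters squared. -/
theorem altCauchy_eq {N d : ℕ} (hd : d ≤ N) :
    altCauchy φ ψ N (d + deltaSum N) = (N.factorial : ℂ) • cauchySum φ ψ d := by
  have hc : ∀ p : Nat.Partition d, Multiset.card p.parts ≤ N := fun p => (card_parts_le p).trans hd
  have h1 : (N.factorial : ℂ) • cauchySum φ ψ d =
      ∑ x : Nat.Partition d × Equiv.Perm (Fin N), φ (schur x.1) * ψ (schur x.1) := by
    rw [Fintype.sum_prod_type, cauchySum, Finset.smul_sum]
    refine Finset.sum_congr rfl fun p _ => ?_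
    dsimp only
    rw [Finset.sum_const, Finset.card_univ, Fintype.card_perm, Fintype.card_fin,
      Nat.cast_smul_eq_nsmul]
  rw [h1, altCauchy]
  symm
  refine Finset.sum_of_injOn (fun x => shiftedParts x.1 N ∘ x.2) ?_ ?_ ?_ ?_
  · rintro ⟨p, σ⟩ - ⟨q, τ⟩ - h
    simp only at h
    have hr : Set.range (shiftedParts p N) = Set.range (shiftedParts q N) := by
      rw [← σ.surjective.range_comp, h, τ.surjective.range_comp]
    have e := ((shiftedParts_strictAnti p N).range_inj (shiftedParts_strictAnti q N)).mp hr
    have hpq : p = q := by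
      refine partition_ext fun i => ?_
      rcases lt_or_ge i N with hi | hi
      · simpa [shiftedParts] using congrFun e ⟨i, hi⟩
      · rw [natPart_eq_zero p ((hc p).trans hi), natPart_eq_zero q ((hc q).trans hi)]
    subst hpq
    have : σ = τ := Equiv.ext fun i =>
      (shiftedParts_strictAnti p N).injective (congrFun h i)
    rw [this]
  · rintro ⟨p, σ⟩ -
    rw [Finset.mem_coe, mem_exponents]
    simp only [Function.comp_apply]
    rw [Equiv.sum_comp σ (shiftedParts p N), sum_shiftedParts p (hc p)]
  · intro α hα hα'
    rw [mem_exponents] at hα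
    have : natSchur α = 0 := by
      by_contra hne
      have hinj : Function.Injective α := fun i j hij =>
        injective_of_altSchur_ne_zero hne (by simpa using hij)
      obtain ⟨p, σ, h⟩ := exists_shiftedParts α hinj hα
      exact hα' ⟨(p, σ), by simp, h⟩
    rw [this]; simp
  · rintro ⟨p, σ⟩ -
    have h2 := altSchur_perm (fun i => (shiftedParts p N i : ℤ)) σ
    have h3 : natSchur (shiftedParts p N ∘ σ) = ((σ.sign : ℤ) : TimePoly) * schur p := by
      rw [← natSchur_shiftedParts p (hc p)]
      exact h2
    simp only [h3, map_mul, map_intCast]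
    have h4 : (((σ.sign : ℤ) : B)) * ((σ.sign : ℤ) : B) = 1 := by
      rw [← Int.cast_mul, ← Units.val_mul, Int.units_mul_self]; simp
    linear_combination (-(φ (schur p) * ψ (schur p))) * h4

/-- The recursion for the Cauchy sums, which amounts to
`∑_d Q^d ∑_{λ ⊢ d} s_λ[t] s_λ[t'] = exp (∑ k Q^k t_k t'_k)`. -/
theorem cauchySum_rec (d : ℕ) :
    (d : ℂ) • cauchySum φ ψ d = ∑ k ∈ Finset.range d, φ (powerSum k) * ψ (powerSum k) *
        cauchySum φ ψ (d - (k + 1)) := by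
  -- With N = d variables for all the sums involved, the same factor d! appears throughout and
  -- cancels.
  have h := altCauchy_rec φ ψ (le_refl d)
  rw [altCauchy_eq φ ψ le_rfl, Finset.sum_congr rfl fun k _ => by
    rw [altCauchy_eq φ ψ (Nat.sub_le d (k + 1)), mul_smul_comm], ← Finset.smul_sum, smul_comm] at h
  have h0 : (d.factorial : ℂ) ≠ 0 := by exact_mod_cast d.factorial_ne_zero
  exact smul_right_injective B h0 h

end Cauchy

end DoubleHurwitz

end

/-! ### Calculus of formal power series and uniqueness of the solution -/

noncomputable section

namespace DoubleHurwitz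

open MvPowerSeries

/-! ### The chain rule and the formal logarithm -/

/-- For polynomials this is the Leibniz rule. A given coefficient of f(a) sees only a truncation of
f, because high powers of a do not reach it. -/
theorem pderiv_subst {σ R : Type*} [CommRing R] (f : PowerSeries R) {a : MvPowerSeries σ R}
    (ha : PowerSeries.HasSubst a) (v : σ) :
    pderiv R v (f.subst a) = (PowerSeries.derivative R f).subst a * pderiv R v a := by
  classical
  have hpoly : ∀ p : Polynomial R, pderiv R v ((p : PowerSeries R).subst a) =
      (PowerSeries.derivative R (p : PowerSeries R)).subst a * pderiv R v a := by
    intro p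
    simp [PowerSeries.subst_coe ha, PowerSeries.derivative_coe,
      Derivation.comp_aeval_eq (a := a) (pderiv R v) p, smul_eq_mul]
  have hfin : ∀ e : σ →₀ ℕ, ∃ M : ℕ, ∀ d ≥ M, coeff e (a ^ d) = 0 := by
    intro e
    obtain ⟨k, hk⟩ := ha
    refine ⟨e.degree + k, fun d hd => ?_⟩
    exact coeff_eq_zero_of_constantCoeff_nilpotent hk (by omega)
  ext n
  obtain ⟨M, hM⟩ : ∃ M : ℕ, ∀ d ≥ M, coeff (n + Finsupp.single v 1) (a ^ d) = 0 ∧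
      ∀ x ∈ Finset.HasAntidiagonal.antidiagonal n, coeff x.1 (a ^ d) = 0 := by
    choose M hM using hfin
    refine ⟨M (n + Finsupp.single v 1) +
      ∑ x ∈ Finset.HasAntidiagonal.antidiagonal n, M x.1, fun d hd => ⟨hM _ _ (by omega),
      fun x hx => hM _ _ ?_⟩⟩
    have := Finset.single_le_sum (f := fun x : (σ →₀ ℕ) × (σ →₀ ℕ) => M x.1)
      (fun _ _ => Nat.zero_le _) hx
    omega
  have h1 : coeff (n + Finsupp.single v 1) (f.subst a) =
      coeff (n + Finsupp.single v 1) ((↑(PowerSeries.trunc (M + 1) f) : PowerSeries R).subst a) := by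
    rw [PowerSeries.coeff_subst ha, PowerSeries.coeff_subst ha]
    refine finsum_congr fun d => ?_
    rcases lt_or_ge d M with hd | hd
    · rw [PowerSeries.coeff_coe_trunc_of_lt (by omega)]
    · rw [(hM d hd).1]; simp
  rw [coeff_pderiv, h1, ← coeff_pderiv, hpoly, coeff_mul, coeff_mul]
  refine Finset.sum_congr rfl fun x hx => ?_
  congr 1
  rw [PowerSeries.coeff_subst ha, PowerSeries.coeff_subst ha]
  refine finsum_congr fun d => ?_
  rcases lt_or_ge d M with hd | hd
  · rw [PowerSeries.coeff_derivative, PowerSeries.coeff_derivative,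
      PowerSeries.coeff_coe_trunc_of_lt (by omega)]
  · rw [(hM d hd).2 x hx]; simp

section Log

theorem hasSubst_sub_one {R : Type} [CommRing R] {A : Series R} (hA : constantCoeff A = 1) : PowerSeries.HasSubst (A - 1) :=
  PowerSeries.HasSubst.of_constantCoeff_zero (by rw [map_sub, map_one, hA, sub_self])

variable {R : Type} [CommRing R] [Algebra ℚ R] {A : Series R}

theorem constantCoeff_formalLog (hA : constantCoeff A = 1) : constantCoeff (formalLog A) = 0 :=
  PowerSeries.constantCoeff_subst_eq_zero (by rw [map_sub, map_one, hA, sub_self]) _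
    PowerSeries.constantCoeff_log

/-- The derivative of log(1 + X) is inverse to 1 + X, and 1 + X becomes A under the substitution.
The multiplied form avoids inverses over the ring R. -/
theorem pderiv_formalLog_mul (hA : constantCoeff A = 1) (v : Var) :
    pderiv R v (formalLog A) * A = pderiv R v A := by
  have hs := hasSubst_sub_one hA
  rw [formalLog, pderiv_subst _ hs, PowerSeries.deriv_log, map_sub, (pderiv R v).map_one_eq_zero,
    sub_zero]
  have h1 : (PowerSeries.mk fun n : ℕ => algebraMap ℚ R ((-1 : ℚ) ^ n)) *
      (1 + PowerSeries.X : PowerSeries R) = 1 := by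
    ext n
    rw [mul_add, mul_one, map_add]
    cases n with
    | zero => simp
    | succ n => simp [PowerSeries.coeff_succ_mul_X, PowerSeries.coeff_one, pow_succ]
  have h2 := congrArg (PowerSeries.subst (A - 1)) h1
  have h3 : PowerSeries.subst (A - 1) (1 : PowerSeries R) = (1 : Series R) := by
    rw [← PowerSeries.coe_substAlgHom hs, map_one]
  rw [PowerSeries.subst_mul hs, PowerSeries.subst_add hs, PowerSeries.subst_X hs, h3,
    add_sub_cancel] at h2
  linear_combination (pderiv R v A) * h2

end Log

/-! ### Locally finite sums -/

/-- Every monomial occurs in finitely many members of the family. -/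
def LocFin {ι σ R : Type} [CommRing R] (f : ι → MvPowerSeries σ R) : Prop :=
  ∀ m : σ →₀ ℕ, {i | coeff m (f i) ≠ 0}.Finite

section FormalSum

variable {ι σ R : Type} [CommRing R]

theorem coeff_formalSum (f : ι → MvPowerSeries σ R) (m : σ →₀ ℕ) :
    coeff m (formalSum f) = ∑ᶠ i, coeff m (f i) := rfl

theorem formalSum_add {f g : ι → MvPowerSeries σ R} (hf : LocFin f) (hg : LocFin g) :
    formalSum (fun i => f i + g i) = formalSum f + formalSum g := by
  ext m
  simp only [coeff_formalSum, map_add]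
  exact finsum_add_distrib (hf m) (hg m)

theorem formalSum_mul_left {f : ι → MvPowerSeries σ R} (hf : LocFin f) (A : MvPowerSeries σ R) :
    formalSum (fun i => A * f i) = A * formalSum f := by
  classical
  ext m
  simp only [coeff_formalSum, coeff_mul]
  set s : Set ι := ⋃ x ∈ Finset.HasAntidiagonal.antidiagonal m, {i | coeff x.2 (f i) ≠ 0} with hs
  have hsf : s.Finite := Set.Finite.biUnion (Finset.finite_toSet _) fun x _ => hf x.2
  have h1 : ∀ x ∈ Finset.HasAntidiagonal.antidiagonal m,
      ∑ᶠ i, coeff x.2 (f i) = ∑ i ∈ hsf.toFinset, coeff x.2 (f i) := by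
    intro x hx
    refine finsum_eq_sum_of_support_subset _ fun i hi => ?_
    rw [Set.Finite.coe_toFinset]
    exact Set.mem_biUnion (t := fun x : (σ →₀ ℕ) × (σ →₀ ℕ) => {i | coeff x.2 (f i) ≠ 0}) hx hi
  rw [Finset.sum_congr rfl fun x hx => by rw [h1 x hx, Finset.mul_sum], Finset.sum_comm]
  refine finsum_eq_sum_of_support_subset _ fun i hi => ?_
  rw [Set.Finite.coe_toFinset]
  obtain ⟨x, hx, hne⟩ := Finset.exists_ne_zero_of_sum_ne_zero hi
  exact Set.mem_biUnion (t := fun x : (σ →₀ ℕ) × (σ →₀ ℕ) => {i | coeff x.2 (f i) ≠ 0}) hx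
    (right_ne_zero_of_mul hne)

theorem formalSum_eq_sum {f : ι → MvPowerSeries σ R} (s : Finset ι) (h : ∀ i ∉ s, f i = 0) :
    formalSum f = ∑ i ∈ s, f i := by
  ext m
  rw [coeff_formalSum, map_sum]
  refine finsum_eq_sum_of_support_subset _ fun i hi => ?_
  by_contra hi'
  exact hi (by simp [h i hi'])

theorem formalSum_zero : formalSum (fun _ : ι => (0 : MvPowerSeries σ R)) = 0 := by
  rw [formalSum_eq_sum ∅ (by simp), Finset.sum_empty]

theorem coeff_X_mul_of_ne_zero {σ R : Type} [CommSemiring R] (v : σ) {m : σ →₀ ℕ} (h : m v ≠ 0) (A : MvPowerSeries σ R) :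
    coeff m (X v * A) = coeff (m - Finsupp.single v 1) A := by
  classical
  have hle : Finsupp.single v 1 ≤ m := by simpa [Nat.one_le_iff_ne_zero] using h
  rw [X, coeff_monomial_mul, if_pos hle, one_mul]

theorem coeff_X_mul_of_eq_zero {σ R : Type} [CommSemiring R] (v : σ) {m : σ →₀ ℕ} (h : m v = 0) (A : MvPowerSeries σ R) :
    coeff m (X v * A) = 0 := by
  classical
  have hle : ¬ Finsupp.single v 1 ≤ m := by simp [h]
  rw [X, coeff_monomial_mul, if_neg hle]

theorem LocFin.smul {f : ι → MvPowerSeries σ R} (hf : LocFin f) (c : ι → R) :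
    LocFin fun i => c i • f i := fun m => (hf m).subset fun i hi h => hi (by simp [h])

end FormalSum

theorem t_injective : Function.Injective Var.t := fun _ _ h => by injection h

theorem locFin_of_X_mul_X (c : ℕ+ × ℕ+ → ℂ) (f : ℕ+ × ℕ+ → Series ℂ) :
    LocFin fun p : ℕ+ × ℕ+ => c p • (X (Var.t p.1) * X (Var.t p.2) * f p) := by
  refine LocFin.smul (fun m => ?_) c
  have hfin : {k : ℕ+ | m (Var.t k) ≠ 0}.Finite :=
    (m.support.finite_toSet.preimage t_injective.injOn).subset fun k hk => by
      simpa using hk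
  refine (hfin.prod hfin).subset fun p hp => ⟨fun h => hp ?_, fun h => hp ?_⟩
  · rw [mul_assoc, coeff_X_mul_of_eq_zero _ h]
  · rw [mul_comm (X (Var.t p.1)), mul_assoc, coeff_X_mul_of_eq_zero _ h]

theorem locFin_of_X_add (c : ℕ+ × ℕ+ → ℂ) (f : ℕ+ × ℕ+ → Series ℂ) :
    LocFin fun p : ℕ+ × ℕ+ => c p • (X (Var.t (p.1 + p.2)) * f p) := by
  refine LocFin.smul (fun m => ?_) c
  have hfin : {k : ℕ+ | m (Var.t k) ≠ 0}.Finite :=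
    (m.support.finite_toSet.preimage t_injective.injOn).subset fun k hk => by
      simpa using hk
  obtain ⟨b, hb⟩ := hfin.bddAbove
  refine ((Set.finite_Iic b).prod (Set.finite_Iic b)).subset fun p hp => ?_
  have h1 : p.1 + p.2 ≤ b := hb fun h => hp (coeff_X_mul_of_eq_zero _ h _)
  exact ⟨(PNat.lt_add_right p.1 p.2).le.trans h1, (PNat.lt_add_left p.2 p.1).le.trans h1⟩

/-! ### Agreement of coefficients -/

/-- The coefficients of the monomials whose degree in `v` lies in `T` agree. -/
def Agree (v : Var) (T : Set ℕ) (A B : Series ℂ) : Prop :=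
  ∀ m : Var →₀ ℕ, m v ∈ T → coeff m A = coeff m B

namespace Agree

variable {v : Var} {T : Set ℕ} {A A' B B' : Series ℂ}

theorem refl (A : Series ℂ) : Agree v T A A := fun _ _ => rfl

theorem symm (h : Agree v T A B) : Agree v T B A := fun m hm => (h m hm).symm

theorem trans (h : Agree v T A B) (h' : Agree v T B B') : Agree v T A B' :=
  fun m hm => (h m hm).trans (h' m hm)

theorem add (h : Agree v T A B) (h' : Agree v T A' B') : Agree v T (A + A') (B + B') :=
  fun m hm => by rw [map_add, map_add, h m hm, h' m hm]

theorem smul (c : ℂ) (h : Agree v T A B) : Agree v T (c • A) (c • B) :=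
  fun m hm => by rw [map_smul, map_smul, h m hm]

theorem formalSum {ι : Type} {f g : ι → Series ℂ} (h : ∀ i, Agree v T (f i) (g i)) :
    Agree v T (DoubleHurwitz.formalSum f) (DoubleHurwitz.formalSum g) :=
  fun m hm => finsum_congr fun i => h i m hm

theorem sum {ι : Type} {s : Finset ι} {f g : ι → Series ℂ} (h : ∀ i ∈ s, Agree v T (f i) (g i)) :
    Agree v T (∑ i ∈ s, f i) (∑ i ∈ s, g i) :=
  fun m hm => by rw [map_sum, map_sum]; exact Finset.sum_congr rfl fun i hi => h i hi m hm

theorem X_mul {w : Var} (hw : w ≠ v) (h : Agree v T A B) : Agree v T (X w * A) (X w * B) := by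
  intro m hm
  by_cases h0 : m w = 0
  · rw [coeff_X_mul_of_eq_zero _ h0, coeff_X_mul_of_eq_zero _ h0]
  · rw [coeff_X_mul_of_ne_zero _ h0, coeff_X_mul_of_ne_zero _ h0]
    refine h _ ?_
    simpa [Finsupp.single_apply, hw] using hm

theorem pd {w : Var} (hw : w ≠ v) (h : Agree v T A B) :
    Agree v T (DoubleHurwitz.pd w A) (DoubleHurwitz.pd w B) := by
  intro m hm
  rw [DoubleHurwitz.pd, DoubleHurwitz.pd, coeff_pderiv, coeff_pderiv, h]
  simpa [Finsupp.single_apply, hw] using hm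

/-- The factors of a monomial have no larger degree in v, so T has to be closed downwards. -/
theorem mul (hT : IsLowerSet T) (h : Agree v T A B) (h' : Agree v T A' B') :
    Agree v T (A * A') (B * B') := by
  classical
  intro m hm
  rw [coeff_mul, coeff_mul]
  refine Finset.sum_congr rfl fun x hx => ?_
  have hx' : x.1 v + x.2 v = m v := by
    rw [← Finsupp.add_apply, Finset.HasAntidiagonal.mem_antidiagonal.mp hx]
  rw [h x.1 (hT (by omega) hm), h' x.2 (hT (by omega) hm)]

theorem joinTerm (hv : ∀ k, Var.t k ≠ v) (h : Agree v T A B) :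
    Agree v T (DoubleHurwitz.joinTerm A) (DoubleHurwitz.joinTerm B) := by
  refine .smul _ (.formalSum fun p => .smul _ ?_)
  rw [mul_assoc, mul_assoc]
  exact .X_mul (hv _) (.X_mul (hv _) (.pd (hv _) h))

theorem cutTerm (hv : ∀ k, Var.t k ≠ v) (h : Agree v T A B) :
    Agree v T (DoubleHurwitz.cutTerm A) (DoubleHurwitz.cutTerm B) :=
  .smul _ (.formalSum fun _ => .smul _ (.X_mul (hv _) (.pd (hv _) (.pd (hv _) h))))

theorem quadTerm (hv : ∀ k, Var.t k ≠ v) (hT : IsLowerSet T) {F G : ℕ → Series ℂ} {n : ℕ}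
    (h : ∀ i ≤ n, Agree v T (F i) (G i)) :
    Agree v T (DoubleHurwitz.quadTerm F n) (DoubleHurwitz.quadTerm G n) :=
  .smul _ (.formalSum fun _ => .smul _ (.X_mul (hv _) (.sum fun i hi =>
    .mul hT (.pd (hv _) (h i (Nat.lt_succ_iff.mp (Finset.mem_range.mp hi))))
      (.pd (hv _) (h _ (Nat.sub_le _ _))))))

end Agree

theorem t_ne_beta (k : ℕ+) : Var.t k ≠ Var.beta := nofun

theorem t_ne_Q (k : ℕ+) : Var.t k ≠ Var.Q := nofun

/-! ### Uniqueness of the solution -/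

theorem coeff_pd_beta (A : Series ℂ) (m : Var →₀ ℕ) :
    coeff m (pd Var.beta A) = coeff (m + Finsupp.single Var.beta 1) A * (m Var.beta + 1) :=
  coeff_pderiv A m

/-- If the degree in `v` is positive, the exponent is the successor of another one in `v`. -/
theorem exists_add_single {σ : Type*} {m : σ →₀ ℕ} {v : σ} (h : m v ≠ 0) :
    ∃ m', m = m' + Finsupp.single v 1 := by
  classical
  exact ⟨m - Finsupp.single v 1, (tsub_add_cancel_of_le (by
    simpa [Nat.one_le_iff_ne_zero] using h)).symm⟩

/-- Induction on n, and for fixed n on the degree in β. The coefficients of β-degree b + 1 are given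
by the right-hand side in degree b, which involves F_0, …, F_n only in degrees at most b. -/
theorem eq_of_cutJoinEq {F G : ℕ → Series ℂ} {N : ℕ}
    (hF : ∀ n ≤ N, CutJoinEq F n ∧ InitialCond F n)
    (hG : ∀ n ≤ N, CutJoinEq G n ∧ InitialCond G n) : ∀ n ≤ N, G n = F n := by
  intro n
  induction n using Nat.strong_induction_on with
  | _ n ih =>
    intro hn
    have key : ∀ b : ℕ, Agree Var.beta (Set.Iic b) (G n) (F n) := by
      intro b
      induction b with
      | zero =>
        intro m hm
        have hm0 : m Var.beta = 0 := Nat.le_zero.mp hm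
        have h := (hG n hn).2.trans (hF n hn).2.symm
        have h' := congrArg (coeff m) h
        change (if m Var.beta = 0 then coeff m (G n) else 0) =
          (if m Var.beta = 0 then coeff m (F n) else 0) at h'
        simpa [hm0] using h'
      | succ b ihb =>
        intro m hm
        by_cases hm0 : m Var.beta = 0
        · exact ihb m (by simp [hm0])
        · obtain ⟨m', rfl⟩ := exists_add_single hm0
          have hm' : m' Var.beta ∈ Set.Iic b := by simpa using hm
          have hall : ∀ i ≤ n, Agree Var.beta (Set.Iic b) (G i) (F i) := by
            intro i hi
            rcases hi.eq_or_lt with rfl | hi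
            · exact ihb
            · rw [ih i hi (by omega)]
              exact .refl _
          have hcut : Agree Var.beta (Set.Iic b)
              (if n = 0 then 0 else cutTerm (G (n - 1)))
              (if n = 0 then 0 else cutTerm (F (n - 1))) := by
            split_ifs
            · exact .refl _
            · exact (hall (n - 1) (Nat.sub_le _ _)).cutTerm t_ne_beta
          have hrhs := ((ihb.joinTerm t_ne_beta).add hcut).add
            (Agree.quadTerm t_ne_beta (isLowerSet_Iic b) hall)
          have h := hrhs m' hm'
          rw [← (hG n hn).1, ← (hF n hn).1, coeff_pd_beta, coeff_pd_beta] at h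
          exact mul_right_cancel₀ (Nat.cast_add_one_ne_zero _) h
    ext m
    exact key (m Var.beta) m (Set.mem_Iic.mpr le_rfl)

end DoubleHurwitz

end

/-! ### The cut-and-join equation for Z -/

noncomputable section

namespace DoubleHurwitz

open MvPowerSeries

/-! ### The terms of the generating function -/

/-- Evaluation of a polynomial in the times at `t`. -/
def evalT : TimePoly →ₐ[ℂ] Series ℂ := MvPolynomial.aeval fun k : ℕ+ => (X (Var.t k) : Series ℂ)

/-- Evaluation of a polynomial in the times at `-t̄`. -/
def evalTbar : TimePoly →ₐ[ℂ] Series ℂ :=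
  MvPolynomial.aeval fun k : ℕ+ => (-X (Var.tbar k) : Series ℂ)

/-- The series `exp (c β)`. -/
def expBeta (c : ℂ) : Series ℂ :=
  (PowerSeries.exp ℂ).subst (C c * X Var.beta : Series ℂ)

/-- The contribution of a partition to the generating function. -/
def term {d : ℕ} (p : Nat.Partition d) : Series ℂ :=
  expBeta ((kappa p : ℂ) / 2) * X Var.Q ^ d * evalT (schur p) * evalTbar (schur p)

theorem Z_eq : Z = formalSum fun p : (Σ d : ℕ, Nat.Partition d) => term p.2 := rfl

/-- The part of the generating function of degree `d` in `Q`. -/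
def Zdeg (d : ℕ) : Series ℂ := ∑ p : Nat.Partition d, term p

theorem derivation_aeval {ι A : Type*} [CommRing A] [Algebra ℂ A] (D : Derivation ℂ A A)
    [DecidableEq ι] (f : ι → A) (j : ι) (c : A) (h : ∀ k, D (f k) = if k = j then c else 0)
    (p : MvPolynomial ι ℂ) :
    D (MvPolynomial.aeval f p) = c * MvPolynomial.aeval f (MvPolynomial.pderiv j p) := by
  induction p using MvPolynomial.induction_on with
  | C a => simp
  | add p q hp hq => rw [map_add, map_add, hp, hq, map_add, map_add, mul_add]
  | mul_X p k hp =>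
    rw [map_mul, Derivation.leibniz, hp, MvPolynomial.aeval_X, h, Derivation.leibniz,
      MvPolynomial.pderiv_X, map_add, smul_eq_mul, smul_eq_mul, smul_eq_mul, smul_eq_mul, map_mul,
      map_mul, MvPolynomial.aeval_X]
    by_cases hk : k = j
    · subst hk; simp; ring
    · simp [hk]; ring

theorem derivation_aeval_eq_zero {ι A : Type*} [CommRing A] [Algebra ℂ A] (D : Derivation ℂ A A)
    (f : ι → A) (h : ∀ k, D (f k) = 0) (p : MvPolynomial ι ℂ) :
    D (MvPolynomial.aeval f p) = 0 := by
  induction p using MvPolynomial.induction_on with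
  | C a => simp
  | add p q hp hq => rw [map_add, map_add, hp, hq, add_zero]
  | mul_X p k hp =>
    rw [map_mul, Derivation.leibniz, hp, MvPolynomial.aeval_X, h]; simp

theorem pd_evalT_t (k : ℕ+) (p : TimePoly) :
    pd (Var.t k) (evalT p) = evalT (MvPolynomial.pderiv k p) := by
  classical
  rw [pd, evalT, derivation_aeval (pderiv ℂ (Var.t k)) _ k 1, one_mul]
  intro l
  by_cases h : l = k
  · subst h; simp
  · rw [if_neg h, pderiv_X_of_ne fun e => h (t_injective e)]

theorem pd_evalT (v : Var) (hv : ∀ k, Var.t k ≠ v) (p : TimePoly) : pd v (evalT p) = 0 :=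
  derivation_aeval_eq_zero (pderiv ℂ v) _ (fun k => pderiv_X_of_ne (hv k)) p

theorem pd_evalTbar (v : Var) (hv : ∀ k, Var.tbar k ≠ v) (p : TimePoly) :
    pd v (evalTbar p) = 0 :=
  derivation_aeval_eq_zero (pderiv ℂ v) _
    (fun k => by rw [map_neg, pderiv_X_of_ne (hv k), neg_zero]) p

theorem hasSubst_C_mul_X (c : ℂ) : PowerSeries.HasSubst (C c * X Var.beta : Series ℂ) :=
  PowerSeries.HasSubst.of_constantCoeff_zero (by simp)

theorem pd_expBeta_beta (c : ℂ) : pd Var.beta (expBeta c) = c • expBeta c := by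
  rw [pd, expBeta, pderiv_subst _ (hasSubst_C_mul_X c), PowerSeries.derivative_exp,
    Derivation.leibniz, pderiv_C, pderiv_X_self, smul_zero, add_zero, smul_eq_mul, mul_one,
    smul_eq_C_mul, mul_comm]

theorem pd_expBeta (c : ℂ) {v : Var} (hv : v ≠ Var.beta) : pd v (expBeta c) = 0 := by
  rw [pd, expBeta, pderiv_subst _ (hasSubst_C_mul_X c), Derivation.leibniz, pderiv_C,
    pderiv_X_of_ne hv.symm]
  simp

theorem constantCoeff_expBeta (c : ℂ) : constantCoeff (expBeta c) = 1 := by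
  rw [expBeta, PowerSeries.constantCoeff_subst (hasSubst_C_mul_X c), finsum_eq_single _ 0]
  · simp
  · intro n hn; simp [hn]

theorem pd_mul (v : Var) (A B : Series ℂ) : pd v (A * B) = pd v A * B + A * pd v B := by
  rw [pd, Derivation.leibniz, smul_eq_mul, smul_eq_mul, pd, pd]; ring

theorem pd_pow_eq_zero {v : Var} {A : Series ℂ} (h : pd v A = 0) (n : ℕ) : pd v (A ^ n) = 0 := by
  rw [pd, Derivation.leibniz_pow, ← pd, h]; simp

theorem pd_X_of_ne {v w : Var} (h : w ≠ v) : pd v (X w) = 0 := pderiv_X_of_ne h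

/-- The factors of a term which do not involve `t`. -/
def termCoeff {d : ℕ} (p : Nat.Partition d) : Series ℂ :=
  expBeta ((kappa p : ℂ) / 2) * X Var.Q ^ d * evalTbar (schur p)

theorem term_eq {d : ℕ} (p : Nat.Partition d) : term p = termCoeff p * evalT (schur p) := by
  rw [term, termCoeff]; ring

theorem pd_t_termCoeff {d : ℕ} (p : Nat.Partition d) (k : ℕ+) :
    pd (Var.t k) (termCoeff p) = 0 := by
  rw [termCoeff, pd_mul, pd_mul, pd_expBeta _ (t_ne_beta k),
    pd_pow_eq_zero (pd_X_of_ne (t_ne_Q k).symm), pd_evalTbar (Var.t k) (fun _ => nofun)]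
  simp

theorem pd_beta_term {d : ℕ} (p : Nat.Partition d) :
    pd Var.beta (term p) = ((kappa p : ℂ) / 2) • term p := by
  rw [term, pd_mul, pd_mul, pd_mul, pd_expBeta_beta, pd_pow_eq_zero (pd_X_of_ne (show Var.Q ≠ Var.beta from nofun)),
    pd_evalTbar Var.beta (fun _ => nofun), pd_evalT Var.beta (fun _ => nofun)]
  simp only [mul_zero, add_zero, smul_mul_assoc]

theorem X_mul_pd_Q_pow (d : ℕ) :
    X Var.Q * pd Var.Q (X Var.Q ^ d : Series ℂ) = (d : ℂ) • (X Var.Q ^ d : Series ℂ) := by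
  rw [pd, Derivation.leibniz_pow, pderiv_X_self]
  cases d with
  | zero => simp
  | succ d =>
    rw [Nat.add_sub_cancel, smul_eq_mul, mul_one, ← Nat.cast_smul_eq_nsmul ℂ, mul_smul_comm,
      ← pow_succ']

theorem X_mul_pd_Q_term {d : ℕ} (p : Nat.Partition d) :
    X Var.Q * pd Var.Q (term p) = (d : ℂ) • term p := by
  rw [term, pd_mul, pd_mul, pd_mul, pd_expBeta _ (show Var.Q ≠ Var.beta from nofun),
    pd_evalTbar Var.Q (fun _ => nofun), pd_evalT Var.Q (fun _ => nofun)]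
  simp only [mul_zero, add_zero, zero_mul, zero_add]
  rw [← mul_assoc, ← mul_assoc, mul_left_comm, X_mul_pd_Q_pow]
  simp only [smul_mul_assoc, mul_smul_comm]

theorem coeff_X_mul_pd (v : Var) (A : Series ℂ) (m : Var →₀ ℕ) :
    coeff m (X v * pd v A) = (m v : ℂ) * coeff m A := by
  by_cases h : m v = 0
  · rw [coeff_X_mul_of_eq_zero _ h, h, Nat.cast_zero, zero_mul]
  · obtain ⟨m', rfl⟩ := exists_add_single h
    rw [coeff_X_mul_of_ne_zero _ h, pd, coeff_pderiv, add_tsub_cancel_right]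
    simp [mul_comm]

/-- The operator Q ∂/∂Q acts on the term by d, and on the monomial by its degree in Q. -/
theorem coeff_term_eq_zero {d : ℕ} (p : Nat.Partition d) {m : Var →₀ ℕ} (h : m Var.Q ≠ d) :
    coeff m (term p) = 0 := by
  have h1 := congrArg (coeff m) (X_mul_pd_Q_term p)
  rw [coeff_X_mul_pd, map_smul, smul_eq_mul, ← sub_eq_zero, ← sub_mul] at h1
  rcases mul_eq_zero.mp h1 with h2 | h2
  · exact absurd (by exact_mod_cast sub_eq_zero.mp h2) h
  · exact h2

/-- In each degree in Q the sum over partitions is finite, so operators not involving Q can be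
applied term by term. -/
theorem agree_Z (d : ℕ) : Agree Var.Q {d} Z (Zdeg d) := by
  intro m hm
  have hm : m Var.Q = d := hm
  rw [Z_eq, coeff_formalSum, Zdeg, map_sum]
  rw [finsum_eq_sum_of_support_subset (s := Finset.univ.map
    ⟨fun p : Nat.Partition d => (⟨d, p⟩ : Σ d : ℕ, Nat.Partition d), fun p q h => by
      simpa using h⟩)]
  · rw [Finset.sum_map]; rfl
  · rintro ⟨d', p⟩ hp
    have : d' = d := by
      by_contra hne
      exact hp (coeff_term_eq_zero p (by rw [hm]; exact fun e => hne e.symm))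
    subst this
    simp only [Finset.coe_map, Finset.coe_univ, Set.image_univ, Set.mem_range]
    exact ⟨p, rfl⟩

/-! ### The evolution equation for the generating function -/

theorem exists_pderiv_eq_zero (f : TimePoly) :
    ∃ M : ℕ, ∀ n ≥ M, MvPolynomial.pderiv n.succPNat f = 0 := by
  obtain ⟨b, hb⟩ := f.vars.bddAbove
  refine ⟨b, fun n hn => MvPolynomial.pderiv_eq_zero_of_notMem_vars fun h => ?_⟩
  have h1 : (n.succPNat : ℕ) ≤ b := hb h
  simp at h1
  omega

theorem evalT_powerSum (k : ℕ) :
    evalT (powerSum k) = ((k : ℂ) + 1) • X (Var.t k.succPNat) := by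
  rw [powerSum, map_smul, evalT, MvPolynomial.aeval_X]

/-- The pairs `(k, l)` of positive integers at most `M`. -/
def pairs (M : ℕ) : Finset (ℕ+ × ℕ+) :=
  (Finset.range M ×ˢ Finset.range M).map
    ⟨fun p => (p.1.succPNat, p.2.succPNat), fun _ _ h =>
      Prod.ext (Nat.succPNat_injective (congrArg Prod.fst h))
        (Nat.succPNat_injective (congrArg Prod.snd h))⟩

theorem sum_pairs {B : Type*} [AddCommMonoid B] (M : ℕ) (g : ℕ+ × ℕ+ → B) :
    ∑ p ∈ pairs M, g p =
      ∑ k ∈ Finset.range M, ∑ l ∈ Finset.range M, g (k.succPNat, l.succPNat) := by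
  rw [pairs, Finset.sum_map, Finset.sum_product]
  rfl

theorem mem_pairs {M : ℕ} {p : ℕ+ × ℕ+} (h1 : p.1.natPred < M) (h2 : p.2.natPred < M) :
    p ∈ pairs M := by
  rw [pairs, Finset.mem_map]
  exact ⟨(p.1.natPred, p.2.natPred), by simp [h1, h2],
    Prod.ext (PNat.succPNat_natPred _) (PNat.succPNat_natPred _)⟩

theorem succPNat_add_succPNat (k l : ℕ) : k.succPNat + l.succPNat = (k + l + 1).succPNat := by
  apply PNat.eq; simp; ring

/-- The polynomial f involves finitely many times, so both formal sums reduce to pairs of indices at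
most M. For the cut term either index being large suffices, as the derivatives commute. -/
theorem joinTerm_add_cutTerm_mul_evalT (c : Series ℂ) (hc : ∀ k, pd (Var.t k) c = 0) {M : ℕ}
    {f : TimePoly} (hM : ∀ n ≥ M, MvPolynomial.pderiv n.succPNat f = 0) :
    joinTerm (c * evalT f) + cutTerm (c * evalT f) =
      (1 / 2 : ℂ) • (c * evalT (cutJoin M f)) := by
  have hd : ∀ (k : ℕ+) (g : TimePoly), pd (Var.t k) (c * evalT g) =
      c * evalT (MvPolynomial.pderiv k g) := by
    intro k g
    rw [pd_mul, hc, zero_mul, zero_add, pd_evalT_t]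
  have hM' : ∀ k : ℕ+, M ≤ k.natPred → MvPolynomial.pderiv k f = 0 := by
    intro k hk
    simpa using hM _ hk
  rw [joinTerm, cutTerm, ← smul_add, formalSum_eq_sum (pairs M), formalSum_eq_sum (pairs M),
    ← Finset.sum_add_distrib]
  · congr 1
    rw [sum_pairs, cutJoin, map_sum, Finset.mul_sum]
    refine Finset.sum_congr rfl fun k _ => ?_
    rw [map_sum, Finset.mul_sum]
    refine Finset.sum_congr rfl fun l _ => ?_
    simp only [succPNat_add_succPNat, hd, map_add, map_mul,
      evalT_powerSum]
    push_cast
    simp only [smul_eq_C_mul, Nat.succPNat_coe, Nat.succ_eq_add_one, map_add, map_mul, map_natCast,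
      map_one, Nat.cast_add, Nat.cast_one]
    ring
  · intro p hp
    have h : MvPolynomial.pderiv p.1 (MvPolynomial.pderiv p.2 f) = 0 := by
      by_cases h1 : p.1.natPred < M
      · rw [hM' p.2 (not_lt.mp fun h2 => hp (mem_pairs h1 h2)), map_zero]
      · by_cases h2 : p.2.natPred < M
        · have hcomm : MvPolynomial.pderiv p.1 (MvPolynomial.pderiv p.2 f) =
              MvPolynomial.pderiv p.2 (MvPolynomial.pderiv p.1 f) := by
            have h0 : ⁅(MvPolynomial.pderiv p.1 : Derivation ℂ TimePoly TimePoly),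
                (MvPolynomial.pderiv p.2 : Derivation ℂ TimePoly TimePoly)⁆ = 0 := by
              classical
              refine MvPolynomial.derivation_ext fun i => ?_
              simp only [Derivation.commutator_apply, MvPolynomial.pderiv_X, Pi.single_apply]
              split_ifs <;> simp
            rw [← sub_eq_zero, ← Derivation.commutator_apply, h0]
            rfl
          rw [hcomm, hM' p.1 (not_lt.mp h1), map_zero]
        · rw [hM' p.2 (not_lt.mp h2), map_zero]
    rw [hd, hd, h]; simp
  · intro p hp
    have h : MvPolynomial.pderiv (p.1 + p.2) f = 0 := by
      refine hM' _ ?_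
      by_contra hlt
      have e : (p.1 + p.2).natPred + 1 = p.1.natPred + 1 + (p.2.natPred + 1) := by
        simp only [PNat.natPred_add_one, PNat.add_coe]
      exact hp (mem_pairs (by omega) (by omega))
    rw [hd, h]; simp

/-- With α_i = λ_i + r and r = n - i, the difference of a² - (2n - 1) a at a = α_i and a = r is λ_i
(λ_i - 2i + 1). The subtracted sum in `cutJoin_altSchur` is the sum over these r. -/
theorem cutJoin_schur {d : ℕ} (p : Nat.Partition d) {M : ℕ}
    (hM : ∀ i, 2 * (shiftedParts p (Multiset.card p.parts) i : ℤ) ≤ M) :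
    cutJoin M (schur p) = (kappa p : ℂ) • schur p := by
  have h := cutJoin_altSchur (fun i => (shiftedParts p (Multiset.card p.parts) i : ℤ)) hM
  rw [← natSchur, natSchur_shiftedParts_card] at h
  rw [h]
  congr 1
  set n := Multiset.card p.parts
  have e : ∑ j ∈ Finset.range n, ((j : ℂ) ^ 2 - (2 * n - 1) * j) =
      ∑ i : Fin n, (((i.rev : ℕ) : ℂ) ^ 2 - (2 * n - 1) * (i.rev : ℕ)) := by
    rw [Finset.sum_range]
    exact (Equiv.sum_comp Fin.revPerm
      (fun i : Fin n => ((i : ℂ) ^ 2 - (2 * n - 1) * (i : ℂ)))).symm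
  rw [e, ← Finset.sum_sub_distrib, kappa, Int.cast_sum]
  refine Finset.sum_congr rfl fun i _ => ?_
  have hr : ((i.rev : ℕ) : ℂ) = n - (i + 1) := by
    rw [Fin.val_rev, Nat.cast_sub i.isLt]; push_cast; ring
  simp only [shiftedParts, part_eq]
  push_cast
  rw [hr]
  ring

theorem joinTerm_add_cutTerm_term {d : ℕ} (p : Nat.Partition d) :
    joinTerm (term p) + cutTerm (term p) = pd Var.beta (term p) := by
  obtain ⟨M₁, h1⟩ := exists_pderiv_eq_zero (schur p)
  obtain ⟨M₂, h2⟩ : ∃ M : ℕ, ∀ i, 2 * (shiftedParts p (Multiset.card p.parts) i : ℤ) ≤ M := by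
    refine ⟨2 * ∑ i, shiftedParts p (Multiset.card p.parts) i, fun i => ?_⟩
    have := Finset.single_le_sum (f := shiftedParts p (Multiset.card p.parts))
      (fun _ _ => Nat.zero_le _) (Finset.mem_univ i)
    exact_mod_cast Nat.mul_le_mul_left 2 this
  rw [pd_beta_term, term_eq, joinTerm_add_cutTerm_mul_evalT _ (pd_t_termCoeff p)
    (M := max M₁ M₂) fun n hn => h1 n ((le_max_left _ _).trans hn),
    cutJoin_schur p fun i => (h2 i).trans (by exact_mod_cast le_max_right _ _), map_smul,
    mul_smul_comm, smul_smul]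
  congr 1
  ring

/-- The family whose sum is `2 joinTerm A`. -/
theorem locFin_join (A : Series ℂ) : LocFin fun p : ℕ+ × ℕ+ =>
    ((p.1 : ℂ) * (p.2 : ℂ)) • (X (Var.t p.1) * X (Var.t p.2) * pd (Var.t (p.1 + p.2)) A) :=
  locFin_of_X_mul_X (fun p => (p.1 : ℂ) * (p.2 : ℂ)) _

theorem locFin_cut (f : ℕ+ × ℕ+ → Series ℂ) : LocFin fun p : ℕ+ × ℕ+ =>
    ((p.1 : ℂ) + (p.2 : ℂ)) • (X (Var.t (p.1 + p.2)) * f p) :=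
  locFin_of_X_add (fun p => (p.1 : ℂ) + (p.2 : ℂ)) f

theorem joinTerm_add (A B : Series ℂ) : joinTerm (A + B) = joinTerm A + joinTerm B := by
  simp only [joinTerm]
  rw [← smul_add, ← formalSum_add (locFin_join A) (locFin_join B)]
  congr 2
  funext p
  rw [pd, map_add, mul_add, smul_add, pd, pd]

theorem cutTerm_add (A B : Series ℂ) : cutTerm (A + B) = cutTerm A + cutTerm B := by
  simp only [cutTerm]
  rw [← smul_add, ← formalSum_add (locFin_cut _) (locFin_cut _)]
  congr 2
  funext p
  simp only [pd, map_add, mul_add, smul_add]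

theorem joinTerm_zero : joinTerm 0 = 0 := by simpa using joinTerm_add 0 0

theorem cutTerm_zero : cutTerm 0 = 0 := by simpa using cutTerm_add 0 0

theorem joinTerm_sum {ι : Type} (s : Finset ι) (f : ι → Series ℂ) :
    joinTerm (∑ i ∈ s, f i) = ∑ i ∈ s, joinTerm (f i) :=
  map_sum (⟨⟨joinTerm, joinTerm_zero⟩, joinTerm_add⟩ : Series ℂ →+ Series ℂ) f s

theorem cutTerm_sum {ι : Type} (s : Finset ι) (f : ι → Series ℂ) :
    cutTerm (∑ i ∈ s, f i) = ∑ i ∈ s, cutTerm (f i) :=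
  map_sum (⟨⟨cutTerm, cutTerm_zero⟩, cutTerm_add⟩ : Series ℂ →+ Series ℂ) f s

/-- The cut-and-join equation for the generating function. -/
theorem pd_beta_Z : pd Var.beta Z = joinTerm Z + cutTerm Z := by
  have h : ∀ d, pd Var.beta (Zdeg d) = joinTerm (Zdeg d) + cutTerm (Zdeg d) := by
    intro d
    rw [Zdeg, joinTerm_sum, cutTerm_sum, ← Finset.sum_add_distrib, pd, map_sum]
    exact Finset.sum_congr rfl fun p _ => (joinTerm_add_cutTerm_term p).symm
  ext m
  have h1 := (agree_Z (m Var.Q)).pd (w := Var.beta) (show Var.beta ≠ Var.Q from nofun) m rfl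
  have h2 := (((agree_Z (m Var.Q)).joinTerm t_ne_Q).add ((agree_Z (m Var.Q)).cutTerm t_ne_Q)) m rfl
  rw [h1, h, h2]

end DoubleHurwitz

end

/-! ### The evolution equation and the initial value of log Z -/

noncomputable section

namespace DoubleHurwitz

open MvPowerSeries

/-! ### The evolution equation for the logarithm -/

theorem expBeta_zero : expBeta 0 = 1 := by
  refine pderiv.ext (fun v => ?_) ?_
  · by_cases h : v = Var.beta
    · subst h
      have := pd_expBeta_beta 0
      rw [zero_smul] at this
      rw [pderiv_one]; exact this
    · rw [pderiv_one]; exact pd_expBeta 0 h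
  · rw [constantCoeff_expBeta, map_one]

theorem Zdeg_zero : Zdeg 0 = 1 := by
  have h : ∀ p : Nat.Partition 0, term p = 1 := by
    intro p
    have hp : p.parts = 0 := Nat.Partition.partition_zero_parts p
    have hc : Multiset.card p.parts = 0 := by rw [hp, Multiset.card_zero]
    have : IsEmpty (Fin (Multiset.card p.parts)) := by rw [hc]; infer_instance
    rw [term, schur, kappa, Matrix.det_isEmpty, Finset.univ_eq_empty, Finset.sum_empty]
    simp [expBeta_zero]
  rw [Zdeg, Finset.sum_congr rfl fun p _ => h p]
  simp

theorem agree_Z_one : Agree Var.Q {0} Z 1 := by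
  rw [← Zdeg_zero]; exact agree_Z 0

theorem constantCoeff_Z : constantCoeff Z = 1 := by
  have h := agree_Z_one 0 rfl
  simpa using h

theorem Z_ne_zero : Z ≠ 0 := fun h => by
  have := constantCoeff_Z
  rw [h, map_zero] at this
  exact zero_ne_one this

/-- The logarithm of the generating function. -/
def logZ : Series ℂ := formalLog Z

theorem pd_logZ_mul (v : Var) : pd v logZ * Z = pd v Z := pderiv_formalLog_mul constantCoeff_Z v

/-- `½ ∑_{k,l ≥ 1} (k + l) t_{k+l} (∂A/∂t_k) (∂A/∂t_l)`. -/
def squareTerm (A : Series ℂ) : Series ℂ :=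
  (1 / 2 : ℂ) • formalSum fun p : ℕ+ × ℕ+ =>
    ((p.1 : ℂ) + (p.2 : ℂ)) • (X (Var.t (p.1 + p.2)) * (pd (Var.t p.1) A * pd (Var.t p.2) A))

/-- With L = log Z, ∂Z = Z ∂L and ∂_k ∂_l Z = Z (∂_k ∂_l L + ∂_k L ∂_l L). Thus the cut term of Z
splits into the cut and square terms of L, and the nonzero factor Z is cancelled. -/
theorem pd_beta_logZ : pd Var.beta logZ = joinTerm logZ + cutTerm logZ + squareTerm logZ := by
  have hj : Z * joinTerm logZ = joinTerm Z := by
    rw [joinTerm, joinTerm, mul_smul_comm, ← formalSum_mul_left (locFin_join _)]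
    congr 2
    funext p
    rw [mul_smul_comm, ← pd_logZ_mul]
    congr 1; ring
  have hc : Z * (cutTerm logZ + squareTerm logZ) = cutTerm Z := by
    rw [cutTerm, cutTerm, squareTerm, ← smul_add, ← formalSum_add (locFin_cut _) (locFin_cut _),
      mul_smul_comm]
    simp only [← smul_add, ← mul_add]
    rw [← formalSum_mul_left (locFin_cut _)]
    congr 2
    funext p
    have h : pd (Var.t p.1) (pd (Var.t p.2) Z) =
        Z * (pd (Var.t p.1) (pd (Var.t p.2) logZ) + pd (Var.t p.1) logZ * pd (Var.t p.2) logZ) := by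
      rw [← pd_logZ_mul (Var.t p.2), pd_mul, ← pd_logZ_mul (Var.t p.1)]
      ring
    rw [h, mul_smul_comm, mul_left_comm]
  refine mul_right_cancel₀ Z_ne_zero ?_
  rw [pd_logZ_mul, pd_beta_Z, ← hj, ← hc]
  ring

/-! ### The initial condition -/

theorem exists_ne_zero_of_ne_zero {v : Var} {m : Var →₀ ℕ} (hm : m ≠ 0) (hv : m v = 0) :
    ∃ w, w ≠ v ∧ m w ≠ 0 := by
  obtain ⟨w, hw⟩ := Finsupp.ne_iff.mp hm
  exact ⟨w, fun e => hw (by rw [e, hv]; rfl), hw⟩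

theorem coeff_eq_zero_of_X_mul_pd {A : Series ℂ} {m : Var →₀ ℕ} {v : Var} (hv : m v ≠ 0)
    (h : coeff m (X v * pd v A) = 0) : coeff m A = 0 := by
  rw [coeff_X_mul_pd] at h
  exact (mul_eq_zero.mp h).resolve_left (Nat.cast_ne_zero.mpr hv)

/-- A nonconstant monomial free of v contains some other variable w, and w ∂/∂w multiplies its
coefficient by a positive integer. -/
theorem agree_of_pd_eq_zero {v : Var} {A : Series ℂ}
    (h : ∀ w ≠ v, Agree v {0} (pd w A) 0) : Agree v {0} A (C (constantCoeff A)) := by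
  classical
  intro m hm
  rw [coeff_C]
  split_ifs with h0
  · rw [h0, coeff_zero_eq_constantCoeff_apply]
  · obtain ⟨w, hwv, hw⟩ := exists_ne_zero_of_ne_zero h0 hm
    refine coeff_eq_zero_of_X_mul_pd hw ?_
    rw [(h w hwv).X_mul hwv m hm]
    simp

theorem agree_expBeta (c : ℂ) : Agree Var.beta {0} (expBeta c) 1 := by
  have h := agree_of_pd_eq_zero (v := Var.beta) (A := expBeta c)
    fun w hw => by rw [pd_expBeta c hw]; exact .refl _
  rwa [constantCoeff_expBeta, map_one] at h

theorem isLowerSet_zero : IsLowerSet ({0} : Set ℕ) := by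
  rw [show ({0} : Set ℕ) = Set.Iic 0 by ext; simp]
  exact isLowerSet_Iic 0

theorem agree_logZ_Q : Agree Var.Q {0} logZ 0 := by
  have h := agree_of_pd_eq_zero (v := Var.Q) (A := logZ) fun w hw => by
    have h1 := ((Agree.refl (pd w logZ)).mul isLowerSet_zero agree_Z_one)
    rw [mul_one, pd_logZ_mul] at h1
    have h2 := agree_Z_one.pd hw
    rw [show pd w 1 = 0 from pderiv_one] at h2
    exact h1.symm.trans h2
  rwa [logZ, constantCoeff_formalLog constantCoeff_Z, map_zero] at h

/-- The part of degree `d` in `Q` of the generating function at `β = 0`. -/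
def Zzero (d : ℕ) : Series ℂ := X Var.Q ^ d * cauchySum evalT evalTbar d

/-- The term of degree `k + 1` in `Q` of `Q ∂/∂Q` of the initial value. -/
def sourceTerm (k : ℕ) : Series ℂ :=
  X Var.Q ^ (k + 1) * (evalT (powerSum k) * evalTbar (powerSum k))

theorem agree_Zdeg (d : ℕ) : Agree Var.beta {0} (Zdeg d) (Zzero d) := by
  rw [Zdeg, Zzero, cauchySum, Finset.mul_sum]
  refine .sum fun p _ => ?_
  have h := ((((agree_expBeta ((kappa p : ℂ) / 2)).mul isLowerSet_zero
    (.refl (X Var.Q ^ d))).mul isLowerSet_zero (.refl (evalT (schur p)))).mul isLowerSet_zero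
    (.refl (evalTbar (schur p))))
  rw [one_mul, mul_assoc (X Var.Q ^ d)] at h
  exact h

theorem pd_Q_cauchySum (d : ℕ) : pd Var.Q (cauchySum evalT evalTbar d) = 0 := by
  rw [cauchySum, pd, map_sum]
  refine Finset.sum_eq_zero fun p _ => ?_
  rw [← pd, pd_mul, pd_evalTbar Var.Q (fun _ => nofun), pd_evalT Var.Q (fun _ => nofun)]
  simp

theorem coeff_X_pow_mul_eq_zero {A : Series ℂ} (hA : pd Var.Q A = 0) {d : ℕ} {m : Var →₀ ℕ}
    (h : m Var.Q ≠ d) : coeff m (X Var.Q ^ d * A) = 0 := by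
  have h1 : X Var.Q * pd Var.Q (X Var.Q ^ d * A) = (d : ℂ) • (X Var.Q ^ d * A) := by
    rw [pd_mul, hA, mul_zero, add_zero, ← mul_assoc, X_mul_pd_Q_pow, smul_mul_assoc]
  have h1 := congrArg (coeff m) h1
  rw [coeff_X_mul_pd, map_smul, smul_eq_mul, ← sub_eq_zero, ← sub_mul] at h1
  rcases mul_eq_zero.mp h1 with h2 | h2
  · exact absurd (by exact_mod_cast sub_eq_zero.mp h2) h
  · exact h2

theorem pd_Q_source (k : ℕ) : pd Var.Q (evalT (powerSum k) * evalTbar (powerSum k)) = 0 := by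
  rw [pd_mul, pd_evalTbar Var.Q (fun _ => nofun), pd_evalT Var.Q (fun _ => nofun)]
  simp

theorem agree_source (d : ℕ) :
    Agree Var.Q (Set.Iic d) (formalSum sourceTerm) (∑ k ∈ Finset.range d, sourceTerm k) := by
  intro m hm
  rw [coeff_formalSum, map_sum]
  refine finsum_eq_sum_of_support_subset _ fun k hk => ?_
  have : m Var.Q = k + 1 := by
    by_contra hne
    exact hk (coeff_X_pow_mul_eq_zero (pd_Q_source k) hne)
  have hm : m Var.Q ≤ d := hm
  simp only [Finset.coe_range, Set.mem_Iio]
  omega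

theorem agree_Z_sum (d : ℕ) :
    Agree Var.Q (Set.Iic d) Z (∑ j ∈ Finset.range (d + 1), Zdeg j) := by
  intro m hm
  rw [agree_Z (m Var.Q) m rfl, map_sum, Finset.sum_eq_single_of_mem (m Var.Q)]
  · exact Finset.mem_range.mpr (Nat.lt_succ_of_le hm)
  · intro j _ hj
    rw [Zdeg, map_sum]
    exact Finset.sum_eq_zero fun p _ => coeff_term_eq_zero p hj.symm

theorem natCast_smul_Zzero (d : ℕ) :
    (d : ℂ) • Zzero d = ∑ k ∈ Finset.range d, sourceTerm k * Zzero (d - (k + 1)) := by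
  rw [Zzero, ← mul_smul_comm, cauchySum_rec, Finset.mul_sum]
  refine Finset.sum_congr rfl fun k hk => ?_
  have hk := Finset.mem_range.mp hk
  rw [sourceTerm, Zzero]
  nth_rewrite 1 [show d = (k + 1) + (d - (k + 1)) by omega]
  rw [pow_add]
  ring

/-- In each degree in Q this is the recursion for the Cauchy sums: only the product of source degree
k + 1 and Z-degree d - (k + 1) survives. -/
theorem agree_X_mul_pd_Z :
    Agree Var.beta {0} (X Var.Q * pd Var.Q Z) (formalSum sourceTerm * Z) := by
  intro m hm
  set d := m Var.Q with hd
  have h1 : coeff m Z = coeff m (Zzero d) := (agree_Z d m hd.symm).trans (agree_Zdeg d m hm)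
  rw [coeff_X_mul_pd, h1, ← hd, ← smul_eq_mul, ← map_smul, natCast_smul_Zzero,
    (agree_source d).mul (isLowerSet_Iic d) (agree_Z_sum d) m (Set.mem_Iic.mpr le_rfl),
    (Agree.refl _).mul isLowerSet_zero (.sum fun j _ => agree_Zdeg j) m hm, Finset.sum_mul,
    map_sum, map_sum]
  refine Finset.sum_congr rfl fun k hk => ?_
  have hk := Finset.mem_range.mp hk
  rw [Finset.mul_sum, map_sum, Finset.sum_eq_single_of_mem (d - (k + 1))
    (Finset.mem_range.mpr (by omega))]
  intro j _ hj
  have e : sourceTerm k * Zzero j = X Var.Q ^ (k + 1 + j) *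
      (evalT (powerSum k) * evalTbar (powerSum k) * cauchySum evalT evalTbar j) := by
    rw [sourceTerm, Zzero, pow_add]; ring
  rw [e]
  refine coeff_X_pow_mul_eq_zero ?_ (by omega)
  rw [pd_mul, pd_Q_source, pd_Q_cauchySum]
  simp

theorem agree_X_mul_pd_logZ :
    Agree Var.beta {0} (X Var.Q * pd Var.Q logZ) (formalSum sourceTerm) := by
  have h := agree_X_mul_pd_Z.mul isLowerSet_zero (.refl Z⁻¹)
  have hZ : Z * Z⁻¹ = 1 := MvPowerSeries.mul_inv_cancel Z (by rw [constantCoeff_Z]; exact one_ne_zero)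
  rwa [← pd_logZ_mul, ← mul_assoc, mul_assoc _ Z, mul_assoc _ Z, hZ, mul_one, mul_one] at h

/-- The initial value `-∑_{k ≥ 1} Q^k k t_k t̄_k`. -/
def initialValue : Series ℂ :=
  -formalSum fun k : ℕ+ =>
    (k : ℂ) • (X Var.Q ^ (k : ℕ) * X (Var.t k) * X (Var.tbar k) : Series ℂ)

theorem evalTbar_powerSum (k : ℕ) :
    evalTbar (powerSum k) = -(((k : ℂ) + 1) • X (Var.tbar k.succPNat)) := by
  rw [powerSum, map_smul, evalTbar, MvPolynomial.aeval_X, smul_neg]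

theorem coeff_initialTerm (k : ℕ+) (m : Var →₀ ℕ) :
    (m Var.Q : ℂ) * coeff m (-((k : ℂ) • (X Var.Q ^ (k : ℕ) * X (Var.t k) * X (Var.tbar k) :
      Series ℂ))) = coeff m (sourceTerm k.natPred) := by
  have hs : sourceTerm k.natPred = (k : ℂ) • (X Var.Q ^ (k : ℕ) *
      -((k : ℂ) • (X (Var.t k) * X (Var.tbar k)))) := by
    have hk : ((k.natPred : ℂ) + 1) = (k : ℂ) := by
      rw [← Nat.cast_one, ← Nat.cast_add, PNat.natPred_add_one]
    rw [sourceTerm, evalT_powerSum, evalTbar_powerSum, PNat.natPred_add_one,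
      PNat.succPNat_natPred, hk]
    simp only [smul_eq_C_mul]
    ring
  have hi : -((k : ℂ) • (X Var.Q ^ (k : ℕ) * X (Var.t k) * X (Var.tbar k) : Series ℂ)) =
      X Var.Q ^ (k : ℕ) * -((k : ℂ) • (X (Var.t k) * X (Var.tbar k))) := by
    simp only [smul_eq_C_mul]
    ring
  rw [hs, hi, map_smul, smul_eq_mul]
  by_cases h : m Var.Q = k
  · rw [h]
  · rw [coeff_X_pow_mul_eq_zero _ h, mul_zero, mul_zero]
    rw [← smul_neg, pd, Derivation.map_smul, map_neg, ← pd, pd_mul,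
      pd_X_of_ne (t_ne_Q k), pd_X_of_ne (show Var.tbar k ≠ Var.Q from nofun)]
    simp

theorem coeff_initialValue (m : Var →₀ ℕ) :
    coeff m initialValue = ∑ᶠ k : ℕ+, coeff m
      (-((k : ℂ) • (X Var.Q ^ (k : ℕ) * X (Var.t k) * X (Var.tbar k) : Series ℂ))) := by
  rw [initialValue, map_neg, coeff_formalSum, ← finsum_neg_distrib]
  simp only [map_neg]

theorem coeff_mul_initialValue (m : Var →₀ ℕ) :
    (m Var.Q : ℂ) * coeff m initialValue = coeff m (formalSum sourceTerm) := by
  rw [coeff_initialValue, ← smul_eq_mul, smul_finsum, coeff_formalSum,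
    ← finsum_comp_equiv Equiv.pnatEquivNat]
  exact finsum_congr fun k => coeff_initialTerm k m

/-- The logarithmic derivative in Q determines all coefficients of positive degree in Q. Those of
degree 0 vanish on both sides, since Z is 1 at Q = 0. -/
theorem agree_logZ_initialValue : Agree Var.beta {0} logZ initialValue := by
  intro m hm
  by_cases h : m Var.Q = 0
  · rw [agree_logZ_Q m h, map_zero, coeff_initialValue]
    refine (finsum_eq_zero_of_forall_eq_zero fun k => ?_).symm
    rw [map_neg, map_smul, mul_assoc, coeff_X_pow_mul_eq_zero, smul_zero, neg_zero]
    · rw [pd_mul, pd_X_of_ne (t_ne_Q k), pd_X_of_ne (show Var.tbar k ≠ Var.Q from nofun)]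
      simp
    · rw [h]; exact k.ne_zero.symm
  · refine mul_left_cancel₀ (Nat.cast_ne_zero.mpr h : (m Var.Q : ℂ) ≠ 0) ?_
    rw [← coeff_X_mul_pd, agree_X_mul_pd_logZ m hm, coeff_mul_initialValue]

end DoubleHurwitz

end

/-! ### The grading by powers of ħ and the genus expansion -/

noncomputable section

namespace DoubleHurwitz

open MvPowerSeries

/-! ### Homogeneous parts -/

/-- The exponent of `ħ` produced by rescaling a variable. -/
def hbarDegree : Var → ℤ
  | Var.beta => 1
  | Var.Q => 0
  | Var.t _ => -1
  | Var.tbar _ => -1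

/-- The exponent of `ħ` produced by rescaling a monomial. -/
def monomialDegree (m : Var →₀ ℕ) : ℤ := m.sum fun v e => (e : ℤ) * hbarDegree v

theorem monomialDegree_add (m m' : Var →₀ ℕ) :
    monomialDegree (m + m') = monomialDegree m + monomialDegree m' :=
  Finsupp.sum_add_index' (by simp) (by intros; push_cast; ring)

theorem monomialDegree_single (v : Var) : monomialDegree (Finsupp.single v 1) = hbarDegree v := by
  rw [monomialDegree, Finsupp.sum_single_index] <;> simp

/-- The part of a series consisting of the monomials with `ħ`-degree `j`. -/
def homPart (j : ℤ) (A : Series ℂ) : Series ℂ :=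
  fun m => if monomialDegree m = j then coeff m A else 0

theorem coeff_homPart (j : ℤ) (A : Series ℂ) (m : Var →₀ ℕ) :
    coeff m (homPart j A) = if monomialDegree m = j then coeff m A else 0 := rfl

theorem homPart_add (j : ℤ) (A B : Series ℂ) : homPart j (A + B) = homPart j A + homPart j B := by
  ext m; simp only [coeff_homPart, map_add]; split_ifs <;> simp

theorem homPart_smul (j : ℤ) (c : ℂ) (A : Series ℂ) : homPart j (c • A) = c • homPart j A := by
  ext m; simp only [coeff_homPart, map_smul]; split_ifs <;> simp

theorem homPart_formalSum (j : ℤ) {ι : Type} (f : ι → Series ℂ) :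
    homPart j (formalSum f) = formalSum fun i => homPart j (f i) := by
  ext m
  simp only [coeff_homPart, coeff_formalSum]
  split_ifs <;> simp

theorem homPart_X_mul (j : ℤ) (v : Var) (A : Series ℂ) :
    homPart j (X v * A) = X v * homPart (j - hbarDegree v) A := by
  ext m
  rw [coeff_homPart]
  by_cases h : m v = 0
  · rw [coeff_X_mul_of_eq_zero _ h, coeff_X_mul_of_eq_zero _ h, ite_self]
  · obtain ⟨m', rfl⟩ := exists_add_single h
    rw [coeff_X_mul_of_ne_zero _ h, coeff_X_mul_of_ne_zero _ h, coeff_homPart,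
      add_tsub_cancel_right, monomialDegree_add, monomialDegree_single]
    simp only [eq_sub_iff_add_eq]

theorem homPart_pd (j : ℤ) (v : Var) (A : Series ℂ) :
    homPart j (pd v A) = pd v (homPart (j + hbarDegree v) A) := by
  ext m
  rw [coeff_homPart, pd, pd, coeff_pderiv, coeff_pderiv, coeff_homPart, monomialDegree_add,
    monomialDegree_single]
  simp only [add_left_inj]
  split_ifs <;> simp

theorem homPart_joinTerm (j : ℤ) (A : Series ℂ) :
    homPart j (joinTerm A) = joinTerm (homPart (j + 1) A) := by
  rw [joinTerm, joinTerm, homPart_smul, homPart_formalSum]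
  congr 2
  funext p
  rw [homPart_smul, mul_assoc, homPart_X_mul, homPart_X_mul, homPart_pd, ← mul_assoc]
  congr 4
  simp only [hbarDegree]; ring

theorem homPart_cutTerm (j : ℤ) (A : Series ℂ) :
    homPart j (cutTerm A) = cutTerm (homPart (j - 1) A) := by
  rw [cutTerm, cutTerm, homPart_smul, homPart_formalSum]
  congr 2
  funext p
  rw [homPart_smul, homPart_X_mul, homPart_pd, homPart_pd]
  congr 5
  simp only [hbarDegree]; ring

/-! ### The genus expansion -/

/-- The `n`-th coefficient of the genus expansion. -/
def genusPart (n : ℕ) : Series ℂ := homPart (2 * (n : ℤ) - 2) logZ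

theorem coeff_homPart_mul_eq_zero {b : ℕ} {A B : Series ℂ} {j : ℤ}
    (h : ∀ i : ℤ, Agree Var.beta (Set.Iic b) (homPart i A) 0 ∨
      Agree Var.beta (Set.Iic b) (homPart (j - i) B) 0) :
    Agree Var.beta (Set.Iic b) (homPart j (A * B)) 0 := by
  classical
  intro m hm
  rw [coeff_homPart]
  split_ifs with hj
  · rw [coeff_mul, map_zero]
    refine Finset.sum_eq_zero fun x hx => ?_
    have hx := Finset.HasAntidiagonal.mem_antidiagonal.mp hx
    have hb : x.1 Var.beta + x.2 Var.beta = m Var.beta := by rw [← Finsupp.add_apply, hx]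
    have hd : monomialDegree x.1 + monomialDegree x.2 = j := by rw [← monomialDegree_add, hx, hj]
    have hm : m Var.beta ≤ b := hm
    rcases h (monomialDegree x.1) with h | h
    · have := h x.1 (Set.mem_Iic.mpr (by omega))
      rw [coeff_homPart, if_pos rfl] at this
      rw [this, map_zero, zero_mul]
    · have := h x.2 (Set.mem_Iic.mpr (by omega))
      rw [coeff_homPart, if_pos (by omega)] at this
      rw [this, map_zero, mul_zero]
  · rw [map_zero]

theorem monomialDegree_initial (k : ℕ+) :
    ∀ j : ℤ, j ≠ -2 → homPart j ((X Var.Q ^ (k : ℕ) * X (Var.t k) * X (Var.tbar k) :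
      Series ℂ)) = 0 := by
  intro j hj
  have h1 : ∀ (i : ℤ), homPart i (X (Var.tbar k) : Series ℂ) = if i = -1 then X (Var.tbar k) else 0 := by
    classical
    intro i
    ext m
    rw [coeff_homPart, coeff_X]
    by_cases hm : m = Finsupp.single (Var.tbar k) 1
    · subst hm
      rw [monomialDegree_single]
      simp only [hbarDegree, eq_comm (a := (-1 : ℤ))]
      split_ifs <;> simp
    · split_ifs <;> simp [coeff_X, hm]
  have h2 : ∀ (n : ℕ) (i : ℤ) (A : Series ℂ), homPart i (X Var.Q ^ n * A) = X Var.Q ^ n * homPart i A := by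
    intro n
    induction n with
    | zero => intros; simp
    | succ n ih =>
      intro i A
      rw [pow_succ', mul_assoc, homPart_X_mul, ih, mul_assoc]
      simp only [hbarDegree, sub_zero]
  rw [mul_assoc, h2, homPart_X_mul, h1, if_neg, mul_zero, mul_zero]
  simp only [hbarDegree]
  omega

theorem homPart_initialValue {j : ℤ} (hj : j ≠ -2) : homPart j initialValue = 0 := by
  have : initialValue = (-1 : ℂ) • formalSum fun k : ℕ+ =>
    (k : ℂ) • (X Var.Q ^ (k : ℕ) * X (Var.t k) * X (Var.tbar k) : Series ℂ) := by
    rw [initialValue, neg_one_smul]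
  rw [this, homPart_smul, homPart_formalSum]
  simp only [homPart_smul, monomialDegree_initial _ j hj, smul_zero, formalSum_zero]

theorem Agree.homPart {v : Var} {T : Set ℕ} {A B : Series ℂ} (h : Agree v T A B) (j : ℤ) :
    Agree v T (DoubleHurwitz.homPart j A) (DoubleHurwitz.homPart j B) := fun m hm => by
  rw [coeff_homPart, coeff_homPart, h m hm]

theorem pd_zero (v : Var) : pd v 0 = 0 := by rw [pd, map_zero]

theorem homPart_squareTerm (j : ℤ) (A : Series ℂ) :
    homPart j (squareTerm A) = (1 / 2 : ℂ) • formalSum fun p : ℕ+ × ℕ+ =>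
      ((p.1 : ℂ) + (p.2 : ℂ)) • (X (Var.t (p.1 + p.2)) *
        homPart (j + 1) (pd (Var.t p.1) A * pd (Var.t p.2) A)) := by
  rw [squareTerm, homPart_smul, homPart_formalSum]
  congr 2
  funext p
  rw [homPart_smul, homPart_X_mul]
  rfl

/-- At β = 0 only degree -2 occurs. The evolution equation for the part of degree j involves the
parts j and j - 2 linearly and products of parts whose degrees add up to j - 2. If j is not of the
form 2n - 2, then neither is j - 2, and no product has two admissible factors. So vanishing passes
from one degree in β to the next. -/
theorem agree_homPart_logZ (b : ℕ) : ∀ j : ℤ, (∀ n : ℕ, j ≠ 2 * (n : ℤ) - 2) →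
    Agree Var.beta (Set.Iic b) (homPart j logZ) 0 := by
  have h0 : ∀ j : ℤ, (∀ n : ℕ, j ≠ 2 * (n : ℤ) - 2) →
      Agree Var.beta {0} (homPart j logZ) 0 := by
    intro j hj
    have := agree_logZ_initialValue.homPart j
    rwa [homPart_initialValue (by simpa using hj 0)] at this
  induction b with
  | zero =>
    intro j hj m hm
    exact h0 j hj m (Nat.le_zero.mp hm)
  | succ b ih =>
    intro j hj m hm
    by_cases hm0 : m Var.beta = 0
    · exact h0 j hj m hm0
    · obtain ⟨m', rfl⟩ := exists_add_single hm0
      have hm' : m' Var.beta ∈ Set.Iic b := by simpa using hm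
      have h1 : pd Var.beta (homPart j logZ) =
          joinTerm (homPart j logZ) + cutTerm (homPart (j - 2) logZ) +
            homPart (j - 1) (squareTerm logZ) := by
        have := homPart_pd (j - 1) Var.beta logZ
        rw [show j - 1 + hbarDegree Var.beta = j by simp [hbarDegree]] at this
        rw [← this, pd_beta_logZ, homPart_add, homPart_add, homPart_joinTerm, homPart_cutTerm,
          sub_add_cancel, sub_sub]
        norm_num
      have hsq : Agree Var.beta (Set.Iic b) (homPart (j - 1) (squareTerm logZ)) 0 := by
        rw [homPart_squareTerm]
        have h : ∀ p : ℕ+ × ℕ+, Agree Var.beta (Set.Iic b)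
            (((p.1 : ℂ) + (p.2 : ℂ)) • (X (Var.t (p.1 + p.2)) *
              homPart (j - 1 + 1) (pd (Var.t p.1) logZ * pd (Var.t p.2) logZ))) 0 := by
          intro p
          have h2 : Agree Var.beta (Set.Iic b)
              (homPart (j - 1 + 1) (pd (Var.t p.1) logZ * pd (Var.t p.2) logZ)) 0 := by
            refine coeff_homPart_mul_eq_zero fun i => ?_
            rw [homPart_pd, homPart_pd]
            -- Admissible factors with indices n and n' would make j = 2(n + n') - 2 admissible.
            by_cases hi : ∃ n : ℕ, i + hbarDegree (Var.t p.1) = 2 * (n : ℤ) - 2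
            · obtain ⟨n, hn⟩ := hi
              have := (ih (j - 1 + 1 - i + hbarDegree (Var.t p.2)) fun n' hn' => hj (n + n') (by
                simp only [hbarDegree] at hn hn' ⊢
                push_cast
                omega)).pd (t_ne_beta p.2)
              rw [pd_zero] at this
              exact .inr this
            · have := (ih _ (not_exists.mp hi)).pd (t_ne_beta p.1)
              rw [pd_zero] at this
              exact .inl this
          have h3 := (h2.X_mul (t_ne_beta (p.1 + p.2))).smul ((p.1 : ℂ) + (p.2 : ℂ))
          rwa [mul_zero, smul_zero] at h3
        have h4 := (Agree.formalSum h).smul (1 / 2 : ℂ)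
        rwa [formalSum_zero, smul_zero] at h4
      have h5 := (((ih j hj).joinTerm t_ne_beta).add ((ih (j - 2) fun n hn => hj (n + 1) (by
        push_cast; omega)).cutTerm t_ne_beta)).add hsq
      rw [joinTerm_zero, cutTerm_zero, add_zero, add_zero, ← h1] at h5
      have h6 := h5 m' hm'
      rw [coeff_pd_beta, map_zero] at h6
      rw [map_zero]
      exact (mul_eq_zero.mp h6).resolve_right (Nat.cast_add_one_ne_zero _)

theorem homPart_logZ {j : ℤ} (hj : ∀ n : ℕ, j ≠ 2 * (n : ℤ) - 2) : homPart j logZ = 0 := by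
  ext m
  exact agree_homPart_logZ (m Var.beta) j hj m (Set.mem_Iic.mpr le_rfl)

theorem pd_t_genusPart (k : ℕ+) (n : ℕ) :
    pd (Var.t k) (genusPart n) = homPart (2 * (n : ℤ) - 1) (pd (Var.t k) logZ) := by
  rw [homPart_pd, genusPart]
  congr 2
  simp only [hbarDegree]; ring

theorem coeff_pd_t_logZ (k : ℕ+) {m : Var →₀ ℕ} (hm : ∀ n : ℕ, monomialDegree m ≠ 2 * (n : ℤ) - 1) :
    coeff m (pd (Var.t k) logZ) = 0 := by
  have h := congrArg (coeff m) (homPart_pd (monomialDegree m) (Var.t k) logZ)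
  rw [homPart_logZ, pd_zero, coeff_homPart, if_pos rfl, map_zero] at h
  · exact h
  · intro n hn
    refine hm n ?_
    simp only [hbarDegree] at hn
    omega

/-- The derivatives ∂/∂t of log Z live in degrees 2a - 1 with a ≥ 0, so degree 2n - 2 of the product
arises exactly from the pairs a and n - a with 0 ≤ a ≤ n. -/
theorem homPart_pd_mul_pd (n : ℕ) (k l : ℕ+) :
    homPart (2 * (n : ℤ) - 2) (pd (Var.t k) logZ * pd (Var.t l) logZ) =
      ∑ a ∈ Finset.range (n + 1), pd (Var.t k) (genusPart a) * pd (Var.t l) (genusPart (n - a)) := by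
  classical
  ext m
  simp only [pd_t_genusPart, map_sum, coeff_homPart, coeff_mul]
  rw [Finset.sum_comm]
  have key : ∀ x ∈ Finset.HasAntidiagonal.antidiagonal m,
      ∑ a ∈ Finset.range (n + 1),
        (if monomialDegree x.1 = 2 * (a : ℤ) - 1 then coeff x.1 (pd (Var.t k) logZ) else 0) *
        (if monomialDegree x.2 = 2 * ((n - a : ℕ) : ℤ) - 1 then coeff x.2 (pd (Var.t l) logZ)
          else 0) =
      if monomialDegree m = 2 * (n : ℤ) - 2 then
        coeff x.1 (pd (Var.t k) logZ) * coeff x.2 (pd (Var.t l) logZ) else 0 := by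
    intro x hx
    have hd : monomialDegree x.1 + monomialDegree x.2 = monomialDegree m := by
      rw [← monomialDegree_add, Finset.HasAntidiagonal.mem_antidiagonal.mp hx]
    by_cases h : ∃ a ∈ Finset.range (n + 1), monomialDegree x.1 = 2 * (a : ℤ) - 1
    · obtain ⟨a, ha, ha1⟩ := h
      have ha' := Finset.mem_range.mp ha
      rw [Finset.sum_eq_single_of_mem a ha, if_pos ha1]
      · by_cases h2 : monomialDegree m = 2 * (n : ℤ) - 2
        · rw [if_pos h2, if_pos (by omega)]
        · rw [if_neg h2, if_neg (by omega), mul_zero]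
      · intro a' _ hne
        rw [if_neg (by omega), zero_mul]
    · push Not at h
      rw [Finset.sum_eq_zero fun a ha => by rw [if_neg (h a ha), zero_mul]]
      split_ifs with h2
      · by_cases h3 : ∃ a : ℕ, monomialDegree x.1 = 2 * (a : ℤ) - 1
        · obtain ⟨a, ha⟩ := h3
          have ha' : n < a := by
            by_contra hlt
            exact h a (Finset.mem_range.mpr (by omega)) ha
          rw [coeff_pd_t_logZ l (fun n' => by omega), mul_zero]
        · rw [coeff_pd_t_logZ k (not_exists.mp h3), zero_mul]
      · rfl
  rw [Finset.sum_congr rfl key]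
  split_ifs <;> simp

theorem cutJoinEq_genusPart (n : ℕ) : CutJoinEq genusPart n := by
  have h := homPart_pd (2 * (n : ℤ) - 3) Var.beta logZ
  rw [show 2 * (n : ℤ) - 3 + hbarDegree Var.beta = 2 * n - 2 by simp only [hbarDegree]; ring] at h
  rw [CutJoinEq, genusPart, ← h, pd_beta_logZ, homPart_add, homPart_add, homPart_joinTerm,
    homPart_cutTerm, homPart_squareTerm, quadTerm]
  rw [show 2 * (n : ℤ) - 3 + 1 = 2 * n - 2 by ring]
  simp only [homPart_pd_mul_pd]
  congr 2
  cases n with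
  | zero =>
    -- The cut term would need the part of degree -4, which vanishes; this is F_{-1} = 0.
    rw [if_pos rfl, homPart_logZ, cutTerm_zero]
    intro n; push_cast; omega
  | succ n =>
    rw [if_neg (Nat.succ_ne_zero n), Nat.add_sub_cancel, genusPart]
    congr 2
    push_cast; ring

theorem initialCond_genusPart (n : ℕ) : InitialCond genusPart n := by
  have h := agree_logZ_initialValue.homPart (2 * (n : ℤ) - 2)
  have h2 : homPart (2 * (n : ℤ) - 2) initialValue = if n = 0 then initialValue else 0 := by
    split_ifs with hn
    · ext m
      rw [coeff_homPart]
      split_ifs with hm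
      · rfl
      · have := congrArg (coeff m) (homPart_initialValue (j := monomialDegree m)
          (by subst hn; simpa using hm))
        rw [coeff_homPart, if_pos rfl, map_zero] at this
        exact this.symm
    · exact homPart_initialValue (by omega)
  rw [h2] at h
  rw [InitialCond, ← initialValue]
  ext m
  change (if m Var.beta = 0 then _ else _) = _
  split_ifs with hm hn hn
  · have := h m hm
    rw [if_pos hn] at this
    exact this
  · have := h m hm
    rw [if_neg hn] at this
    exact this
  · rw [coeff_initialValue]
    refine (finsum_eq_zero_of_forall_eq_zero fun k => ?_).symm
    have h3 : (pd Var.beta (X Var.Q ^ (k : ℕ) * X (Var.t k) * X (Var.tbar k) : Series ℂ)) = 0 := by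
      rw [pd_mul, pd_mul, pd_pow_eq_zero (pd_X_of_ne (show Var.Q ≠ Var.beta from nofun)),
        pd_X_of_ne (t_ne_beta k), pd_X_of_ne (show Var.tbar k ≠ Var.beta from nofun)]
      simp
    rw [map_neg, map_smul, coeff_eq_zero_of_X_mul_pd hm, smul_zero, neg_zero]
    rw [h3, mul_zero, map_zero]
  · rfl

/-! ### Rescaling -/

/-- The rescaling of a series by powers of `ħ`. -/
def rescaleHbar : Series ℂ →+* Series (LaurentSeries ℂ) :=
  (MvPowerSeries.rescale hbarFactor).comp (MvPowerSeries.map HahnSeries.C)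

theorem hbarFactor_eq (v : Var) : hbarFactor v = HahnSeries.single (hbarDegree v) 1 := by
  have h : hbar⁻¹ = HahnSeries.single (-1) 1 := by
    rw [hbar]
    refine inv_eq_of_mul_eq_one_right ?_
    rw [HahnSeries.single_mul_single]
    simp
  cases v
  · rfl
  · rfl
  · exact h
  · exact h

theorem prod_hbarFactor (m : Var →₀ ℕ) :
    (m.prod fun v e => hbarFactor v ^ e) = HahnSeries.single (monomialDegree m) 1 := by
  induction m using Finsupp.induction_linear with
  | zero => rfl
  | add m m' h h' =>
    rw [Finsupp.prod_add_index' (by simp) (by intros; rw [pow_add]), h, h', monomialDegree_add,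
      HahnSeries.single_mul_single, one_mul]
  | single v e =>
    rw [Finsupp.prod_single_index (by simp), monomialDegree, Finsupp.sum_single_index (by simp),
      hbarFactor_eq, HahnSeries.single_pow, one_pow, nsmul_eq_mul]

theorem coeff_rescaleHbar (A : Series ℂ) (m : Var →₀ ℕ) :
    coeff m (rescaleHbar A) = HahnSeries.single (monomialDegree m) (coeff m A) := by
  rw [rescaleHbar, RingHom.comp_apply, coeff_rescale, prod_hbarFactor, coeff_map,
    HahnSeries.C_apply, HahnSeries.single_mul_single, add_zero, one_mul]

theorem pderiv_rescaleHbar (v : Var) (A : Series ℂ) :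
    pderiv _ v (rescaleHbar A) = hbarFactor v • rescaleHbar (pd v A) := by
  ext1 m
  have h : ((m v : LaurentSeries ℂ) + 1) = HahnSeries.single 0 ((m v : ℂ) + 1) := by
    rw [← HahnSeries.C_apply, map_add, map_natCast, map_one]
  rw [coeff_pderiv, map_smul, coeff_rescaleHbar, coeff_rescaleHbar, pd, coeff_pderiv, smul_eq_mul,
    hbarFactor_eq, HahnSeries.single_mul_single, h, HahnSeries.single_mul_single,
    monomialDegree_add, monomialDegree_single, one_mul, add_zero, add_comm]

/-- Absence of torsion is what lets a power series be recovered from its partial derivatives and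
constant term, as in `formalLog_Zhbar`. -/
instance : IsAddTorsionFree (LaurentSeries ℂ) :=
  ⟨fun n hn f g h => by
    have h1 : (n : LaurentSeries ℂ) ≠ 0 := by
      rw [← map_natCast (HahnSeries.C : ℂ →+* LaurentSeries ℂ)]
      exact HahnSeries.C_ne_zero (Nat.cast_ne_zero.mpr hn)
    simp only [nsmul_eq_mul] at h
    exact mul_left_cancel₀ h1 h⟩

/-- Both series have constant term 0, and their partial derivatives become equal after
multiplication by the rescaled Z, because rescaling commutes with derivatives up to a power of ħ. -/
theorem formalLog_Zhbar : formalLog Zhbar = rescaleHbar logZ := by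
  have hc : ∀ A, constantCoeff (rescaleHbar A) = HahnSeries.C (constantCoeff A) := by
    intro A
    rw [← coeff_zero_eq_constantCoeff_apply, coeff_rescaleHbar]
    rfl
  have hZ : constantCoeff Zhbar = 1 := by
    change constantCoeff (rescaleHbar Z) = 1
    rw [hc, constantCoeff_Z, map_one]
  have hne : Zhbar ≠ 0 := fun h => by
    rw [h, map_zero] at hZ
    exact zero_ne_one hZ
  refine pderiv.ext (fun v => mul_right_cancel₀ hne ?_) ?_
  · rw [pderiv_formalLog_mul hZ, pderiv_rescaleHbar, smul_mul_assoc]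
    change pderiv _ v (rescaleHbar Z) = _ • (_ * rescaleHbar Z)
    rw [← map_mul, pd_logZ_mul, pderiv_rescaleHbar]
  · rw [constantCoeff_formalLog hZ, hc, logZ, constantCoeff_formalLog constantCoeff_Z, map_zero]

theorem hasGenusExpansion : HasGenusExpansion (formalLog Zhbar) genusPart := by
  intro m
  rw [formalLog_Zhbar, coeff_rescaleHbar]
  refine ⟨fun n => ?_, fun j hj => ?_⟩
  · rw [HahnSeries.coeff_single, genusPart, coeff_homPart]
    simp only [eq_comm]
  · rw [HahnSeries.coeff_single]
    split_ifs with h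
    · have := congrArg (coeff m) (homPart_logZ hj)
      rwa [coeff_homPart, if_pos h.symm] at this
    · rfl

end DoubleHurwitz

end

/-! ### Majorant series: substitution, chain rule and comparison -/

noncomputable section

namespace DoubleHurwitz

open MvPowerSeries

/-! ### Power series with coefficients in `[0, ∞]` -/

/-- Formal power series with coefficients in `[0, ∞]`, ordered coefficientwise. -/
abbrev Maj (τ : Type) : Type := MvPowerSeries τ ENNReal

variable {σ τ υ ι κ : Type}

instance : PartialOrder (Maj τ) := inferInstanceAs (PartialOrder ((τ →₀ ℕ) → ENNReal))

theorem Maj.le_def {A B : Maj τ} : A ≤ B ↔ ∀ m, coeff m A ≤ coeff m B := Iff.rfl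

instance : IsOrderedAddMonoid (Maj τ) where
  add_le_add_left A B h C := Maj.le_def.mpr fun m => by
    rw [map_add, map_add]; exact add_le_add (h m) le_rfl

instance : MulLeftMono (Maj τ) := ⟨fun A B C h => Maj.le_def.mpr fun m => by
  classical
  simp only [coeff_mul]
  exact Finset.sum_le_sum fun x _ => mul_le_mul' le_rfl (h x.2)⟩

instance : MulRightMono (Maj τ) := ⟨fun A B C h => Maj.le_def.mpr fun m => by
  classical
  simp only [Function.swap, coeff_mul]
  exact Finset.sum_le_sum fun x _ => mul_le_mul' (h x.1) le_rfl⟩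

instance : CanonicallyOrderedAdd (Maj τ) where
  exists_add_of_le {A B} h := ⟨(fun m => coeff m B - coeff m A : (τ →₀ ℕ) → ENNReal), by
    ext m
    exact (add_tsub_cancel_of_le (h m)).symm⟩
  le_add_self A B := Maj.le_def.mpr fun m => by rw [map_add]; exact le_add_self
  le_self_add A B := Maj.le_def.mpr fun m => by rw [map_add]; exact le_self_add

theorem Maj.C_le_C {a b : ENNReal} (h : a ≤ b) : (C a : Maj τ) ≤ C b := fun m => by
  classical
  change coeff m (C a) ≤ coeff m (C b)
  rw [coeff_C, coeff_C]
  split_ifs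
  · exact h
  · exact le_rfl

/-- The coefficientwise sum of a family. -/
def esum (f : ι → Maj τ) : Maj τ := fun m => ∑' i, coeff m (f i)

theorem coeff_esum (f : ι → Maj τ) (m : τ →₀ ℕ) : coeff m (esum f) = ∑' i, coeff m (f i) := rfl

theorem esum_le_esum {f g : ι → Maj τ} (h : ∀ i, f i ≤ g i) : esum f ≤ esum g :=
  fun m => ENNReal.tsum_le_tsum fun i => h i m

theorem mul_esum (A : Maj τ) (f : ι → Maj τ) : A * esum f = esum fun i => A * f i := by
  classical
  ext m
  simp only [coeff_mul, coeff_esum, ← ENNReal.tsum_mul_left]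
  exact (Summable.tsum_finsetSum fun _ _ => ENNReal.summable).symm

theorem esum_mul (A : Maj τ) (f : ι → Maj τ) : esum f * A = esum fun i => f i * A := by
  simp only [mul_comm _ A, mul_esum]

theorem esum_add (f g : ι → Maj τ) : esum (fun i => f i + g i) = esum f + esum g := by
  ext m
  simp only [map_add, coeff_esum, ENNReal.tsum_add]

theorem esum_comm (f : ι → κ → Maj τ) :
    esum (fun i => esum fun k => f i k) = esum fun k => esum fun i => f i k := by
  ext m
  simp only [coeff_esum]
  exact ENNReal.tsum_comm

theorem esum_prod (f : ι × κ → Maj τ) : esum f = esum fun i => esum fun k => f (i, k) := by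
  ext m
  simp only [coeff_esum]
  exact ENNReal.tsum_prod'

theorem esum_eq_single {f : ι → Maj τ} (i : ι) (h : ∀ j, j ≠ i → f j = 0) : esum f = f i := by
  ext m
  rw [coeff_esum, tsum_eq_single i]
  intro j hj
  rw [h j hj, map_zero]

theorem esum_zero : esum (fun _ : ι => (0 : Maj τ)) = 0 := by
  ext m; simp [coeff_esum]

theorem esum_comp_of_injective {f : ι → Maj τ} {g : κ → ι} (hg : Function.Injective g)
    (h : ∀ i, i ∉ Set.range g → f i = 0) : esum f = esum fun k => f (g k) := by
  ext m
  rw [coeff_esum, coeff_esum]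
  refine (hg.tsum_eq (f := fun i => coeff m (f i)) fun i hi => ?_).symm
  by_contra hn
  exact hi (by simp [h i hn])

theorem pderiv_esum (v : τ) (f : ι → Maj τ) :
    pderiv ENNReal v (esum f) = esum fun i => pderiv ENNReal v (f i) := by
  ext m
  simp only [coeff_pderiv, coeff_esum, ENNReal.tsum_mul_right]

theorem pderiv_le_pderiv (v : τ) {A B : Maj τ} (h : A ≤ B) :
    pderiv ENNReal v A ≤ pderiv ENNReal v B := Maj.le_def.mpr fun m => by
  rw [coeff_pderiv, coeff_pderiv]
  exact mul_le_mul' (h _) le_rfl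

theorem pderiv_mul' {R : Type} [CommSemiring R] (v : τ) (A B : MvPowerSeries τ R) :
    pderiv R v (A * B) = pderiv R v A * B + A * pderiv R v B := by
  rw [Derivation.leibniz, smul_eq_mul, smul_eq_mul, add_comm, mul_comm B]

theorem pderiv_pderiv_comm {R : Type} [CommSemiring R] (v w : τ) (A : MvPowerSeries τ R) :
    pderiv R v (pderiv R w A) = pderiv R w (pderiv R v A) := by
  classical
  ext m
  simp only [coeff_pderiv, Finsupp.add_apply, Finsupp.single_apply]
  by_cases h : v = w
  · rw [h]
  · rw [if_neg h, if_neg (Ne.symm h), add_right_comm, add_zero, add_zero, mul_right_comm]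

/-! ### Substitution -/

/-- The value of a monomial. -/
def monomialSubst (w : σ → Maj τ) (m : σ →₀ ℕ) : Maj τ := m.prod fun v e => w v ^ e

theorem monomialSubst_zero (w : σ → Maj τ) : monomialSubst w 0 = 1 := Finsupp.prod_zero_index

theorem monomialSubst_add (w : σ → Maj τ) (m m' : σ →₀ ℕ) :
    monomialSubst w (m + m') = monomialSubst w m * monomialSubst w m' :=
  Finsupp.prod_add_index' (fun _ => pow_zero _) fun _ _ _ => pow_add _ _ _

theorem monomialSubst_single (w : σ → Maj τ) (v : σ) (e : ℕ) :
    monomialSubst w (Finsupp.single v e) = w v ^ e :=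
  Finsupp.prod_single_index (pow_zero _)

/-- Substitution of arbitrary series for the variables. -/
def subst (w : σ → Maj τ) : Maj σ →+* Maj τ where
  toFun A := esum fun m => C (coeff m A) * monomialSubst w m
  map_zero' := by simp [esum_zero]
  map_one' := by
    classical
    rw [esum_eq_single 0, monomialSubst_zero]
    · simp
    · intro m hm; simp [coeff_one, hm]
  map_add' A B := by simp only [map_add, add_mul, esum_add]
  map_mul' A B := by
    classical
    have h : ∀ p : (σ →₀ ℕ) × (σ →₀ ℕ), C (coeff p.1 A) * monomialSubst w p.1 *
        (C (coeff p.2 B) * monomialSubst w p.2) =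
        C (coeff p.1 A * coeff p.2 B) * monomialSubst w (p.1 + p.2) := by
      intro p
      rw [monomialSubst_add, map_mul]; ring
    rw [esum_mul]
    simp only [mul_esum]
    rw [← esum_prod (fun p : (σ →₀ ℕ) × (σ →₀ ℕ) => C (coeff p.1 A) * monomialSubst w p.1 *
        (C (coeff p.2 B) * monomialSubst w p.2))]
    simp only [h]
    ext e
    rw [coeff_esum, coeff_esum, ← Finset.HasAntidiagonal.sigmaAntidiagonalEquivProd.tsum_eq, ENNReal.tsum_sigma']
    refine tsum_congr fun m => ?_
    rw [tsum_fintype, coeff_C_mul, coeff_mul, Finset.sum_mul, ← Finset.sum_coe_sort]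
    refine Finset.sum_congr rfl fun x _ => ?_
    have hx := Finset.HasAntidiagonal.mem_antidiagonal.mp x.2
    rw [coeff_C_mul]
    simp only [Finset.HasAntidiagonal.sigmaAntidiagonalEquivProd_apply, hx]

theorem subst_apply (w : σ → Maj τ) (A : Maj σ) :
    subst w A = esum fun m => C (coeff m A) * monomialSubst w m := rfl

theorem subst_C (w : σ → Maj τ) (a : ENNReal) : subst w (C a) = C a := by
  classical
  rw [subst_apply, esum_eq_single 0, monomialSubst_zero]
  · simp
  · intro m hm; simp [coeff_C, hm]

theorem subst_X (w : σ → Maj τ) (v : σ) : subst w (X v) = w v := by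
  classical
  rw [subst_apply, esum_eq_single (Finsupp.single v 1), monomialSubst_single]
  · simp
  · intro m hm; simp [coeff_X, hm]

theorem subst_mono (w : σ → Maj τ) {A B : Maj σ} (h : A ≤ B) : subst w A ≤ subst w B :=
  esum_le_esum fun m => mul_le_mul' (Maj.C_le_C (h m)) le_rfl

theorem C_tsum (f : ι → ENNReal) : (C (∑' i, f i) : Maj τ) = esum fun i => C (f i) := by
  classical
  ext m
  simp only [coeff_esum, coeff_C]
  split_ifs
  · rfl
  · simp

theorem subst_esum (w : σ → Maj τ) (f : ι → Maj σ) :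
    subst w (esum f) = esum fun i => subst w (f i) := by
  simp only [subst_apply, coeff_esum, C_tsum, esum_mul]
  exact esum_comm _

theorem map_monomialSubst (φ : Maj τ →+* Maj υ) (w : σ → Maj τ) (m : σ →₀ ℕ) :
    φ (monomialSubst w m) = monomialSubst (fun v => φ (w v)) m := by
  simp only [monomialSubst, Finsupp.prod, map_prod, map_pow]

theorem subst_subst (w : σ → Maj τ) (w' : τ → Maj υ) (A : Maj σ) :
    subst w' (subst w A) = subst (fun v => subst w' (w v)) A := by
  rw [subst_apply w, subst_esum, subst_apply]
  simp only [map_mul, subst_C, map_monomialSubst]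

theorem monomialSubst_X (m : σ →₀ ℕ) : monomialSubst (fun v => (X v : Maj σ)) m = monomial m 1 := by
  induction m using Finsupp.induction_linear with
  | zero => rw [monomialSubst_zero, monomial_zero_one]
  | add m m' h h' => rw [monomialSubst_add, h, h', monomial_mul_monomial, one_mul]
  | single v e => rw [monomialSubst_single, X_pow_eq]

theorem subst_X_self (A : Maj σ) : subst (fun v => (X v : Maj σ)) A = A := by
  classical
  ext m
  rw [subst_apply, coeff_esum, tsum_eq_single m]
  · rw [monomialSubst_X, coeff_C_mul, coeff_monomial_same, mul_one]
  · intro m' hm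
    rw [monomialSubst_X, coeff_C_mul, coeff_monomial_ne hm.symm, mul_zero]

/-- The chain rule. -/
theorem pderiv_subst_maj (w : σ → Maj τ) (i : τ) (A : Maj σ) :
    pderiv ENNReal i (subst w A) =
      esum fun v => pderiv ENNReal i (w v) * subst w (pderiv ENNReal v A) := by
  classical
  have hmul : ∀ A B : Maj σ,
      pderiv ENNReal i (subst w A) =
        (esum fun v => pderiv ENNReal i (w v) * subst w (pderiv ENNReal v A)) →
      pderiv ENNReal i (subst w B) =
        (esum fun v => pderiv ENNReal i (w v) * subst w (pderiv ENNReal v B)) →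
      pderiv ENNReal i (subst w (A * B)) =
        esum fun v => pderiv ENNReal i (w v) * subst w (pderiv ENNReal v (A * B)) := by
    intro A B hA hB
    rw [map_mul, pderiv_mul', hA, hB, esum_mul, mul_esum, ← esum_add]
    congr 1
    funext v
    rw [pderiv_mul', map_add, map_mul, map_mul]
    ring
  have hC : ∀ a : ENNReal, pderiv ENNReal i (subst w (C a)) =
      esum fun v => pderiv ENNReal i (w v) * subst w (pderiv ENNReal v (C a)) := by
    intro a
    simp [subst_C, esum_zero]
  have hX : ∀ u, pderiv ENNReal i (subst w (X u)) =
      esum fun v => pderiv ENNReal i (w v) * subst w (pderiv ENNReal v (X u)) := by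
    intro u
    rw [subst_X, esum_eq_single u]
    · rw [pderiv_X_self, map_one, mul_one]
    · intro v hv
      rw [pderiv_X_of_ne hv.symm, map_zero, mul_zero]
  have hone : pderiv ENNReal i (subst w 1) =
      esum fun v => pderiv ENNReal i (w v) * subst w (pderiv ENNReal v 1) := by
    simpa using hC 1
  have hmon : ∀ m : σ →₀ ℕ, pderiv ENNReal i (subst w (monomialSubst (fun v => X v) m)) =
      esum fun v => pderiv ENNReal i (w v) *
        subst w (pderiv ENNReal v (monomialSubst (fun v => X v) m)) := by
    intro m
    induction m using Finsupp.induction_linear with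
    | zero => rw [monomialSubst_zero]; exact hone
    | add m m' h h' => rw [monomialSubst_add]; exact hmul _ _ h h'
    | single v e =>
      rw [monomialSubst_single]
      induction e with
      | zero => rw [pow_zero]; exact hone
      | succ e ih => rw [pow_succ]; exact hmul _ _ ih (hX v)
  -- The rule holds for monomials by the Leibniz rule. Writing A as the sum of its monomials extends
  -- it to all series, since sums in [0, ∞] may be interchanged freely.
  conv_lhs => rw [← subst_X_self A, subst_apply (fun v => X v), subst_esum, pderiv_esum]
  conv_rhs => rw [← subst_X_self A, subst_apply (fun v => X v)]
  simp only [pderiv_esum, subst_esum, mul_esum]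
  rw [esum_comm]
  congr 1
  funext m
  exact hmul _ _ (hC _) (hmon m)

/-! ### Comparison in bounded degree -/

/-- The coefficients of the monomials of degree at most `r` in `i` are bounded by those of the
second series. -/
def LeUpTo (i : τ) (r : ℕ) (A B : Maj τ) : Prop := ∀ m : τ →₀ ℕ, m i ≤ r → coeff m A ≤ coeff m B

namespace LeUpTo

variable {i : τ} {r : ℕ} {A A' B B' : Maj τ}

theorem of_le (h : A ≤ B) : LeUpTo i r A B := fun m _ => h m

theorem refl (A : Maj τ) : LeUpTo i r A A := of_le le_rfl

theorem trans (h : LeUpTo i r A B) (h' : LeUpTo i r B B') : LeUpTo i r A B' :=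
  fun m hm => (h m hm).trans (h' m hm)

theorem add (h : LeUpTo i r A B) (h' : LeUpTo i r A' B') : LeUpTo i r (A + A') (B + B') :=
  fun m hm => by rw [map_add, map_add]; exact add_le_add (h m hm) (h' m hm)

theorem mul (h : LeUpTo i r A B) (h' : LeUpTo i r A' B') : LeUpTo i r (A * A') (B * B') := by
  classical
  intro m hm
  rw [coeff_mul, coeff_mul]
  refine Finset.sum_le_sum fun x hx => ?_
  have hx' : x.1 i + x.2 i = m i := by
    rw [← Finsupp.add_apply, Finset.HasAntidiagonal.mem_antidiagonal.mp hx]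
  exact mul_le_mul' (h _ (by omega)) (h' _ (by omega))

theorem esum {f g : ι → Maj τ} (h : ∀ j, LeUpTo i r (f j) (g j)) :
    LeUpTo i r (DoubleHurwitz.esum f) (DoubleHurwitz.esum g) :=
  fun m hm => ENNReal.tsum_le_tsum fun j => h j m hm

theorem pderiv {j : τ} (hj : j ≠ i) (h : LeUpTo i r A B) :
    LeUpTo i r (MvPowerSeries.pderiv ENNReal j A) (MvPowerSeries.pderiv ENNReal j B) := by
  classical
  intro m hm
  rw [coeff_pderiv, coeff_pderiv]
  refine mul_le_mul' (h _ ?_) le_rfl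
  simpa [Finsupp.single_apply, hj] using hm

end LeUpTo

/-- A comparison principle for evolution equations. -/
theorem le_of_pderiv_le {i : τ} {p P : ι → Maj τ}
    (h0 : ∀ j (m : τ →₀ ℕ), m i = 0 → coeff m (p j) ≤ coeff m (P j))
    (step : ∀ r, (∀ j, LeUpTo i r (p j) (P j)) → ∀ j,
      LeUpTo i r (2 * pderiv ENNReal i (p j)) (2 * pderiv ENNReal i (P j))) (j : ι) :
    p j ≤ P j := by
  have key : ∀ r j, LeUpTo i r (p j) (P j) := by
    intro r
    induction r with
    | zero => exact fun j m hm => h0 j m (Nat.le_zero.mp hm)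
    | succ r ih =>
      intro j m hm
      by_cases hm0 : m i = 0
      · exact h0 j m hm0
      · obtain ⟨m', rfl⟩ := exists_add_single hm0
        have h := step r ih j m' (by simpa using hm)
        have h2 : ∀ A : Maj τ, coeff m' (2 * pderiv ENNReal i A) =
            coeff (m' + Finsupp.single i 1) A * (2 * ((m' i : ENNReal) + 1)) := by
          intro A
          rw [two_mul, map_add, coeff_pderiv]
          ring
        rw [h2, h2] at h
        -- As a natural number the factor is visibly finite and nonzero, so it can be cancelled in
        -- [0, ∞].
        have hne : (2 * ((m' i : ENNReal) + 1)) = ((2 * (m' i + 1) : ℕ) : ENNReal) := by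
          push_cast; rfl
        rw [hne] at h
        exact (ENNReal.mul_le_mul_iff_left (Nat.cast_ne_zero.mpr (by omega))
          (ENNReal.natCast_ne_top _)).mp h
  exact fun m => key (m i) j m le_rfl

end DoubleHurwitz

end

/-! ### Evolution inequalities for the absolute values of the coefficients -/

noncomputable section

namespace DoubleHurwitz

open MvPowerSeries

/-! ### Majorants of the evolution equations -/

/-- The series of the absolute values of the coefficients. -/
def absSeries (A : Series ℂ) : Maj Var := fun m => ‖coeff m A‖ₑ

theorem coeff_absSeries (A : Series ℂ) (m : Var →₀ ℕ) : coeff m (absSeries A) = ‖coeff m A‖ₑ := rfl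

theorem enorm_natCast_complex (n : ℕ) : ‖(n : ℂ)‖ₑ = n := by
  rw [← ofReal_norm, Complex.norm_natCast, ENNReal.ofReal_natCast]

theorem absSeries_zero : absSeries 0 = 0 := by
  ext m; simp [coeff_absSeries]

theorem absSeries_add_le (A B : Series ℂ) : absSeries (A + B) ≤ absSeries A + absSeries B :=
  Maj.le_def.mpr fun m => by
    rw [map_add, coeff_absSeries, coeff_absSeries, coeff_absSeries, map_add]
    exact enorm_add_le _ _

theorem absSeries_sum_le (s : Finset ι) (f : ι → Series ℂ) :
    absSeries (∑ i ∈ s, f i) ≤ ∑ i ∈ s, absSeries (f i) := Maj.le_def.mpr fun m => by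
  rw [map_sum, coeff_absSeries, map_sum]
  exact enorm_sum_le _ _

theorem absSeries_mul_le (A B : Series ℂ) : absSeries (A * B) ≤ absSeries A * absSeries B :=
  Maj.le_def.mpr fun m => by
    classical
    rw [coeff_absSeries, coeff_mul, coeff_mul]
    refine (enorm_sum_le _ _).trans (le_of_eq (Finset.sum_congr rfl fun x _ => ?_))
    rw [enorm_mul, coeff_absSeries, coeff_absSeries]

theorem absSeries_natCast_smul (n : ℕ) (A : Series ℂ) :
    absSeries ((n : ℂ) • A) = (n : Maj Var) * absSeries A := by
  ext m
  rw [coeff_absSeries, map_smul, smul_eq_mul, enorm_mul, enorm_natCast_complex,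
    ← map_natCast (C : ENNReal →+* Maj Var), coeff_C_mul, coeff_absSeries]

theorem absSeries_X_mul (v : Var) (A : Series ℂ) : absSeries (X v * A) = X v * absSeries A := by
  ext m
  rw [coeff_absSeries]
  by_cases h : m v = 0
  · rw [coeff_X_mul_of_eq_zero _ h, coeff_X_mul_of_eq_zero _ h, enorm_zero]
  · rw [coeff_X_mul_of_ne_zero _ h, coeff_X_mul_of_ne_zero _ h, coeff_absSeries]

theorem absSeries_pd (v : Var) (A : Series ℂ) :
    absSeries (pd v A) = pderiv ENNReal v (absSeries A) := by
  ext m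
  rw [coeff_absSeries, pd, coeff_pderiv, coeff_pderiv, enorm_mul, coeff_absSeries,
    ← Nat.cast_add_one, enorm_natCast_complex, Nat.cast_add_one]

theorem absSeries_formalSum_le (f : ι → Series ℂ) :
    absSeries (formalSum f) ≤ esum fun i => absSeries (f i) := Maj.le_def.mpr fun m => by
  rw [coeff_absSeries, coeff_formalSum, coeff_esum]
  by_cases h : (Function.support fun i => coeff m (f i)).Finite
  · rw [finsum_eq_sum _ h]
    refine (enorm_sum_le _ _).trans ?_
    exact ENNReal.sum_le_tsum h.toFinset
  -- By convention a formal sum with infinite support has coefficient 0, so no finiteness hypothesis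
  -- is needed.
  · rw [finsum_of_infinite_support h, enorm_zero]
    exact zero_le

/-- All evolution inequalities are stated doubled, which removes the factors ½. -/
theorem two_mul_absSeries_half_smul (A : Series ℂ) :
    2 * absSeries ((1 / 2 : ℂ) • A) = absSeries A := by
  have h := absSeries_natCast_smul 2 ((1 / 2 : ℂ) • A)
  rw [smul_smul] at h
  norm_num at h
  exact h.symm

/-- The partial derivative with respect to `t_k` of a majorant. -/
def dt (k : ℕ+) (A : Maj Var) : Maj Var := pderiv ENNReal (Var.t k) A

theorem dt_mono (k : ℕ+) {A B : Maj Var} (h : A ≤ B) : dt k A ≤ dt k B := pderiv_le_pderiv _ h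

theorem dt_comm (k l : ℕ+) (A : Maj Var) : dt k (dt l A) = dt l (dt k A) :=
  pderiv_pderiv_comm _ _ _

theorem dt_add (k : ℕ+) (A B : Maj Var) : dt k (A + B) = dt k A + dt k B := map_add _ _ _

theorem dt_mul (k : ℕ+) (A B : Maj Var) : dt k (A * B) = dt k A * B + A * dt k B :=
  pderiv_mul' _ _ _

theorem dt_esum (k : ℕ+) (f : ι → Maj Var) : dt k (esum f) = esum fun i => dt k (f i) :=
  pderiv_esum _ _

theorem dt_natCast_mul (k : ℕ+) (n : ℕ) (A : Maj Var) : dt k ((n : Maj Var) * A) = n * dt k A := by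
  rw [dt_mul, dt, ← map_natCast (C : ENNReal →+* Maj Var), pderiv_C, zero_mul, zero_add]

theorem dt_X (k l : ℕ+) : dt k (X (Var.t l)) = if l = k then 1 else 0 := by
  split_ifs with h
  · rw [h, dt, pderiv_X_self]
  · rw [dt, pderiv_X_of_ne fun e => h (t_injective e)]

/-- Twice the join operator. -/
def majJoin (A : Maj Var) : Maj Var :=
  esum fun p : ℕ+ × ℕ+ => (((p.1 : ℕ) * (p.2 : ℕ) : ℕ) : Maj Var) *
    (X (Var.t p.1) * X (Var.t p.2) * dt (p.1 + p.2) A)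

/-- Twice the cut operator. -/
def majCut (A : Maj Var) : Maj Var :=
  esum fun p : ℕ+ × ℕ+ => ((p.1 + p.2 : ℕ+) : Maj Var) *
    (X (Var.t (p.1 + p.2)) * dt p.1 (dt p.2 A))

/-- Twice the quadratic term. -/
def majQuad (A B : Maj Var) : Maj Var :=
  esum fun p : ℕ+ × ℕ+ => ((p.1 + p.2 : ℕ+) : Maj Var) *
    (X (Var.t (p.1 + p.2)) * (dt p.1 A * dt p.2 B))

theorem majQuad_comm (A B : Maj Var) : majQuad A B = majQuad B A := by
  rw [majQuad, majQuad, esum_prod, esum_comm,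
    esum_prod (fun p : ℕ+ × ℕ+ => ((p.1 + p.2 : ℕ+) : Maj Var) *
      (X (Var.t (p.1 + p.2)) * (dt p.1 B * dt p.2 A)))]
  simp only [add_comm, mul_comm]

theorem two_mul_absSeries_joinTerm_le (A : Series ℂ) :
    2 * absSeries (joinTerm A) ≤ majJoin (absSeries A) := by
  rw [joinTerm, two_mul_absSeries_half_smul]
  refine (absSeries_formalSum_le _).trans (esum_le_esum fun p => le_of_eq ?_)
  rw [← Nat.cast_mul, absSeries_natCast_smul, mul_assoc, absSeries_X_mul, absSeries_X_mul,
    absSeries_pd, ← mul_assoc (X _), dt]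

theorem two_mul_absSeries_cutTerm_le (A : Series ℂ) :
    2 * absSeries (cutTerm A) ≤ majCut (absSeries A) := by
  rw [cutTerm, two_mul_absSeries_half_smul]
  refine (absSeries_formalSum_le _).trans (esum_le_esum fun p => le_of_eq ?_)
  rw [← Nat.cast_add, absSeries_natCast_smul, absSeries_X_mul, absSeries_pd, absSeries_pd, dt, dt,
    PNat.add_coe]

theorem esum_sum (s : Finset κ) (f : ι → κ → Maj τ) :
    esum (fun i => ∑ k ∈ s, f i k) = ∑ k ∈ s, esum fun i => f i k := by
  ext m
  rw [coeff_esum, map_sum]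
  simp only [map_sum, coeff_esum]
  exact Summable.tsum_finsetSum fun _ _ => ENNReal.summable

theorem two_mul_absSeries_quadTerm_le (F : ℕ → Series ℂ) (n : ℕ) :
    2 * absSeries (quadTerm F n) ≤
      ∑ a ∈ Finset.range (n + 1), majQuad (absSeries (F a)) (absSeries (F (n - a))) := by
  rw [quadTerm, two_mul_absSeries_half_smul]
  simp only [majQuad]
  rw [← esum_sum]
  refine (absSeries_formalSum_le _).trans (esum_le_esum fun p => ?_)
  rw [← Nat.cast_add, absSeries_natCast_smul, absSeries_X_mul, ← PNat.add_coe, ← Finset.mul_sum,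
    ← Finset.mul_sum]
  refine mul_le_mul' le_rfl (mul_le_mul' le_rfl ((absSeries_sum_le _ _).trans
    (Finset.sum_le_sum fun a _ => (absSeries_mul_le _ _).trans ?_)))
  rw [absSeries_pd, absSeries_pd, dt, dt]

/-- The majorant of the `n`-th coefficient of the genus expansion. -/
def genusMaj (n : ℕ) : Maj Var := absSeries (genusPart n)

theorem two_mul_pderiv_genusMaj_le (n : ℕ) :
    2 * pderiv ENNReal Var.beta (genusMaj n) ≤ majJoin (genusMaj n) +
      (if n = 0 then 0 else majCut (genusMaj (n - 1))) +
      ∑ a ∈ Finset.range (n + 1), majQuad (genusMaj a) (genusMaj (n - a)) := by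
  rw [genusMaj, ← absSeries_pd, cutJoinEq_genusPart n]
  refine (mul_le_mul' le_rfl ((absSeries_add_le _ _).trans
    (add_le_add (absSeries_add_le _ _) le_rfl))).trans ?_
  rw [mul_add, mul_add]
  refine add_le_add (add_le_add (two_mul_absSeries_joinTerm_le _) ?_)
    (two_mul_absSeries_quadTerm_le _ _)
  split_ifs
  · rw [absSeries_zero, mul_zero]
  · exact two_mul_absSeries_cutTerm_le _

/-- The majorant of the initial value. -/
def initialMaj : Maj Var :=
  esum fun k : ℕ+ => ((k : ℕ) : Maj Var) * (X Var.Q ^ (k : ℕ) * X (Var.t k) * X (Var.tbar k))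

theorem absSeries_X_pow_mul (v : Var) (n : ℕ) (A : Series ℂ) :
    absSeries (X v ^ n * A) = X v ^ n * absSeries A := by
  induction n with
  | zero => simp
  | succ n ih => rw [pow_succ', mul_assoc, absSeries_X_mul, ih, pow_succ', mul_assoc]

theorem absSeries_one : absSeries 1 = 1 := by
  classical
  ext m
  rw [coeff_absSeries, coeff_one, coeff_one]
  split_ifs <;> simp

theorem absSeries_neg (A : Series ℂ) : absSeries (-A) = absSeries A := by
  ext m
  rw [coeff_absSeries, coeff_absSeries, map_neg, enorm_neg]

theorem absSeries_initialValue_le : absSeries initialValue ≤ initialMaj := by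
  rw [initialValue, absSeries_neg]
  refine (absSeries_formalSum_le _).trans (esum_le_esum fun k => le_of_eq ?_)
  rw [absSeries_natCast_smul, mul_assoc, absSeries_X_pow_mul, absSeries_X_mul,
    ← mul_one (X (Var.tbar k) : Series ℂ), absSeries_X_mul, absSeries_one, mul_one, mul_assoc]

/-- Each coefficient of F_n is either 0 or the coefficient of log Z, so the same bound serves for
every n. -/
theorem genusMaj_leUpTo_initialMaj (n : ℕ) : LeUpTo Var.beta 0 (genusMaj n) initialMaj := by
  intro m hm
  have hm0 : m Var.beta = 0 := Nat.le_zero.mp hm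
  have h := agree_logZ_initialValue m hm0
  refine le_trans ?_ (absSeries_initialValue_le m)
  change ‖coeff m (genusPart n)‖ₑ ≤ ‖coeff m initialValue‖ₑ
  rw [← h, genusPart, coeff_homPart]
  split_ifs
  · exact le_rfl
  · simp

/-! ### Differentiated majorants -/

/-- The derivative hits t_k, t_l or A; the first two contributions agree by symmetry. -/
theorem dt_majJoin (j : ℕ+) (A : Maj Var) :
    dt j (majJoin A) = 2 * (((j : ℕ) : Maj Var) *
      esum fun l : ℕ+ => ((l : ℕ) : Maj Var) * (X (Var.t l) * dt (j + l) A)) + majJoin (dt j A) := by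
  have h1 : (esum fun p : ℕ+ × ℕ+ => (((p.1 : ℕ) * (p.2 : ℕ) : ℕ) : Maj Var) *
      (dt j (X (Var.t p.1)) * X (Var.t p.2) * dt (p.1 + p.2) A)) = ((j : ℕ) : Maj Var) *
      esum fun l : ℕ+ => ((l : ℕ) : Maj Var) * (X (Var.t l) * dt (j + l) A) := by
    rw [esum_prod, esum_eq_single j, mul_esum]
    · congr 1
      funext l
      rw [dt_X, if_pos rfl, Nat.cast_mul]
      ring
    · intro k hk
      simp only [dt_X, if_neg hk, zero_mul, mul_zero, esum_zero]
  have h2 : (esum fun p : ℕ+ × ℕ+ => (((p.1 : ℕ) * (p.2 : ℕ) : ℕ) : Maj Var) *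
      (X (Var.t p.1) * dt j (X (Var.t p.2)) * dt (p.1 + p.2) A)) = ((j : ℕ) : Maj Var) *
      esum fun l : ℕ+ => ((l : ℕ) : Maj Var) * (X (Var.t l) * dt (j + l) A) := by
    rw [← h1, esum_prod, esum_comm, esum_prod]
    congr 1
    funext k
    congr 1
    funext l
    rw [Nat.mul_comm, add_comm l k, mul_comm (X _)]
  rw [two_mul]
  nth_rewrite 1 [← h1]
  rw [← h2, majJoin, majJoin, dt_esum, ← esum_add, ← esum_add]
  congr 1
  funext p
  rw [dt_natCast_mul, dt_mul, dt_mul, dt_comm j]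
  ring

theorem dt_majQuad (j : ℕ+) (A : Maj Var) :
    dt j (majQuad A A) = ((j : ℕ) : Maj Var) * (esum fun p : ℕ+ × ℕ+ =>
      if p.1 + p.2 = j then dt p.1 A * dt p.2 A else 0) + 2 * majQuad A (dt j A) := by
  rw [two_mul]
  nth_rewrite 1 [majQuad_comm A (dt j A)]
  rw [majQuad, majQuad, majQuad, dt_esum, mul_esum, ← esum_add, ← esum_add]
  congr 1
  funext p
  rw [dt_natCast_mul, dt_mul, dt_X, dt_mul, dt_comm j, dt_comm j]
  split_ifs with h
  · rw [h]; ring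
  · ring

end DoubleHurwitz

end

/-! ### Restriction of the evolution inequalities to a curve -/

noncomputable section

namespace DoubleHurwitz

open MvPowerSeries

/-! ### The weights `1 / k²` -/

/-- The weight `1 / k²`. -/
def invSq (k : ℕ+) : ENNReal := (((k : ℕ) : ENNReal) ^ 2)⁻¹

theorem pnat_cast_ne_zero (k : ℕ+) : ((k : ℕ) : ENNReal) ≠ 0 := Nat.cast_ne_zero.mpr k.ne_zero

theorem sq_mul_invSq (k : ℕ+) : ((k : ℕ) : ENNReal) ^ 2 * invSq k = 1 :=
  ENNReal.mul_inv_cancel (pow_ne_zero _ (pnat_cast_ne_zero k))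
    (ENNReal.pow_ne_top (ENNReal.natCast_ne_top _))

theorem invSq_antitone {k l : ℕ+} (h : k ≤ l) : invSq l ≤ invSq k := by
  refine ENNReal.inv_le_inv.mpr (pow_le_pow_left' ?_ 2)
  exact_mod_cast h

theorem invSq_le_one (k : ℕ+) : invSq k ≤ 1 := by
  have := invSq_antitone (one_le : 1 ≤ k)
  simpa [invSq] using this

/-- This is (k + l)² ≤ 2 (k² + l²) divided by k² l² (k + l)². -/
theorem invSq_mul_invSq_le (k l : ℕ+) :
    invSq k * invSq l ≤ 2 * (invSq k + invSq l) * invSq (k + l) := by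
  have h : (((k + l : ℕ+) : ℕ) : ENNReal) ^ 2 ≤
      2 * (((k : ℕ) : ENNReal) ^ 2 + ((l : ℕ) : ENNReal) ^ 2) := by
    have h' : ∀ a b : ℕ, (a + b) ^ 2 ≤ 2 * (a ^ 2 + b ^ 2) := fun a b => by
      zify; nlinarith [sq_nonneg ((a : ℤ) - b)]
    exact_mod_cast h' k l
  calc invSq k * invSq l
      = (((k + l : ℕ+) : ℕ) : ENNReal) ^ 2 * invSq (k + l) * (invSq k * invSq l) := by
        rw [sq_mul_invSq, one_mul]
    _ ≤ 2 * (((k : ℕ) : ENNReal) ^ 2 + ((l : ℕ) : ENNReal) ^ 2) * invSq (k + l) *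
        (invSq k * invSq l) := by gcongr
    _ = 2 * ((((k : ℕ) : ENNReal) ^ 2 * invSq k) * invSq l +
        (((l : ℕ) : ENNReal) ^ 2 * invSq l) * invSq k) * invSq (k + l) := by ring
    _ = 2 * (invSq k + invSq l) * invSq (k + l) := by
        rw [sq_mul_invSq, sq_mul_invSq, one_mul, one_mul, add_comm (invSq l)]

theorem tsum_invSq_le : ∑' k : ℕ+, invSq k ≤ 2 := by
  have h1 : ∀ n : ℕ, ENNReal.ofReal (1 / (n : ℝ) ^ 2) ≤ ((n : ENNReal) ^ 2)⁻¹ := by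
    intro n
    rcases Nat.eq_zero_or_pos n with rfl | hn
    · simp
    · rw [one_div, ENNReal.ofReal_inv_of_pos (by positivity), ENNReal.ofReal_pow (by positivity),
        ENNReal.ofReal_natCast]
  have h2 : ∀ k : ℕ+, invSq k = ENNReal.ofReal (1 / ((k : ℕ) : ℝ) ^ 2) := by
    intro k
    have hk : (0 : ℝ) < (k : ℕ) := Nat.cast_pos.mpr k.pos
    rw [one_div, ENNReal.ofReal_inv_of_pos (by positivity), ENNReal.ofReal_pow (by positivity),
        ENNReal.ofReal_natCast, invSq]
  have h3 : ∑' n : ℕ, ENNReal.ofReal (1 / (n : ℝ) ^ 2) ≤ 2 := by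
    rw [← ENNReal.ofReal_tsum_of_nonneg (fun n => by positivity) hasSum_zeta_two.summable,
      hasSum_zeta_two.tsum_eq]
    refine ENNReal.ofReal_le_of_le_toReal ?_
    have := Real.pi_lt_d2
    have := Real.pi_pos
    simp only [ENNReal.toReal_ofNat]
    nlinarith
  calc ∑' k : ℕ+, invSq k = ∑' k : ℕ+, ENNReal.ofReal (1 / ((k : ℕ) : ℝ) ^ 2) := by
        simp only [h2]
    _ ≤ ∑' n : ℕ, ENNReal.ofReal (1 / (n : ℝ) ^ 2) :=
        ENNReal.tsum_comp_le_tsum_of_injective PNat.coe_injective _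
    _ ≤ 2 := h3

/-- After `invSq_mul_invSq_le` one of the two weights is summed freely, giving at most 2 since π²/6
< 2, and the other index is absorbed in the sum over n. The two symmetric halves and the factor 2
make 8. -/
theorem tsum_invSq_mul_invSq_le (b : ℕ+ → ENNReal) :
    ∑' p : ℕ+ × ℕ+, invSq p.1 * invSq p.2 * b (p.1 + p.2) ≤ 8 * ∑' n, invSq n * b n := by
  set G := ∑' n, invSq n * b n with hG
  have h1 : ∀ k : ℕ+, ∑' l : ℕ+, invSq (k + l) * b (k + l) ≤ G := fun k =>
    ENNReal.tsum_comp_le_tsum_of_injective (add_right_injective k) fun n => invSq n * b n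
  have h2 : ∑' k : ℕ+, ∑' l : ℕ+, invSq k * (invSq (k + l) * b (k + l)) ≤ 2 * G := by
    simp only [ENNReal.tsum_mul_left]
    calc _ ≤ ∑' k : ℕ+, invSq k * G := ENNReal.tsum_le_tsum fun k => mul_le_mul' le_rfl (h1 k)
      _ = (∑' k : ℕ+, invSq k) * G := ENNReal.tsum_mul_right
      _ ≤ 2 * G := mul_le_mul' tsum_invSq_le le_rfl
  have h3 : ∑' k : ℕ+, ∑' l : ℕ+, invSq l * (invSq (k + l) * b (k + l)) ≤ 2 * G := by
    rw [ENNReal.tsum_comm]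
    simpa only [add_comm] using h2
  calc _ ≤ ∑' p : ℕ+ × ℕ+, (2 * (invSq p.1 * (invSq (p.1 + p.2) * b (p.1 + p.2))) +
        2 * (invSq p.2 * (invSq (p.1 + p.2) * b (p.1 + p.2)))) := by
        refine ENNReal.tsum_le_tsum fun p => ?_
        refine (mul_le_mul' (invSq_mul_invSq_le p.1 p.2) le_rfl).trans (le_of_eq ?_)
        ring
    _ ≤ 2 * (2 * G) + 2 * (2 * G) := by
        rw [ENNReal.tsum_add, ENNReal.tsum_mul_left, ENNReal.tsum_mul_left, ENNReal.tsum_prod',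
          ENNReal.tsum_prod']
        exact add_le_add (mul_le_mul' le_rfl h2) (mul_le_mul' le_rfl h3)
    _ = 8 * G := by ring

theorem esum_invSq_mul_invSq_le (B : ℕ+ → Maj τ) :
    (esum fun p : ℕ+ × ℕ+ => C (invSq p.1 * invSq p.2) * B (p.1 + p.2)) ≤
      8 * esum fun n => C (invSq n) * B n := Maj.le_def.mpr fun m => by
  have h8 : (8 : Maj τ) = C 8 := (map_ofNat (C : ENNReal →+* Maj τ) 8).symm
  rw [h8, coeff_C_mul]
  simp only [coeff_esum, coeff_C_mul]
  exact tsum_invSq_mul_invSq_le _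

/-! ### Evaluation at a curve of points -/

/-- The weights at which the variables are evaluated. -/
def curve : Var → Maj (Fin 2)
  | Var.beta => X 1
  | Var.Q => 1
  | Var.t k => C (invSq k * ((k : ℕ) : ENNReal)⁻¹) * X 0 ^ (k : ℕ)
  | Var.tbar k => C ((((k : ℕ) : ENNReal) ^ 3)⁻¹)

/-- Evaluation of a majorant along the curve. -/
def evalCurve : Maj Var →+* Maj (Fin 2) := subst curve

theorem evalCurve_X (v : Var) : evalCurve (X v) = curve v := subst_X _ _

theorem evalCurve_mono {A B : Maj Var} (h : A ≤ B) : evalCurve A ≤ evalCurve B := subst_mono _ h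

theorem evalCurve_esum (f : ι → Maj Var) : evalCurve (esum f) = esum fun i => evalCurve (f i) :=
  subst_esum _ _

theorem natCast_mul_C (n : ℕ) (a : ENNReal) : (n : Maj τ) * C a = C (n * a) := by
  rw [map_mul, map_natCast]

/-- The cube in t_k = x^k / k³ is chosen so that k t_k carries the weight 1/k² of the convolution
estimate. -/
theorem natCast_mul_curve_t (k : ℕ+) :
    ((k : ℕ) : Maj (Fin 2)) * curve (Var.t k) = C (invSq k) * X 0 ^ (k : ℕ) := by
  rw [curve, ← mul_assoc, natCast_mul_C, mul_left_comm,
    ENNReal.mul_inv_cancel (pnat_cast_ne_zero k) (ENNReal.natCast_ne_top _), mul_one]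

theorem pderiv_evalCurve (A : Maj Var) :
    pderiv ENNReal 1 (evalCurve A) = evalCurve (pderiv ENNReal Var.beta A) := by
  rw [evalCurve, pderiv_subst_maj, esum_eq_single Var.beta]
  · rw [curve, pderiv_X_self, one_mul]
  · have h0 : pderiv ENNReal (1 : Fin 2) (X 0) = 0 := pderiv_X_of_ne (by decide)
    intro v hv
    have : pderiv ENNReal 1 (curve v) = 0 := by
      cases v with
      | beta => exact absurd rfl hv
      | Q => rw [curve, pderiv_one]
      | t k =>
        rw [curve, pderiv_mul', pderiv_C, zero_mul, zero_add, Derivation.leibniz_pow, h0, smul_zero,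
          smul_zero, mul_zero]
      | tbar k => rw [curve, pderiv_C]
    rw [this, zero_mul]

/-- The Euler operator `x ∂/∂x`. -/
def eulerX (A : Maj (Fin 2)) : Maj (Fin 2) := X 0 * pderiv ENNReal 0 A

theorem eulerX_mono {A B : Maj (Fin 2)} (h : A ≤ B) : eulerX A ≤ eulerX B :=
  mul_le_mul' le_rfl (pderiv_le_pderiv _ h)

theorem eulerX_mul (A B : Maj (Fin 2)) : eulerX (A * B) = eulerX A * B + A * eulerX B := by
  rw [eulerX, pderiv_mul', eulerX, eulerX]; ring

theorem eulerX_C (a : ENNReal) : eulerX (C a) = 0 := by rw [eulerX, pderiv_C, mul_zero]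

theorem eulerX_C_mul (a : ENNReal) (A : Maj (Fin 2)) : eulerX (C a * A) = C a * eulerX A := by
  rw [eulerX_mul, eulerX_C, zero_mul, zero_add]

theorem eulerX_X_pow (k : ℕ) : eulerX (X 0 ^ k) = (k : Maj (Fin 2)) * X 0 ^ k := by
  induction k with
  | zero => rw [pow_zero, ← map_one (C : ENNReal →+* Maj (Fin 2)), eulerX_C]; simp
  | succ k ih =>
    rw [pow_succ, eulerX_mul, ih, eulerX, pderiv_X_self]
    push_cast
    ring

theorem eulerX_esum (f : ι → Maj (Fin 2)) : eulerX (esum f) = esum fun i => eulerX (f i) := by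
  simp only [eulerX, pderiv_esum, mul_esum]

theorem natCast_mul_le_eulerX (k : ℕ) (A : Maj (Fin 2)) :
    (k : Maj (Fin 2)) * (X 0 ^ k * A) ≤ eulerX (X 0 ^ k * A) := by
  rw [eulerX_mul, eulerX_X_pow, mul_assoc]
  exact le_self_add

/-- Along the curve only the t_k depend on x, and x ∂t_k/∂x = k t_k. -/
theorem eulerX_evalCurve (A : Maj Var) :
    eulerX (evalCurve A) = esum fun k : ℕ+ => C (invSq k) * (X 0 ^ (k : ℕ) * evalCurve (dt k A)) := by
  rw [eulerX, evalCurve, pderiv_subst_maj, mul_esum, esum_comp_of_injective t_injective]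
  · congr 1
    funext k
    rw [← mul_assoc, ← eulerX, curve, eulerX_C_mul, eulerX_X_pow, dt, ← mul_assoc, ← mul_assoc]
    congr 2
    rw [mul_comm (C _), natCast_mul_C, mul_left_comm,
      ENNReal.mul_inv_cancel (pnat_cast_ne_zero k) (ENNReal.natCast_ne_top _), mul_one]
  · have h0 : pderiv ENNReal (0 : Fin 2) (X 1) = 0 := pderiv_X_of_ne (by decide)
    intro v hv
    have : pderiv ENNReal 0 (curve v) = 0 := by
      cases v with
      | beta => exact h0
      | Q => rw [curve, pderiv_one]
      | t k => exact absurd ⟨k, rfl⟩ hv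
      | tbar k => rw [curve, pderiv_C]
    rw [this, zero_mul, mul_zero]

/-- The velocity `∑_k x^k ∂A/∂t_k`. -/
def flux (A : Maj Var) : Maj (Fin 2) := esum fun k : ℕ+ => X 0 ^ (k : ℕ) * evalCurve (dt k A)

/-- The weights k t_k and l t_l are convolved, and the result is compared with the expansion of
`eulerX_evalCurve`. -/
theorem evalCurve_majJoin_le (A : Maj Var) :
    evalCurve (majJoin A) ≤ 8 * eulerX (evalCurve A) := by
  rw [eulerX_evalCurve, majJoin, evalCurve_esum]
  refine le_trans (le_of_eq ?_)
    (esum_invSq_mul_invSq_le fun n => X 0 ^ (n : ℕ) * evalCurve (dt n A))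
  congr 1
  funext p
  have h : ∀ a b c d e : Maj (Fin 2), a * b * (c * d * e) = (a * c) * (b * d) * e := by
    intros; ring
  rw [map_mul, map_mul, map_mul, map_natCast, evalCurve_X, evalCurve_X, Nat.cast_mul, h,
    natCast_mul_curve_t, natCast_mul_curve_t, map_mul, PNat.add_coe, pow_add]
  ring

theorem natCast_mul_curve_t_add_le (k l : ℕ+) :
    (((k + l : ℕ+) : ℕ) : Maj (Fin 2)) * curve (Var.t (k + l)) ≤
      X 0 ^ (k : ℕ) * (C (invSq l) * X 0 ^ (l : ℕ)) := by
  rw [natCast_mul_curve_t, PNat.add_coe, pow_add, mul_left_comm]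
  exact mul_le_mul' le_rfl (mul_le_mul' (Maj.C_le_C (invSq_antitone (PNat.lt_add_left l k).le))
    le_rfl)

/-- Since (k + l)^{-2} ≤ l^{-2}, the whole weight can be given to B; the factor A is left with the
unweighted sum over k, its flux. -/
theorem evalCurve_majQuad_le (A B : Maj Var) :
    evalCurve (majQuad A B) ≤ flux A * eulerX (evalCurve B) := by
  rw [eulerX_evalCurve, majQuad, evalCurve_esum, flux, esum_mul]
  simp only [mul_esum]
  rw [← esum_prod (fun p : ℕ+ × ℕ+ => X 0 ^ (p.1 : ℕ) * evalCurve (dt p.1 A) *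
    (C (invSq p.2) * (X 0 ^ (p.2 : ℕ) * evalCurve (dt p.2 B))))]
  refine esum_le_esum fun p => ?_
  rw [map_mul, map_mul, map_natCast, evalCurve_X, map_mul, ← mul_assoc]
  refine (mul_le_mul' (natCast_mul_curve_t_add_le p.1 p.2) le_rfl).trans (le_of_eq ?_)
  ring

theorem evalCurve_majCut_le (A : Maj Var) : evalCurve (majCut A) ≤ eulerX (flux A) := by
  rw [majCut, evalCurve_esum, flux, eulerX_esum, esum_prod]
  refine esum_le_esum fun k => ?_
  rw [eulerX_mul, eulerX_evalCurve, mul_esum]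
  refine le_trans (esum_le_esum fun l => ?_) le_add_self
  rw [map_mul, map_mul, map_natCast, evalCurve_X, ← mul_assoc, dt_comm]
  refine (mul_le_mul' (natCast_mul_curve_t_add_le k l) le_rfl).trans (le_of_eq ?_)
  ring

/-- The factor x^k lets each x∂/∂x gain at least k, so two of them undo the weight 1/k². The bound
loses derivatives and therefore serves only for terms already estimated. -/
theorem flux_le (A : Maj Var) : flux A ≤ eulerX (eulerX (eulerX (evalCurve A))) := by
  rw [eulerX_evalCurve, eulerX_esum, eulerX_esum, flux]
  refine esum_le_esum fun k => ?_
  rw [eulerX_C_mul, eulerX_C_mul]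
  calc X 0 ^ (k : ℕ) * evalCurve (dt k A)
      = C (invSq k) * (((k : ℕ) : Maj (Fin 2)) * (((k : ℕ) : Maj (Fin 2)) *
          (X 0 ^ (k : ℕ) * evalCurve (dt k A)))) := by
        rw [← mul_assoc _ _ (X 0 ^ (k : ℕ) * _), ← mul_assoc, mul_comm (C _), ← pow_two,
          ← map_natCast (C : ENNReal →+* Maj (Fin 2)), ← map_pow, ← map_mul, sq_mul_invSq, map_one,
          one_mul]
    _ ≤ C (invSq k) * (((k : ℕ) : Maj (Fin 2)) *
          eulerX (X 0 ^ (k : ℕ) * evalCurve (dt k A))) := by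
        gcongr
        exact natCast_mul_le_eulerX _ _
    _ ≤ C (invSq k) * eulerX (eulerX (X 0 ^ (k : ℕ) * evalCurve (dt k A))) := by
        gcongr
        rw [← map_natCast (C : ENNReal →+* Maj (Fin 2)), ← eulerX_C_mul]
        refine eulerX_mono ?_
        rw [map_natCast]
        exact natCast_mul_le_eulerX _ _

/-! ### Evolution inequalities along the curve -/

/-- The values of `F_n` along the curve. -/
def genusCurve (n : ℕ) : Maj (Fin 2) := evalCurve (genusMaj n)

/-- The values of `∂F_0/∂t_j` along the curve. -/
def momentum (j : ℕ+) : Maj (Fin 2) := evalCurve (dt j (genusMaj 0))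

theorem two_mul_pderiv_genusCurve_le (n : ℕ) :
    2 * pderiv ENNReal 1 (genusCurve n) ≤ 8 * eulerX (genusCurve n) +
      (if n = 0 then 0 else eulerX (flux (genusMaj (n - 1)))) +
      ∑ a ∈ Finset.range (n + 1), evalCurve (majQuad (genusMaj a) (genusMaj (n - a))) := by
  have h := evalCurve_mono (two_mul_pderiv_genusMaj_le n)
  rw [map_mul, map_ofNat, map_add, map_add, map_sum, ← pderiv_evalCurve] at h
  refine h.trans (add_le_add (add_le_add (evalCurve_majJoin_le _) ?_) le_rfl)
  split_ifs
  · rw [map_zero]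
  · exact evalCurve_majCut_le _

/-- Differentiating the genus 0 equation in t_j before restricting to the curve gives a closed
system for the momenta: the flux of F_0 is ∑ x^k times the k-th momentum, so no derivative is lost.
-/
theorem two_mul_pderiv_momentum_le (j : ℕ+) :
    2 * pderiv ENNReal 1 (momentum j) ≤
      2 * (((j : ℕ) : Maj (Fin 2)) *
        esum fun l : ℕ+ => C (invSq l) * X 0 ^ (l : ℕ) * momentum (j + l)) +
      8 * eulerX (momentum j) +
      (((j : ℕ) : Maj (Fin 2)) * (esum fun p : ℕ+ × ℕ+ =>
        if p.1 + p.2 = j then momentum p.1 * momentum p.2 else 0) +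
      2 * ((esum fun k : ℕ+ => X 0 ^ (k : ℕ) * momentum k) * eulerX (momentum j))) := by
  have h := two_mul_pderiv_genusMaj_le 0
  rw [if_pos rfl, add_zero, zero_add, Finset.sum_range_one, Nat.sub_zero] at h
  have h := evalCurve_mono (dt_mono j h)
  have h2 : ∀ A : Maj Var, dt j (2 * A) = 2 * dt j A := fun A => dt_natCast_mul j 2 A
  rw [dt_add, dt_majJoin, dt_majQuad, h2, map_mul, map_ofNat, dt, pderiv_pderiv_comm,
    ← pderiv_evalCurve, ← dt, ← momentum] at h
  refine h.trans ?_
  rw [map_add, map_add, map_add, map_mul, map_mul, map_mul, map_mul, map_natCast, map_ofNat,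
    evalCurve_esum, evalCurve_esum]
  refine add_le_add (add_le_add (le_of_eq ?_) (evalCurve_majJoin_le _)) (add_le_add
    (le_of_eq ?_) (mul_le_mul' le_rfl (evalCurve_majQuad_le _ _)))
  · congr 3
    funext l
    rw [map_mul, map_mul, map_natCast, evalCurve_X, ← mul_assoc, natCast_mul_curve_t, momentum]
  · congr 2
    funext p
    split_ifs
    · rw [map_mul, momentum, momentum]
    · rw [map_zero]

end DoubleHurwitz

end

/-! ### Initial values along the curve and the comparison series -/

noncomputable section

namespace DoubleHurwitz

open MvPowerSeries

/-! ### Initial values along the curve -/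

theorem coeff_monomialSubst_curve {a : Var →₀ ℕ} (ha : a Var.beta ≠ 0) {m : Fin 2 →₀ ℕ}
    (hm : m 1 = 0) : coeff m (monomialSubst curve a) = 0 := by
  obtain ⟨a', rfl⟩ := exists_add_single ha
  rw [monomialSubst_add, monomialSubst_single, pow_one, mul_comm, curve,
    coeff_X_mul_of_eq_zero _ hm]

/-- The value of β on the curve is the second variable, and no other value involves it, so degree 0
is read off from degree 0. -/
theorem LeUpTo.evalCurve {A B : Maj Var} (h : LeUpTo Var.beta 0 A B) :
    LeUpTo 1 0 (DoubleHurwitz.evalCurve A) (DoubleHurwitz.evalCurve B) := by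
  intro m hm
  rw [DoubleHurwitz.evalCurve, subst_apply, subst_apply, coeff_esum, coeff_esum]
  refine ENNReal.tsum_le_tsum fun a => ?_
  rw [coeff_C_mul, coeff_C_mul]
  by_cases ha : a Var.beta = 0
  · exact mul_le_mul' (h a ha.le) le_rfl
  · rw [coeff_monomialSubst_curve ha (Nat.le_zero.mp hm), mul_zero, mul_zero]

theorem natCast_mul_inv_cube (k : ℕ+) :
    ((k : ℕ) : Maj τ) * C ((((k : ℕ) : ENNReal) ^ 3)⁻¹) = C (invSq k) := by
  have hk := pnat_cast_ne_zero k
  have ht : ((k : ℕ) : ENNReal) ≠ ⊤ := ENNReal.natCast_ne_top _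
  rw [natCast_mul_C, pow_succ', ENNReal.mul_inv (.inl hk) (.inl ht), ← mul_assoc,
    ENNReal.mul_inv_cancel hk ht, one_mul, invSq]

theorem dt_initialMaj (j : ℕ+) :
    dt j initialMaj = ((j : ℕ) : Maj Var) * (X Var.Q ^ (j : ℕ) * X (Var.tbar j)) := by
  have h : ∀ k : ℕ+, dt j (((k : ℕ) : Maj Var) *
      (X Var.Q ^ (k : ℕ) * X (Var.t k) * X (Var.tbar k))) =
      if k = j then ((k : ℕ) : Maj Var) * (X Var.Q ^ (k : ℕ) * X (Var.tbar k)) else 0 := by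
    intro k
    have hQ : dt j (X Var.Q ^ (k : ℕ)) = 0 := by
      rw [dt, Derivation.leibniz_pow, pderiv_X_of_ne (t_ne_Q j).symm, smul_zero, smul_zero]
    have hb : dt j (X (Var.tbar k)) = 0 := pderiv_X_of_ne nofun
    rw [dt_natCast_mul, dt_mul, dt_mul, hQ, hb, dt_X]
    split_ifs <;> simp
  rw [initialMaj, dt_esum, esum_eq_single j]
  · rw [h, if_pos rfl]
  · intro k hk
    rw [h, if_neg hk]

/-- At β = 0 the derivative of the initial majorant is j Q^j t̄_j, which is j / j³ on the curve. -/
theorem momentum_leUpTo (j : ℕ+) : LeUpTo 1 0 (momentum j) (C (invSq j)) := by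
  have h := ((genusMaj_leUpTo_initialMaj 0).pderiv (t_ne_beta j)).evalCurve
  rw [← dt, ← dt, dt_initialMaj, map_mul, map_mul, map_natCast, map_pow, evalCurve_X, evalCurve_X,
    curve, curve, one_pow, one_mul, natCast_mul_inv_cube] at h
  exact h

theorem genusCurve_leUpTo (n : ℕ) :
    LeUpTo 1 0 (genusCurve n) (esum fun k : ℕ+ => X 0 ^ (k : ℕ)) := by
  refine (genusMaj_leUpTo_initialMaj n).evalCurve.trans (.of_le ?_)
  rw [initialMaj, evalCurve_esum]
  refine esum_le_esum fun k => ?_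
  rw [map_mul, map_mul, map_mul, map_natCast, map_pow, evalCurve_X, evalCurve_X, evalCurve_X,
    show curve Var.Q = 1 from rfl, one_pow, one_mul, ← mul_assoc, natCast_mul_curve_t, curve]
  have h1 : (C (invSq k) : Maj (Fin 2)) ≤ 1 := by
    rw [← map_one (C : ENNReal →+* Maj (Fin 2))]
    exact Maj.C_le_C (invSq_le_one k)
  have h2 : (C ((((k : ℕ) : ENNReal) ^ 3)⁻¹) : Maj (Fin 2)) ≤ 1 := by
    rw [← map_one (C : ENNReal →+* Maj (Fin 2))]
    refine Maj.C_le_C (ENNReal.inv_le_one.mpr (one_le_pow₀ ?_))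
    exact_mod_cast (one_le : 1 ≤ k)
  calc C (invSq k) * X 0 ^ (k : ℕ) * C ((((k : ℕ) : ENNReal) ^ 3)⁻¹)
      ≤ 1 * X 0 ^ (k : ℕ) * 1 := mul_le_mul' (mul_le_mul' h1 le_rfl) h2
    _ = X 0 ^ (k : ℕ) := by rw [one_mul, mul_one]

/-! ### The shear -/

/-- Substitution of `x + 8 β` for the variable. -/
def shear : Maj Unit →+* Maj (Fin 2) := subst fun _ => X 0 + 8 * X 1

theorem shear_mono {A B : Maj Unit} (h : A ≤ B) : shear A ≤ shear B := subst_mono _ h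

theorem shear_X : shear (X ()) = X 0 + 8 * X 1 := subst_X _ _

theorem X_le_shear_X : X 0 ≤ shear (X ()) := by rw [shear_X]; exact le_self_add

/-- The derivative of a series in one variable. -/
def der (A : Maj Unit) : Maj Unit := pderiv ENNReal () A

theorem pderiv_ofNat_mul (i : τ) (n : ℕ) [n.AtLeastTwo] (A : Maj τ) :
    pderiv ENNReal i ((OfNat.ofNat n : Maj τ) * A) = OfNat.ofNat n * pderiv ENNReal i A := by
  rw [← map_ofNat (C : ENNReal →+* Maj τ), pderiv_mul', pderiv_C, zero_mul, zero_add]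

theorem pderiv_zero_shear (A : Maj Unit) : pderiv ENNReal 0 (shear A) = shear (der A) := by
  rw [shear, pderiv_subst_maj, esum_eq_single () (fun j hj => absurd rfl hj), map_add,
    pderiv_ofNat_mul, pderiv_X_self, pderiv_X_of_ne (by decide), mul_zero, add_zero, one_mul, der]

theorem pderiv_one_shear (A : Maj Unit) : pderiv ENNReal 1 (shear A) = 8 * shear (der A) := by
  rw [shear, pderiv_subst_maj, esum_eq_single () (fun j hj => absurd rfl hj), map_add,
    pderiv_ofNat_mul, pderiv_X_self, pderiv_X_of_ne (by decide), zero_add, mul_one, der]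

/-- Replacing the factor x by x + 8β turns the estimate into one for series in the single variable y
= x + 8β. -/
theorem eulerX_shear_le (A : Maj Unit) : eulerX (shear A) ≤ shear (X () * der A) := by
  rw [eulerX, pderiv_zero_shear, map_mul]
  exact mul_le_mul' X_le_shear_X le_rfl

theorem der_mul (A B : Maj Unit) : der (A * B) = der A * B + A * der B := pderiv_mul' _ _ _

theorem der_pow_succ (A : Maj Unit) (n : ℕ) :
    der (A ^ (n + 1)) = ((n + 1 : ℕ) : Maj Unit) * (A ^ n * der A) := by
  rw [der, Derivation.leibniz_pow, Nat.add_sub_cancel, smul_eq_mul, nsmul_eq_mul, der]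

/-! ### Series in one variable -/

/-- Because of the factor X, coefficients of degree r + 1 on the right use A and A' only up to
degree r. -/
theorem le_of_fixedPoint {U B A A' : Maj Unit} (h : A ≤ U + X () * (B * A))
    (h' : U + X () * (B * A') ≤ A') : A ≤ A' := by
  have key : ∀ r, LeUpTo () r A A' := by
    intro r
    induction r with
    | zero =>
      intro m hm
      refine (h m).trans (le_trans ?_ (h' m))
      change coeff m (U + X () * (B * A)) ≤ coeff m (U + X () * (B * A'))
      rw [map_add, map_add, coeff_X_mul_of_eq_zero _ (Nat.le_zero.mp hm),
        coeff_X_mul_of_eq_zero _ (Nat.le_zero.mp hm)]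
    | succ r ih =>
      intro m hm
      by_cases hm0 : m () = 0
      · exact ih m (by omega)
      · refine (h m).trans (le_trans ?_ (h' m))
        change coeff m (U + X () * (B * A)) ≤ coeff m (U + X () * (B * A'))
        rw [map_add, map_add, coeff_X_mul_of_ne_zero _ hm0, coeff_X_mul_of_ne_zero _ hm0]
        refine add_le_add le_rfl (((LeUpTo.refl B).mul ih) _ ?_)
        simp
        omega
  exact fun m => key (m ()) m le_rfl

/-- The generating series of the Catalan numbers. -/
def catalanMaj : Maj Unit := PowerSeries.map (Nat.castRingHom ENNReal) PowerSeries.catalanSeries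

theorem catalanMaj_eq : catalanMaj = 1 + X () * (catalanMaj * catalanMaj) := by
  have h := congrArg (PowerSeries.map (Nat.castRingHom ENNReal))
    PowerSeries.catalanSeries_sq_mul_X_add_one
  rw [map_add, map_mul, map_pow, PowerSeries.map_X, map_one] at h
  conv_lhs => rw [catalanMaj, ← h]
  rw [add_comm, mul_comm, pow_two]
  rfl

theorem one_le_catalanMaj : 1 ≤ catalanMaj := by
  rw [catalanMaj_eq]; exact le_self_add

theorem der_catalanMaj : der catalanMaj =
    catalanMaj * catalanMaj + 2 * (X () * (catalanMaj * der catalanMaj)) := by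
  conv_lhs => rw [catalanMaj_eq, der, map_add, pderiv_one, zero_add, pderiv_mul', pderiv_X_self,
    one_mul, ← der, der_mul]
  ring

/-- The geometric series `∑ a ^ n X ^ n`. -/
def geom (a : ENNReal) : Maj Unit := PowerSeries.mk fun n => a ^ n

theorem geom_eq (a : ENNReal) : geom a = 1 + X () * (C a * geom a) := by
  change (PowerSeries.mk fun n => a ^ n) =
    1 + PowerSeries.X * (PowerSeries.C a * PowerSeries.mk fun n => a ^ n)
  ext n
  rw [map_add, PowerSeries.coeff_mk]
  cases n with
  | zero => simp
  | succ n =>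
    rw [PowerSeries.coeff_succ_X_mul, PowerSeries.coeff_C_mul, PowerSeries.coeff_mk, pow_succ',
      PowerSeries.coeff_one, if_neg (Nat.succ_ne_zero n), zero_add]

theorem one_le_geom (a : ENNReal) : 1 ≤ geom a := by
  rw [geom_eq]; exact le_self_add

theorem der_geom (a : ENNReal) : der (geom a) = C a * (geom a * geom a) := by
  change PowerSeries.derivative ENNReal (PowerSeries.mk fun n => a ^ n) =
    PowerSeries.C a * ((PowerSeries.mk fun n => a ^ n) * PowerSeries.mk fun n => a ^ n)
  ext n
  rw [PowerSeries.coeff_derivative, PowerSeries.coeff_C_mul, PowerSeries.coeff_mul,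
    PowerSeries.coeff_mk]
  have : ∀ x ∈ Finset.HasAntidiagonal.antidiagonal n,
      (PowerSeries.coeff x.1 (PowerSeries.mk fun n => a ^ n)) *
        (PowerSeries.coeff x.2 (PowerSeries.mk fun n => a ^ n)) = a ^ n := by
    intro x hx
    rw [PowerSeries.coeff_mk, PowerSeries.coeff_mk, ← pow_add,
      Finset.HasAntidiagonal.mem_antidiagonal.mp hx]
  rw [Finset.sum_congr rfl this, Finset.sum_const, Finset.Nat.card_antidiagonal, nsmul_eq_mul,
    pow_succ]
  push_cast
  ring

theorem catalan_le (n : ℕ) : catalan n ≤ 4 ^ n := by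
  rw [catalan_eq_centralBinom_div]
  refine (Nat.div_le_self _ _).trans ?_
  rw [Nat.centralBinom, show 4 = 2 ^ 2 by rfl, ← pow_mul]
  exact Nat.choose_le_two_pow _ _

theorem catalanMaj_le : catalanMaj ≤ geom 4 := by
  refine Maj.le_def.mpr fun m => ?_
  rw [show m = Finsupp.single () (m ()) from Finsupp.unique_ext (by simp)]
  change PowerSeries.coeff (m ()) catalanMaj ≤ PowerSeries.coeff (m ()) (geom 4)
  rw [catalanMaj, PowerSeries.coeff_map, PowerSeries.catalanSeries_coeff, geom,
    PowerSeries.coeff_mk, Nat.coe_castRingHom]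
  exact_mod_cast catalan_le (m ())

/-- The Catalan numbers are at most 4^n. The product 1/((1 - 4y)(1 - 8y)) solves A = 1/(1 - 8y) + 4y
A, and 2/(1 - 8y) is a supersolution. So multiplication by the Catalan series does not worsen the
pole. -/
theorem catalanMaj_mul_geom_le : catalanMaj * geom 8 ≤ 2 * geom 8 := by
  refine (mul_le_mul' catalanMaj_le le_rfl).trans ?_
  refine le_of_fixedPoint (U := geom 8) (B := C 4) (le_of_eq ?_) ?_
  · conv_lhs => rw [geom_eq 4]
    ring
  · have h8 : (C 8 : Maj Unit) = 8 := map_ofNat _ 8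
    have h4 : (C 4 : Maj Unit) = 4 := map_ofNat _ 4
    have : X () * (C 8 * geom 8) ≤ geom 8 := by
      conv_rhs => rw [geom_eq]
      exact le_add_self
    calc geom 8 + X () * (C 4 * (2 * geom 8)) = geom 8 + X () * (C 8 * geom 8) := by
          rw [h8, h4]; ring
      _ ≤ geom 8 + geom 8 := by gcongr
      _ = 2 * geom 8 := by ring

theorem esum_nat_eq (f : ℕ → Maj τ) : esum f = f 0 + esum fun n => f (n + 1) := by
  ext m
  rw [map_add, coeff_esum, coeff_esum]
  exact tsum_eq_zero_add' ENNReal.summable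

theorem esum_pnat_eq (f : ℕ+ → Maj τ) : esum f = esum fun n : ℕ => f n.succPNat :=
  esum_comp_of_injective Nat.succPNat_injective fun k hk =>
    absurd ⟨k.natPred, PNat.succPNat_natPred k⟩ hk

/-- The Catalan equation says c = 1/(1 - yc), so the geometric sum is yc · c. -/
theorem esum_pow_le : (esum fun l : ℕ+ => (X () * catalanMaj) ^ (l : ℕ)) ≤
    X () * (catalanMaj * catalanMaj) := by
  set s : Maj Unit := esum fun l : ℕ => (X () * catalanMaj) ^ l with hs
  have h0 : (esum fun l : ℕ => (X () * catalanMaj) ^ (l + 1)) = X () * (catalanMaj * s) := by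
    rw [hs, ← mul_assoc, mul_esum]
    simp only [pow_succ']
  have h1 : s = 1 + X () * (catalanMaj * s) := by
    rw [← h0, hs, esum_nat_eq, pow_zero]
  have h2 : s ≤ catalanMaj := le_of_fixedPoint h1.le catalanMaj_eq.ge
  have h3 : (esum fun l : ℕ+ => (X () * catalanMaj) ^ (l : ℕ)) = X () * (catalanMaj * s) := by
    rw [esum_pnat_eq]
    exact h0
  rw [h3]
  gcongr

end DoubleHurwitz

end

/-! ### Bounds for all genera along the curve -/

noncomputable section

namespace DoubleHurwitz

open MvPowerSeries

/-! ### The bound in genus zero -/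

/-- The majorant of `∂F_0/∂t_j` along the curve. -/
def momentumBound (j : ℕ+) : Maj (Fin 2) := C (invSq j) * shear catalanMaj ^ (j : ℕ)

theorem one_le_shear_catalanMaj : 1 ≤ shear catalanMaj := by
  rw [← map_one shear]; exact shear_mono one_le_catalanMaj

theorem C_invSq_le_one (k : ℕ+) : (C (invSq k) : Maj τ) ≤ 1 := by
  rw [← map_one (C : ENNReal →+* Maj τ)]
  exact Maj.C_le_C (invSq_le_one k)

theorem esum_X_pow_mul_le :
    (esum fun k : ℕ+ => X 0 ^ (k : ℕ) * shear catalanMaj ^ (k : ℕ)) ≤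
      shear (X () * (catalanMaj * catalanMaj)) := by
  refine le_trans ?_ (shear_mono esum_pow_le)
  rw [shear, subst_esum, ← shear]
  refine esum_le_esum fun k => ?_
  rw [map_pow, map_mul, mul_pow]
  exact mul_le_mul' (pow_le_pow_left' X_le_shear_X _) le_rfl

theorem esum_X_pow_mul_momentumBound_le :
    (esum fun k : ℕ+ => X 0 ^ (k : ℕ) * momentumBound k) ≤
      shear (X () * (catalanMaj * catalanMaj)) := by
  refine le_trans (esum_le_esum fun k => mul_le_mul' le_rfl ?_) esum_X_pow_mul_le
  rw [momentumBound]
  exact (mul_le_mul' (C_invSq_le_one k) le_rfl).trans (one_mul _).le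

/-- From c = 1 + y c² one has y c² ≤ c ≤ c², and c' = c² + 2 y c c'. The left side is at most 10 (c²
+ y c c'), and the right side is 16 (c² + 2 y c c'). The 16 is twice the slope 8 of the shear. -/
theorem catalanMaj_inequality :
    2 * (catalanMaj * (X () * (catalanMaj * catalanMaj))) + 8 * (X () * der catalanMaj) +
      (8 * catalanMaj + 2 * (X () * (catalanMaj * catalanMaj) * (X () * der catalanMaj))) ≤
    16 * der catalanMaj := by
  set c := catalanMaj with hc
  have h1 : X () * (c * c) ≤ c := by
    conv_rhs => rw [hc, catalanMaj_eq, ← hc]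
    exact le_add_self
  have h2 : c ≤ c * c := by
    conv_lhs => rw [← one_mul c]
    exact mul_le_mul' one_le_catalanMaj le_rfl
  have h3 : X () * der c ≤ X () * (c * der c) := by
    gcongr
    conv_lhs => rw [← one_mul (der c)]
    exact mul_le_mul' one_le_catalanMaj le_rfl
  have h4 : der c = c * c + 2 * (X () * (c * der c)) := der_catalanMaj
  calc _ ≤ 2 * (c * c) + 8 * (X () * (c * der c)) + (8 * (c * c) + 2 * (c * (X () * der c))) := by
        gcongr
    _ = 10 * (c * c + X () * (c * der c)) := by ring
    _ ≤ 10 * (c * c + X () * (c * der c)) + (6 * (c * c) + 22 * (X () * (c * der c))) := le_self_add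
    _ = 16 * (c * c + 2 * (X () * (c * der c))) := by ring
    _ = 16 * der c := by rw [← h4]

/-- The candidate is a supersolution of the momentum system. Every term is at most U = j · j^{-2}
c^{j-1} times a term of `catalanMaj_inequality`; the convolution j ∑ p_k p_l gives the summand 8c.
-/
theorem momentumBound_step (j : ℕ+) :
    2 * (((j : ℕ) : Maj (Fin 2)) *
        esum fun l : ℕ+ => C (invSq l) * X 0 ^ (l : ℕ) * momentumBound (j + l)) +
      8 * eulerX (momentumBound j) +
      (((j : ℕ) : Maj (Fin 2)) * (esum fun p : ℕ+ × ℕ+ =>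
        if p.1 + p.2 = j then momentumBound p.1 * momentumBound p.2 else 0) +
      2 * ((esum fun k : ℕ+ => X 0 ^ (k : ℕ) * momentumBound k) * eulerX (momentumBound j))) ≤
    2 * pderiv ENNReal 1 (momentumBound j) := by
  obtain ⟨i, hi⟩ : ∃ i, (j : ℕ) = i + 1 := ⟨j.natPred, (PNat.natPred_add_one j).symm⟩
  set c := catalanMaj with hc
  set U : Maj (Fin 2) := C (invSq j) * ((j : ℕ) : Maj (Fin 2)) * shear (c ^ i) with hU
  have hb : momentumBound j = C (invSq j) * shear (c ^ (i + 1)) := by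
    rw [momentumBound, hi, map_pow]
  have h1 : ((j : ℕ) : Maj (Fin 2)) *
      (esum fun l : ℕ+ => C (invSq l) * X 0 ^ (l : ℕ) * momentumBound (j + l)) ≤
      U * shear (c * (X () * (c * c))) := by
    calc _ ≤ ((j : ℕ) : Maj (Fin 2)) * (esum fun l : ℕ+ => C (invSq j) * shear c ^ (j : ℕ) *
          (X 0 ^ (l : ℕ) * shear c ^ (l : ℕ))) := by
          refine mul_le_mul' le_rfl (esum_le_esum fun l => ?_)
          rw [momentumBound, PNat.add_coe, pow_add]
          calc C (invSq l) * X 0 ^ (l : ℕ) * (C (invSq (j + l)) *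
                (shear c ^ (j : ℕ) * shear c ^ (l : ℕ)))
              ≤ 1 * X 0 ^ (l : ℕ) * (C (invSq j) * (shear c ^ (j : ℕ) * shear c ^ (l : ℕ))) := by
                gcongr
                · exact C_invSq_le_one l
                · exact Maj.C_le_C (invSq_antitone (PNat.lt_add_right j l).le)
            _ = _ := by ring
      _ ≤ ((j : ℕ) : Maj (Fin 2)) * (C (invSq j) * shear c ^ (j : ℕ) *
            shear (X () * (c * c))) := by
          rw [← mul_esum]
          gcongr
          exact esum_X_pow_mul_le
      _ = U * shear (c * (X () * (c * c))) := by
          rw [hU, hi, map_mul shear c, map_pow, pow_succ]; ring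
  have h2 : eulerX (momentumBound j) ≤ U * shear (X () * der c) := by
    rw [hb, eulerX_C_mul]
    refine (mul_le_mul' le_rfl (eulerX_shear_le _)).trans (le_of_eq ?_)
    rw [der_pow_succ, hU, hi, map_mul, map_mul, map_mul, map_mul, map_natCast]
    ring
  have h3 : (esum fun p : ℕ+ × ℕ+ =>
      if p.1 + p.2 = j then momentumBound p.1 * momentumBound p.2 else 0) ≤
      8 * (C (invSq j) * shear (c ^ (i + 1))) := by
    refine le_trans (le_of_eq ?_) ((esum_invSq_mul_invSq_le fun n => if n = j then
      shear c ^ (n : ℕ) else 0).trans (le_of_eq ?_))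
    · congr 1
      funext p
      split_ifs
      · rw [momentumBound, momentumBound, PNat.add_coe, pow_add, map_mul]; ring
      · rw [mul_zero]
    · rw [esum_eq_single j]
      · rw [if_pos rfl, hi, map_pow]
      · intro n hn
        rw [if_neg hn, mul_zero]
  have h4 : pderiv ENNReal 1 (momentumBound j) = U * (8 * shear (der c)) := by
    rw [hb, pderiv_mul', pderiv_C, zero_mul, zero_add, pderiv_one_shear, der_pow_succ, hU, hi,
      map_mul, map_mul, map_natCast]
    ring
  have h5 := mul_le_mul' (le_refl U) (shear_mono catalanMaj_inequality)
  rw [← hc] at h5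
  simp only [map_add, map_mul shear 2, map_mul shear 8, map_mul shear 16, map_ofNat] at h5
  calc _ ≤ 2 * (U * shear (c * (X () * (c * c)))) + 8 * (U * shear (X () * der c)) +
        (((j : ℕ) : Maj (Fin 2)) * (8 * (C (invSq j) * shear (c ^ (i + 1)))) +
        2 * (shear (X () * (c * c)) * (U * shear (X () * der c)))) := by
        gcongr
        exact esum_X_pow_mul_momentumBound_le
    _ = U * (2 * shear (c * (X () * (c * c))) + 8 * shear (X () * der c) + (8 * shear c +
        2 * shear (X () * (c * c) * (X () * der c)))) := by
        rw [map_mul shear (X () * (c * c)), hU, pow_succ, map_mul shear (c ^ i)]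
        ring
    _ ≤ U * (16 * shear (der c)) := h5
    _ = 2 * pderiv ENNReal 1 (momentumBound j) := by rw [h4]; ring

theorem momentum_le (j : ℕ+) : momentum j ≤ momentumBound j := by
  refine le_of_pderiv_le (i := (1 : Fin 2)) (fun j m hm => ?_) (fun r ih j => ?_) j
  · refine (momentum_leUpTo j m hm.le).trans ?_
    have : (C (invSq j) : Maj (Fin 2)) ≤ momentumBound j := by
      conv_lhs => rw [← mul_one (C (invSq j) : Maj (Fin 2))]
      exact mul_le_mul' le_rfl (one_le_pow₀ one_le_shear_catalanMaj)
    exact this m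
  · refine (LeUpTo.of_le (two_mul_pderiv_momentum_le j)).trans (.trans ?_
      (.of_le (momentumBound_step j)))
    have hE : ∀ j, LeUpTo 1 r (eulerX (momentum j)) (eulerX (momentumBound j)) := fun j =>
      (LeUpTo.refl _).mul ((ih j).pderiv (by decide))
    refine .add (.add ((LeUpTo.refl _).mul ((LeUpTo.refl _).mul (.esum fun l =>
      (LeUpTo.refl _).mul (ih _)))) ((LeUpTo.refl _).mul (hE j)))
      (.add ((LeUpTo.refl _).mul (.esum fun p => ?_)) ((LeUpTo.refl _).mul
        (.mul (.esum fun k => (LeUpTo.refl _).mul (ih k)) (hE j))))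
    split_ifs
    · exact (ih _).mul (ih _)
    · exact .refl _

theorem flux_genusMaj_zero_le : flux (genusMaj 0) ≤ shear (X () * (catalanMaj * catalanMaj)) :=
  (esum_le_esum fun k => mul_le_mul' le_rfl (momentum_le k)).trans esum_X_pow_mul_momentumBound_le

/-! ### The bound in higher genus -/

/-- The series bounded by a multiple of a power of a geometric series. -/
def Tame (A : Maj (Fin 2)) : Prop :=
  ∃ (M : ENNReal) (N : ℕ), M ≠ ⊤ ∧ A ≤ C M * shear (geom 8 ^ (N + 1))

theorem geom_pow_mono {N N' : ℕ} (h : N ≤ N') : geom 8 ^ N ≤ geom 8 ^ N' :=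
  pow_le_pow_right₀ (one_le_geom 8) h

theorem Tame.mono {A B : Maj (Fin 2)} (hB : Tame B) (h : A ≤ B) : Tame A :=
  let ⟨M, N, hM, hB⟩ := hB
  ⟨M, N, hM, h.trans hB⟩

theorem tame_zero : Tame 0 := ⟨0, 0, ENNReal.zero_ne_top, by simp⟩

theorem Tame.add {A B : Maj (Fin 2)} (hA : Tame A) (hB : Tame B) : Tame (A + B) := by
  obtain ⟨M, N, hM, hA⟩ := hA
  obtain ⟨M', N', hM', hB⟩ := hB
  refine ⟨M + M', max N N', ENNReal.add_ne_top.mpr ⟨hM, hM'⟩, ?_⟩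
  rw [map_add, add_mul]
  refine add_le_add (hA.trans (mul_le_mul' le_rfl (shear_mono (geom_pow_mono ?_))))
    (hB.trans (mul_le_mul' le_rfl (shear_mono (geom_pow_mono ?_))))
  · exact Nat.succ_le_succ (le_max_left _ _)
  · exact Nat.succ_le_succ (le_max_right _ _)

theorem Tame.mul {A B : Maj (Fin 2)} (hA : Tame A) (hB : Tame B) : Tame (A * B) := by
  obtain ⟨M, N, hM, hA⟩ := hA
  obtain ⟨M', N', hM', hB⟩ := hB
  refine ⟨M * M', N + N' + 1, ENNReal.mul_ne_top hM hM', (mul_le_mul' hA hB).trans (le_of_eq ?_)⟩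
  rw [map_mul, mul_mul_mul_comm, ← map_mul shear, ← pow_add]
  congr 3
  ring

theorem tame_sum (s : Finset ι) {f : ι → Maj (Fin 2)} (h : ∀ i ∈ s, Tame (f i)) :
    Tame (∑ i ∈ s, f i) := by
  classical
  induction s using Finset.induction_on with
  | empty => exact tame_zero
  | insert i s hi ih =>
    rw [Finset.sum_insert hi]
    exact (h i (Finset.mem_insert_self i s)).add
      (ih fun k hk => h k (Finset.mem_insert_of_mem hk))

theorem X_mul_geom_le : X () * (C 8 * geom 8) ≤ geom 8 := by
  conv_rhs => rw [geom_eq]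
  exact le_add_self

theorem X_mul_der_geom_pow_le (N : ℕ) : X () * der (geom 8 ^ (N + 1)) ≤
    ((N + 1 : ℕ) : Maj Unit) * geom 8 ^ (N + 2) := by
  rw [der_pow_succ, der_geom]
  calc X () * (((N + 1 : ℕ) : Maj Unit) * (geom 8 ^ N * (C 8 * (geom 8 * geom 8))))
      = ((N + 1 : ℕ) : Maj Unit) * (geom 8 ^ (N + 1) * (X () * (C 8 * geom 8))) := by ring
    _ ≤ ((N + 1 : ℕ) : Maj Unit) * (geom 8 ^ (N + 1) * geom 8) := by
      gcongr
      exact X_mul_geom_le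
    _ = ((N + 1 : ℕ) : Maj Unit) * geom 8 ^ (N + 2) := by ring

theorem Tame.eulerX {A : Maj (Fin 2)} (hA : Tame A) : Tame (DoubleHurwitz.eulerX A) := by
  obtain ⟨M, N, hM, hA⟩ := hA
  refine ⟨M * (N + 1 : ℕ), N + 1, ENNReal.mul_ne_top hM (ENNReal.natCast_ne_top _), ?_⟩
  refine (eulerX_mono hA).trans ?_
  rw [eulerX_C_mul, map_mul, mul_assoc]
  refine mul_le_mul' le_rfl ((eulerX_shear_le _).trans
    ((shear_mono (X_mul_der_geom_pow_le N)).trans (le_of_eq ?_)))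
  rw [map_mul, map_natCast, map_natCast]

/-- A multiple of g^{N+1}, with g = 1/(1 - 8y), is a supersolution: its β-derivative has a pole of
order N + 2, which dominates x∂/∂x of it, even times the flux of F_0 because of
`catalanMaj_mul_geom_le`, as well as the source. -/
theorem tame_of_pderiv_le {f S : Maj (Fin 2)} (hS : Tame S)
    (h0 : LeUpTo 1 0 f (shear (geom 8)))
    (h : 2 * pderiv ENNReal 1 f ≤ 8 * eulerX f +
      2 * (shear (X () * (catalanMaj * catalanMaj)) * eulerX f) + S) : Tame f := by
  obtain ⟨M, N, hM, hS⟩ := hS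
  -- M pays for the source, and 1 for the initial value.
  refine ⟨M + 1, N, ENNReal.add_ne_top.mpr ⟨hM, ENNReal.one_ne_top⟩, ?_⟩
  set P : Maj (Fin 2) := C (M + 1) * shear (geom 8 ^ (N + 1)) with hP
  set n : Maj Unit := ((N + 1 : ℕ) : Maj Unit) with hn
  have h1n : 1 ≤ n := by
    rw [hn, Nat.cast_succ]
    exact le_add_self
  have h1C : (1 : Maj (Fin 2)) ≤ C (M + 1) := by
    rw [← map_one (C : ENNReal →+* Maj (Fin 2))]
    exact Maj.C_le_C le_add_self
  have hE : eulerX P ≤ C (M + 1) * shear (X () * der (geom 8 ^ (N + 1))) := by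
    rw [hP, eulerX_C_mul]
    exact mul_le_mul' le_rfl (eulerX_shear_le _)
  have hc : X () * (catalanMaj * catalanMaj) ≤ catalanMaj := by
    conv_rhs => rw [catalanMaj_eq]
    exact le_add_self
  have hder : der (geom 8 ^ (N + 1)) = n * (8 * geom 8 ^ (N + 2)) := by
    rw [der_pow_succ, der_geom, ← hn, map_ofNat]; ring
  have key : 8 * (X () * der (geom 8 ^ (N + 1))) +
      2 * (X () * (catalanMaj * catalanMaj) * (X () * der (geom 8 ^ (N + 1)))) +
      geom 8 ^ (N + 1) ≤ 16 * der (geom 8 ^ (N + 1)) := by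
    have h1 := X_mul_der_geom_pow_le N
    rw [← hn] at h1
    calc _ ≤ 8 * (n * geom 8 ^ (N + 2)) + 2 * (catalanMaj * (n * geom 8 ^ (N + 2))) +
          n * geom 8 ^ (N + 2) := by
          gcongr
          calc geom 8 ^ (N + 1) ≤ geom 8 ^ (N + 2) := geom_pow_mono (Nat.le_succ _)
            _ = 1 * geom 8 ^ (N + 2) := (one_mul _).symm
            _ ≤ n * geom 8 ^ (N + 2) := by gcongr
      _ = 9 * (n * geom 8 ^ (N + 2)) + 2 * (n * geom 8 ^ (N + 1) * (catalanMaj * geom 8)) := by ring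
      _ ≤ 9 * (n * geom 8 ^ (N + 2)) + 2 * (n * geom 8 ^ (N + 1) * (2 * geom 8)) := by
          exact add_le_add le_rfl (mul_le_mul' le_rfl (mul_le_mul' le_rfl catalanMaj_mul_geom_le))
      _ = 13 * (n * geom 8 ^ (N + 2)) := by ring
      -- The right side 16 g' for the power g = `geom 8 ^ (N + 1)` is 128 n `geom 8 ^ (N + 2)`, and
      -- 128 = 13 + 115.
      _ ≤ 13 * (n * geom 8 ^ (N + 2)) + 115 * (n * geom 8 ^ (N + 2)) := le_self_add
      _ = 16 * der (geom 8 ^ (N + 1)) := by rw [hder]; ring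
  have hstep : 8 * eulerX P + 2 * (shear (X () * (catalanMaj * catalanMaj)) * eulerX P) + S ≤
      2 * pderiv ENNReal 1 P := by
    have h5 := mul_le_mul' (le_refl (C (M + 1))) (shear_mono key)
    simp only [map_add, map_mul shear 2, map_mul shear 8, map_mul shear 16, map_ofNat] at h5
    calc _ ≤ 8 * (C (M + 1) * shear (X () * der (geom 8 ^ (N + 1)))) +
          2 * (shear (X () * (catalanMaj * catalanMaj)) *
            (C (M + 1) * shear (X () * der (geom 8 ^ (N + 1))))) +
          C (M + 1) * shear (geom 8 ^ (N + 1)) := by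
          refine add_le_add (add_le_add (mul_le_mul' le_rfl hE)
            (mul_le_mul' le_rfl (mul_le_mul' le_rfl hE))) (hS.trans ?_)
          exact mul_le_mul' (Maj.C_le_C le_self_add) le_rfl
      _ = C (M + 1) * (8 * shear (X () * der (geom 8 ^ (N + 1))) +
          2 * shear (X () * (catalanMaj * catalanMaj) * (X () * der (geom 8 ^ (N + 1)))) +
          shear (geom 8 ^ (N + 1))) := by
          rw [map_mul shear (X () * (catalanMaj * catalanMaj))]; ring
      _ ≤ C (M + 1) * (16 * shear (der (geom 8 ^ (N + 1)))) := by
          simpa only [map_add] using h5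
      _ = 2 * pderiv ENNReal 1 P := by
          rw [hP, pderiv_mul', pderiv_C, zero_mul, zero_add, pderiv_one_shear]; ring
  refine le_of_pderiv_le (i := (1 : Fin 2)) (ι := Unit) (p := fun _ => f) (P := fun _ => P)
    (fun _ m hm => ?_) (fun r ih _ => ?_) ()
  · refine (h0 m hm.le).trans ?_
    have : shear (geom 8) ≤ P := by
      rw [hP]
      conv_lhs => rw [← one_mul (shear (geom 8))]
      refine mul_le_mul' h1C (shear_mono ?_)
      conv_lhs => rw [← pow_one (geom 8)]
      exact geom_pow_mono (by omega)
    exact this m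
  · have hE : LeUpTo 1 r (eulerX f) (eulerX P) := (LeUpTo.refl _).mul ((ih ()).pderiv (by decide))
    exact ((LeUpTo.of_le h).trans (.add (.add ((LeUpTo.refl _).mul hE)
      ((LeUpTo.refl _).mul ((LeUpTo.refl _).mul hE))) (.refl _))).trans (.of_le hstep)

theorem esum_X_pow_le : (esum fun k : ℕ+ => (X 0 : Maj (Fin 2)) ^ (k : ℕ)) ≤ shear (geom 8) := by
  refine esum_X_pow_mul_le.trans' (esum_le_esum fun k => ?_) |>.trans (shear_mono ?_)
  · conv_lhs => rw [← mul_one (X 0 ^ (k : ℕ))]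
    exact mul_le_mul' le_rfl (one_le_pow₀ one_le_shear_catalanMaj)
  · calc X () * (catalanMaj * catalanMaj) ≤ catalanMaj := by
          conv_rhs => rw [catalanMaj_eq]
          exact le_add_self
      _ ≤ geom 4 := catalanMaj_le
      _ ≤ geom 8 := by
          refine Maj.le_def.mpr fun m => ?_
          rw [show m = Finsupp.single () (m ()) from Finsupp.unique_ext (by simp)]
          change PowerSeries.coeff (m ()) (geom 4) ≤ PowerSeries.coeff (m ()) (geom 8)
          rw [geom, geom, PowerSeries.coeff_mk, PowerSeries.coeff_mk]
          exact pow_le_pow_left' (by norm_num) _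

theorem Tame.flux {A : Maj Var} (h : Tame (evalCurve A)) : Tame (DoubleHurwitz.flux A) :=
  h.eulerX.eulerX.eulerX.mono (flux_le A)

/-- In the quadratic sum for n > 0 the two terms containing F_0 and F_n form the transport term. All
other terms, and the cut term, involve lower genus only and are tame, since tameness survives
products and Euler operators. -/
theorem tame_genusCurve (n : ℕ) : Tame (genusCurve n) := by
  induction n using Nat.strong_induction_on with
  | _ n ih =>
    have h0 : LeUpTo 1 0 (genusCurve n) (shear (geom 8)) :=
      (genusCurve_leUpTo n).trans (.of_le esum_X_pow_le)
    have h := two_mul_pderiv_genusCurve_le n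
    have hV : ∀ A, evalCurve (majQuad (genusMaj 0) A) ≤
        shear (X () * (catalanMaj * catalanMaj)) * eulerX (evalCurve A) := fun A =>
      (evalCurve_majQuad_le _ _).trans (mul_le_mul' flux_genusMaj_zero_le le_rfl)
    cases n with
    | zero =>
      refine tame_of_pderiv_le tame_zero h0 (h.trans ?_)
      rw [if_pos rfl, add_zero, zero_add, Finset.sum_range_one, add_zero, two_mul (_ * _)]
      exact add_le_add le_rfl ((hV _).trans le_self_add)
    | succ n =>
      rw [if_neg (Nat.succ_ne_zero n), Nat.add_sub_cancel, Finset.sum_range_succ,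
        Finset.sum_range_succ', Nat.sub_self, Nat.sub_zero, majQuad_comm (genusMaj (n + 1))] at h
      refine tame_of_pderiv_le (S := eulerX (flux (genusMaj n)) + ∑ k ∈ Finset.range n,
        evalCurve (majQuad (genusMaj (k + 1)) (genusMaj (n + 1 - (k + 1)))))
        (.add (Tame.flux (ih n (Nat.lt_succ_self n))).eulerX (tame_sum _ fun k hk => ?_)) h0
        (h.trans ?_)
      · have hk := Finset.mem_range.mp hk
        refine Tame.mono ?_ (evalCurve_majQuad_le _ _)
        exact (Tame.flux (ih (k + 1) (by omega))).mul (ih _ (by omega)).eulerX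
      · set S₁ := eulerX (flux (genusMaj n))
        set S₂ := ∑ k ∈ Finset.range n,
          evalCurve (majQuad (genusMaj (k + 1)) (genusMaj (n + 1 - (k + 1))))
        set V := shear (X () * (catalanMaj * catalanMaj)) * eulerX (genusCurve (n + 1)) with hVdef
        have hV' : evalCurve (majQuad (genusMaj 0) (genusMaj (n + 1))) ≤ V := hV _
        calc _ ≤ 8 * eulerX (genusCurve (n + 1)) + S₁ + (S₂ + V + V) := by gcongr
          _ = 8 * eulerX (genusCurve (n + 1)) + 2 * V + (S₁ + S₂) := by ring

end DoubleHurwitz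

end

/-! ### A common polydisc of convergence and analyticity -/

noncomputable section

namespace DoubleHurwitz

open MvPowerSeries

/-! ### Summation of the majorants -/

theorem monomialSubst_mono {w w' : σ → Maj τ} (h : ∀ v, w v ≤ w' v) (m : σ →₀ ℕ) :
    monomialSubst w m ≤ monomialSubst w' m := by
  induction m using Finsupp.induction_linear with
  | zero => rw [monomialSubst_zero, monomialSubst_zero]
  | add m m' h h' => rw [monomialSubst_add, monomialSubst_add]; exact mul_le_mul' h h'
  | single v e =>
    rw [monomialSubst_single, monomialSubst_single]; exact pow_le_pow_left' (h v) e

theorem subst_mono_left {w w' : σ → Maj τ} (h : ∀ v, w v ≤ w' v) (A : Maj σ) :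
    subst w A ≤ subst w' A :=
  esum_le_esum fun m => mul_le_mul' le_rfl (monomialSubst_mono h m)

/-- The value of a majorant at a point. -/
def value (w : σ → ENNReal) : Maj σ →+* ENNReal :=
  (constantCoeff (σ := Empty)).comp (subst fun v => C (w v))

theorem value_apply (w : σ → ENNReal) (A : Maj σ) :
    value w A = ∑' m : σ →₀ ℕ, coeff m A * m.prod fun v e => w v ^ e := by
  rw [value, RingHom.comp_apply, ← coeff_zero_eq_constantCoeff_apply, subst_apply, coeff_esum]
  refine tsum_congr fun m => ?_
  rw [coeff_C_mul, coeff_zero_eq_constantCoeff_apply]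
  simp only [monomialSubst, Finsupp.prod, map_prod, map_pow, constantCoeff_C]

theorem value_C (w : σ → ENNReal) (a : ENNReal) : value w (C a) = a := by
  rw [value, RingHom.comp_apply, subst_C, constantCoeff_C]

theorem value_mono (w : σ → ENNReal) {A B : Maj σ} (h : A ≤ B) : value w A ≤ value w B :=
  subst_mono _ h 0

theorem value_subst (w : σ → Maj τ) (w' : τ → ENNReal) (A : Maj σ) :
    value w' (subst w A) = value (fun v => value w' (w v)) A := by
  have : ∀ B : Maj Empty, B = C (constantCoeff B) := by
    intro B
    ext m
    rw [Subsingleton.elim m 0, coeff_zero_eq_constantCoeff_apply, coeff_zero_eq_constantCoeff_apply,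
      constantCoeff_C]
  rw [value, RingHom.comp_apply, subst_subst, value, RingHom.comp_apply]
  congr 2
  congr 1
  funext v
  exact this _

theorem value_X (w : σ → ENNReal) (v : σ) : value w (X v) = w v := by
  rw [value, RingHom.comp_apply, subst_X, constantCoeff_C]

theorem value_geom (a r : ENNReal) : value (fun _ => r) (geom a) = (1 - a * r)⁻¹ := by
  rw [value_apply, ← ENNReal.tsum_geometric]
  let e : ℕ ≃ (Unit →₀ ℕ) :=
    ⟨fun n => Finsupp.single () n, fun m => m (), fun n => by simp, fun m => by
      ext; simp⟩
  rw [← e.tsum_eq]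
  refine tsum_congr fun n => ?_
  change PowerSeries.coeff n (geom a) * (Finsupp.single () n).prod (fun _ e => r ^ e) = _
  rw [geom, PowerSeries.coeff_mk, 
    Finsupp.prod_single_index (h := fun _ e => r ^ e) (pow_zero _), mul_pow]

/-- At x = β = 1/100 one has 8 (x + 8β) = 72/100 < 1, so the geometric series converges, whatever
the exponent. -/
theorem Tame.value_ne_top {A : Maj (Fin 2)} (h : Tame A) : value (fun _ => 100⁻¹) A ≠ ⊤ := by
  obtain ⟨M, N, hM, hA⟩ := h
  refine ne_top_of_le_ne_top ?_ (value_mono _ hA)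
  rw [map_mul, value_C, map_pow, map_pow]
  refine ENNReal.mul_ne_top hM (ENNReal.pow_ne_top ?_)
  rw [shear, value_subst, map_add, map_mul, map_ofNat, value_X, value_X, value_geom]
  refine ENNReal.inv_ne_top.mpr (tsub_pos_of_lt ?_).ne'
  have : (8 : ENNReal) * (100⁻¹ + 8 * 100⁻¹) = 72 * 100⁻¹ := by ring
  rw [this, ← div_eq_mul_inv, ENNReal.div_lt_iff (by norm_num) (by norm_num)]
  norm_num

theorem cube_le_four_pow (k : ℕ) : k ^ 3 ≤ 4 ^ k := by
  rcases Nat.lt_or_ge k 3 with h | h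
  · interval_cases k <;> norm_num
  · induction k, h using Nat.le_induction with
    | base => norm_num
    | succ k hk ih =>
      have : (k + 1) ^ 3 ≤ 4 * k ^ 3 := by
        nlinarith [Nat.mul_le_mul hk hk, Nat.mul_le_mul (Nat.mul_le_mul hk hk) hk]
      rw [pow_succ 4]
      omega

/-- Here 1/400 = 1/4 · 1/100: the factor 4^{-k} lies below k^{-3}, and 100^{-k} is x^k. -/
theorem curve_lower_bound (v : Var) :
    (400⁻¹ : ENNReal) ^ weight v ≤ value (fun _ => 100⁻¹) (curve v) := by
  have h4 : (400⁻¹ : ENNReal) = 4⁻¹ * 100⁻¹ := by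
    rw [← ENNReal.mul_inv (by norm_num) (by norm_num)]; norm_num
  have hcube : ∀ k : ℕ+, (4⁻¹ : ENNReal) ^ (k : ℕ) ≤ (((k : ℕ) : ENNReal) ^ 3)⁻¹ := by
    intro k
    rw [← ENNReal.inv_pow]
    refine ENNReal.inv_le_inv.mpr ?_
    exact_mod_cast cube_le_four_pow k
  have hle : (400⁻¹ : ENNReal) ≤ 4⁻¹ := ENNReal.inv_le_inv.mpr (by norm_num)
  cases v with
  | beta =>
    rw [weight, pow_one, curve, value_X]
    exact ENNReal.inv_le_inv.mpr (by norm_num)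
  | Q =>
    rw [weight, pow_one, curve, map_one]
    exact ENNReal.inv_le_one.mpr (by norm_num)
  | t k =>
    rw [weight, curve, map_mul, value_C, map_pow, value_X, h4, mul_pow]
    refine mul_le_mul' ((hcube k).trans (le_of_eq ?_)) le_rfl
    rw [invSq, ← ENNReal.mul_inv (.inr (ENNReal.natCast_ne_top _)) (.inr (pnat_cast_ne_zero k)),
      ← pow_succ]
  | tbar k =>
    rw [weight, curve, value_C]
    exact (pow_le_pow_left' hle _).trans (hcube k)

theorem value_genusMaj_ne_top (n : ℕ) :
    value (fun v => (400⁻¹ : ENNReal) ^ weight v) (genusMaj n) ≠ ⊤ := by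
  refine ne_top_of_le_ne_top (tame_genusCurve n).value_ne_top ?_
  rw [genusCurve, evalCurve, value_subst]
  exact subst_mono_left (fun v => Maj.C_le_C (curve_lower_bound v)) _ 0

theorem summable_genusPart (n : ℕ) : Summable fun m : Var →₀ ℕ =>
    ‖coeff m (genusPart n) * m.prod fun v e => (((400⁻¹ : ℝ) : ℂ) ^ weight v) ^ e‖ := by
  have h := value_genusMaj_ne_top n
  rw [value_apply] at h
  have h2 : ∀ m : Var →₀ ℕ, coeff m (genusMaj n) *
      (m.prod fun v e => ((400⁻¹ : ENNReal) ^ weight v) ^ e) =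
      ‖coeff m (genusPart n) * m.prod fun v e => (((400⁻¹ : ℝ) : ℂ) ^ weight v) ^ e‖ₑ := by
    intro m
    have hr : ‖((400⁻¹ : ℝ) : ℂ)‖ₑ = (400⁻¹ : ENNReal) := by
      rw [← ofReal_norm, Complex.norm_real, Real.norm_of_nonneg (by norm_num),
        ENNReal.ofReal_inv_of_pos (by norm_num)]
      norm_num
    have hp : ∀ (s : Finset Var) (f : Var → ℂ), ‖∏ v ∈ s, f v‖ₑ = ∏ v ∈ s, ‖f v‖ₑ := by
      intro s f
      simp only [enorm, nnnorm_prod]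
      exact map_prod ENNReal.ofNNRealHom _ _
    rw [enorm_mul, Finsupp.prod, Finsupp.prod, hp]
    simp only [enorm_pow, hr]
    rfl
  simp only [h2] at h
  have h3 := ENNReal.summable_toReal h
  simpa only [toReal_enorm] using h3

/-! ### Analyticity -/

/-- The coordinate function of a variable. -/
def coordinate (v : Var) : BoundedPoints →L[ℂ] ℂ := lp.evalCLM ℂ (fun _ : Var => ℂ) ⊤ v

theorem norm_coordinate_le (v : Var) : ‖coordinate v‖ ≤ 1 :=
  ContinuousLinearMap.opNorm_le_bound _ zero_le_one fun u => by
    rw [one_mul]; exact lp.norm_apply_le_norm ENNReal.top_ne_zero u v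

/-- The variables of a monomial, with multiplicities. -/
def variableList (m : Var →₀ ℕ) : List Var := m.toMultiset.toList

/-- The product of the coordinates of a monomial, as a multilinear map. -/
def coordinateProduct (m : Var →₀ ℕ) (d : ℕ) : BoundedPoints [×d]→L[ℂ] ℂ :=
  (ContinuousMultilinearMap.mkPiAlgebraFin ℂ d ℂ).compContinuousLinearMap
    -- The default is used only when d exceeds the length of the list, and such terms have
    -- coefficient 0 in `multilinearSeries`.
    fun i => coordinate ((variableList m).getD i Var.beta)

theorem norm_coordinateProduct_le (m : Var →₀ ℕ) (d : ℕ) : ‖coordinateProduct m d‖ ≤ 1 := by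
  refine (ContinuousMultilinearMap.norm_compContinuousLinearMap_le _ _).trans ?_
  rw [ContinuousMultilinearMap.norm_mkPiAlgebraFin, one_mul]
  exact Finset.prod_le_one (fun _ _ => norm_nonneg _) fun _ _ => norm_coordinate_le _

theorem coordinateProduct_apply (m : Var →₀ ℕ) (u : BoundedPoints) :
    coordinateProduct m (variableList m).length (fun _ => u) = monomialValue m u := by
  have h1 : coordinateProduct m (variableList m).length (fun _ => u) =
      ((variableList m).map u).prod := by
    rw [coordinateProduct, ContinuousMultilinearMap.compContinuousLinearMap_apply,
      ContinuousMultilinearMap.mkPiAlgebraFin_apply]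
    congr 1
    refine List.ext_getElem (by simp) fun i h1 h2 => ?_
    simp only [List.getElem_ofFn, List.getElem_map]
    rw [List.getD_eq_getElem]
    rfl
  rw [h1, variableList, ← Multiset.prod_coe, ← Multiset.map_coe, Multiset.coe_toList,
    Finsupp.toMultiset_map, Finsupp.prod_toMultiset,
    Finsupp.prod_mapDomain_index (fun _ => pow_zero _) (fun _ _ _ => pow_add _ _ _)]
  rfl

theorem norm_monomialValue_le (m : Var →₀ ℕ) {u : BoundedPoints} (hu : ‖u‖ ≤ 1) :
    ‖monomialValue m u‖ ≤ 1 := by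
  rw [monomialValue, Finsupp.prod, norm_prod]
  refine Finset.prod_le_one (fun _ _ => norm_nonneg _) fun v _ => ?_
  rw [norm_pow]
  exact pow_le_one₀ (norm_nonneg _) ((lp.norm_apply_le_norm ENNReal.top_ne_zero u v).trans hu)

/-- The formal multilinear series of a power series in bounded families. -/
def multilinearSeries (a : (Var →₀ ℕ) → ℂ) : FormalMultilinearSeries ℂ BoundedPoints ℂ :=
  fun d => ∑' m : Var →₀ ℕ,
    (if (variableList m).length = d then a m else 0) • coordinateProduct m d

theorem norm_multilinear_term_le (a : (Var →₀ ℕ) → ℂ) (m : Var →₀ ℕ) (d : ℕ) :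
    ‖(if (variableList m).length = d then a m else 0) • coordinateProduct m d‖ ≤ ‖a m‖ := by
  rw [norm_smul]
  refine (mul_le_of_le_one_right (norm_nonneg _) (norm_coordinateProduct_le m d)).trans ?_
  split_ifs
  · exact le_rfl
  · simp

/-- Monomials have absolute value at most 1 on the unit ball, so summability of the coefficients
gives absolute convergence there, bounds every homogeneous component by the same constant, and
permits grouping the monomials by degree. -/
theorem hasFPowerSeriesOnBall_multilinearSeries {a : (Var →₀ ℕ) → ℂ}
    (ha : Summable fun m => ‖a m‖) :
    HasFPowerSeriesOnBall (fun u : BoundedPoints => ∑' m, a m * monomialValue m u)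
      (multilinearSeries a) 0 1 := by
  have hs : ∀ d, Summable fun m : Var →₀ ℕ =>
      (if (variableList m).length = d then a m else 0) • coordinateProduct m d := fun d =>
    Summable.of_norm_bounded ha fun m => norm_multilinear_term_le a m d
  refine ⟨?_, zero_lt_one, fun {u} hu => ?_⟩
  · refine (multilinearSeries a).le_radius_of_bound (r := 1) (∑' m, ‖a m‖) fun d => ?_
    rw [NNReal.coe_one, one_pow, mul_one]
    exact tsum_of_norm_bounded ha.hasSum fun m => norm_multilinear_term_le a m d
  · have hu1 : ‖u‖ ≤ 1 := by
      rw [← ENNReal.coe_one, Metric.eball_coe, mem_ball_zero_iff] at hu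
      exact hu.le
    rw [zero_add]
    have h1 : Summable fun m => a m * monomialValue m u := by
      refine Summable.of_norm_bounded ha fun m => ?_
      rw [norm_mul]
      exact mul_le_of_le_one_right (norm_nonneg _) (norm_monomialValue_le m hu1)
    have h2 := (Equiv.sigmaFiberEquiv fun m : Var →₀ ℕ => (variableList m).length).hasSum_iff.mpr
      h1.hasSum
    refine h2.sigma fun d => ?_
    have h3 := (hs d).hasSum.mapL (ContinuousMultilinearMap.apply ℂ (fun _ : Fin d => BoundedPoints)
      ℂ fun _ => u)
    refine (hasSum_subtype_iff_indicator (f := fun m => a m * monomialValue m u)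
      (s := {m | (variableList m).length = d})).mpr ?_
    refine Eq.mp (congrArg (fun f => HasSum f _) (funext fun m => ?_)) h3
    symm
    by_cases hm : (variableList m).length = d
    · rw [Set.indicator_of_mem (show m ∈ {m' | (variableList m').length = d} from hm), if_pos hm]
      subst hm
      rw [map_smul, ContinuousMultilinearMap.apply_apply, coordinateProduct_apply, smul_eq_mul]
    · rw [Set.indicator_of_notMem (show m ∉ {m' | (variableList m').length = d} from hm),
        if_neg hm, map_smul, zero_smul]

theorem monomialValue_point (R : ℝ) (u : BoundedPoints) (m : Var →₀ ℕ) :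
    monomialValue m (point R u) =
      (m.prod fun v e => ((R : ℂ) ^ weight v) ^ e) * monomialValue m u := by
  simp only [monomialValue, point, mul_pow, Finsupp.prod, Finset.prod_mul_distrib]

theorem analyticOnPolydisc_of_summable {A : Series ℂ} {R : ℝ} (h : Summable fun m : Var →₀ ℕ =>
    ‖coeff m A * m.prod fun v e => ((R : ℂ) ^ weight v) ^ e‖) : AnalyticOnPolydisc A R := by
  refine ⟨fun u hu => ?_, ?_⟩
  · refine Summable.of_nonneg_of_le (fun _ => norm_nonneg _) (fun m => ?_) h
    rw [monomialValue_point, ← mul_assoc, norm_mul]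
    exact mul_le_of_le_one_right (norm_nonneg _)
      (norm_monomialValue_le m (mem_ball_zero_iff.mp hu).le)
  · have h1 := (hasFPowerSeriesOnBall_multilinearSeries h).analyticOnNhd
    rw [← ENNReal.coe_one, Metric.eball_coe] at h1
    simp only [monomialValue_point, ← mul_assoc]
    exact h1

theorem analyticOnPolydisc_genusPart (n : ℕ) : AnalyticOnPolydisc (genusPart n) 400⁻¹ :=
  analyticOnPolydisc_of_summable (summable_genusPart n)

end DoubleHurwitz

end

/-! ### The theorem -/

theorem mainTheorem3 :
    ∃ F : ℕ → DoubleHurwitz.Series ℂ,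
      -- the expansion in powers of the square of the Planck constant
      DoubleHurwitz.HasGenusExpansion (DoubleHurwitz.formalLog DoubleHurwitz.Zhbar) F ∧
      -- the evolution equations and the initial conditions
      (∀ n : ℕ, DoubleHurwitz.CutJoinEq F n ∧ DoubleHurwitz.InitialCond F n) ∧
      -- they determine the coefficients recursively
      (∀ (G : ℕ → DoubleHurwitz.Series ℂ) (N : ℕ),
        (∀ n ≤ N, DoubleHurwitz.CutJoinEq G n ∧ DoubleHurwitz.InitialCond G n) →
          ∀ n ≤ N, G n = F n) ∧
      -- the coefficients are analytic in a common domain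
      (∃ R : ℝ, 0 < R ∧ ∀ n : ℕ, DoubleHurwitz.AnalyticOnPolydisc (F n) R) := by
  have h : ∀ n, DoubleHurwitz.CutJoinEq DoubleHurwitz.genusPart n ∧
      DoubleHurwitz.InitialCond DoubleHurwitz.genusPart n := fun n =>
    ⟨DoubleHurwitz.cutJoinEq_genusPart n, DoubleHurwitz.initialCond_genusPart n⟩
  exact ⟨DoubleHurwitz.genusPart, DoubleHurwitz.hasGenusExpansion, h,
    fun _ _ hG => DoubleHurwitz.eq_of_cutJoinEq (fun n _ => h n) hG,
    400⁻¹, by norm_num, DoubleHurwitz.analyticOnPolydisc_genusPart⟩
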